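/- Let $N_{\mathrm{spl}}, N_{\mathrm{ns}}$ be coprime positive integers and $N = N_{\mathrm{spl}} N_{\mathrm{ns}}$. Let $\Delta_1,\Delta_2<0$ be coprime fundamental discriminants which are Heegner discriminants for $\mathrm{Car}(N_{\mathrm{spl}},N_{\mathrm{ns}})$: for $i=1,2$ the Kronecker symbol satisfies $\left(\frac{\Delta_i}{q}\right)=1$ for every prime $q\mid N_{\mathrm{spl}}$ and $\left(\frac{\Delta_i}{q}\right)=-1$ for every prime $q\mid N_{\mathrm{ns}}$. Let $t\in\mathbb{Z}$ with $t\equiv\Delta_1\Delta_2 \pmod 2$ and $t^2\neq\Delta_1\Delta_2$. Let $B_t$ be the Clifford algebra over $\mathbb{Q}$ of the quadratic form $\Delta_1X^2+2tXY+\Delta_2Y^2$, that is, the quaternion algebra $\mathbb{Q}+\mathbb{Q}e_1+\mathbb{Q}e_2+\mathbb{Q}e_1e_2$ with $e_1^2=\Delta_1$, $e_2^2=\Delta_2$, $e_1e_2+e_2e_1=2t$, and let $S_t\subset B_t$ be the order generated as a ring by $\gamma_i=(\Delta_i+e_i)/2$, $i=1,2$. For an order $S$ of $B_t$, let $\mathrm{disc}(S)$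 be its reduced discriminant. For a prime $p$, call $S$ residually split (resp. residually inert) at $p$ if $S\otimes\mathbb{Z}_p$ contains a $\mathbb{Z}_p$-subalgebra isomorphic to $\mathbb{Z}_p\times\mathbb{Z}_p$ (resp. to $\mathbb{Z}_{p^2}=W(\mathbb{F}_{p^2})$). A mixed Cartan order of type $(N_{\mathrm{spl}},N_{\mathrm{ns}})$ is an order $S$ that is residually split or residually inert at each prime $p\mid\mathrm{disc}(S)$, has index $[R:S]=N^2$ in any maximal order $R\supseteq S$, is residually split at every prime dividing $N_{\mathrm{spl}}$, and is residually inert at every prime dividing $N_{\mathrm{ns}}$. Let $\mathrm{Car}_t(N_{\mathrm{spl}},N_{\mathrm{ns}})$ be the set of mixed Cartan orders $R$ of type $(N_{\mathrm{spl}},N_{\mathrm{ns}})$ with $S_t\subseteq R\subset B_t$. For a prime $p\mid\mathrm{disc}(S_t)$, let $\epsilon(p)\in\{\pm1\}$ be the value, at any prime above $p$ of $F=\mathbb{Q}(\sqrt{\Delta_1\Delta_2})$, of the genus character attached to the quadratic extension $\mathbb{Q}(\sqrt{\Delta_1},\sqrt{\Delta_2})/F$: it is $1$ at the primes of $F$ that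 split in this extension and $-1$ at the primes that are inert in it. Assume that $N^2\mid\mathrm{disc}(S_t)$. Then $\mathrm{Car}_t(N_{\mathrm{spl}},N_{\mathrm{ns}})$ is finite and $$|\mathrm{Car}_t(N_{\mathrm{spl}},N_{\mathrm{ns}})|=\prod_{\substack{p\,\mid\,\mathrm{disc}(S_t)\\ \epsilon(p)=1}}\left(1+\mathrm{ord}_p\!\left(\frac{\Delta_1\Delta_2-t^2}{4N^2}\right)\right),$$ where $p$ runs over primes. -/

import Mathlib

/-! ### Discriminants, the Kronecker symbol and Heegner discriminants -/

/-- `Δ` is a fundamental discriminant: either `Δ ≡ 1 mod 4` is squarefree, or `Δ = 4 m` with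
`m` squarefree and `m ≡ 2, 3 mod 4`.  (The value `1` is not excluded here; it is positive.) -/
def IsFundamentalDiscriminant (Δ : ℤ) : Prop :=
  (Δ % 4 = 1 ∧ Squarefree Δ) ∨
    ∃ m : ℤ, Δ = 4 * m ∧ (m % 4 = 2 ∨ m % 4 = 3) ∧ Squarefree m

/-- The Kronecker symbol `(a / q)` at a prime number `q`: the Legendre symbol for odd `q`;
for `q = 2` it is `0`, `1`, `-1` according as `a` is even, `±1 mod 8`, `±3 mod 8`. -/
def kroneckerAtPrime (a : ℤ) (q : ℕ) : ℤ :=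
  if q = 2 then ZMod.χ₈ (a : ZMod 8) else jacobiSym a q

/-- The condition, on a discriminant `Δ`, to be a Heegner discriminant for `Car(Nspl, Nns)`. -/
def IsHeegner (Nspl Nns : ℕ) (Δ : ℤ) : Prop :=
  (∀ q : ℕ, q.Prime → q ∣ Nspl → kroneckerAtPrime Δ q = 1) ∧
    (∀ q : ℕ, q.Prime → q ∣ Nns → kroneckerAtPrime Δ q = -1)

/-! ### The genus character -/

/-- The compositum `L = K₁K₂ = ℚ(√Δ₁, √Δ₂)`, inside `ℂ`. -/
noncomputable abbrev compositumField (Δ₁ Δ₂ : ℤ) : IntermediateField ℚ ℂ :=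
  IntermediateField.adjoin ℚ {z : ℂ | z ^ 2 = (Δ₁ : ℂ) ∨ z ^ 2 = (Δ₂ : ℂ)}

/-- The quadratic field `F = ℚ(√(Δ₁Δ₂))`, inside the compositum `L`. -/
noncomputable abbrev productField (Δ₁ Δ₂ : ℤ) : IntermediateField ℚ (compositumField Δ₁ Δ₂) :=
  IntermediateField.adjoin ℚ
    {z : compositumField Δ₁ Δ₂ | z ^ 2 = (Δ₁ : compositumField Δ₁ Δ₂) * Δ₂}

open Classical in
/-- The value at a nonzero prime `𝔮` of `F` of the genus character attached to the quadratic
extension `L / F`, i.e. the Artin symbol of `𝔮` in `Gal(L / F) = {1, -1}`: it is `1` if `𝔮` splits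
into two primes of `L` and `-1` if `𝔮` is inert.  (For coprime fundamental discriminants
`L / F` is unramified at every nonzero prime, so there is no third case.) -/
noncomputable def genusCharacter (Δ₁ Δ₂ : ℤ)
    (𝔮 : Ideal (NumberField.RingOfIntegers (productField Δ₁ Δ₂))) : ℤ :=
  if (𝔮.primesOver (NumberField.RingOfIntegers (compositumField Δ₁ Δ₂))).ncard = 2
  then 1 else -1

open Classical in
/-- `ε(p)`: the value of the genus character at any prime of `F` above `p`.  (The primes
above `p` are conjugate and `L / ℚ` is Galois, so that the choice does not matter.) -/
noncomputable def genusEpsilon (Δ₁ Δ₂ : ℤ) (p : ℕ) : ℤ :=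
  if ∃ 𝔮 ∈ (Ideal.span {(p : ℤ)}).primesOver
      (NumberField.RingOfIntegers (productField Δ₁ Δ₂)), genusCharacter Δ₁ Δ₂ 𝔮 = 1
  then 1 else -1

/-! ### Orders in quaternion algebras over `ℚ` -/

section Orders

variable {B : Type*} [Ring B] [Algebra ℚ B]

/-- `S` is a `ℤ`-order of `B`: a subring that is a full `ℤ`-lattice. -/
def IsZOrder (S : Subring B) : Prop :=
  Module.Finite ℤ S ∧ Submodule.span ℚ (S : Set B) = ⊤

/-- `R` is a maximal order of `B`. -/
def IsMaximalZOrder (R : Subring B) : Prop :=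
  IsZOrder R ∧ ∀ R' : Subring B, IsZOrder R' → R ≤ R' → R' = R

/-- The reduced trace of a quaternion algebra: half of the trace of left multiplication. -/
noncomputable def reducedTrace (x : B) : ℚ :=
  LinearMap.trace ℚ B (LinearMap.mulLeft ℚ x) / 2

/-- The standard involution of a quaternion algebra. -/
noncomputable def quatConj (x : B) : B := algebraMap ℚ B (reducedTrace x) - x

/-- The form `(x, y, z) ↦ trd ((x y - y x) z̄)`. -/
noncomputable def discForm (x y z : B) : ℚ :=
  reducedTrace ((x * y - y * x) * quatConj z)

/-- The reduced discriminant of an order `S` in a quaternion algebra, as a natural number: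
the nonnegative generator of the ideal of `ℤ` that is generated by the values of
`trd ((x y - y x) z̄)` for `x, y, z ∈ S`. -/
noncomputable def reducedDisc (S : Subring B) : ℕ :=
  Ideal.absNorm (Submodule.comap (Algebra.linearMap ℤ ℚ)
    (Submodule.span ℤ {r : ℚ | ∃ x ∈ S, ∃ y ∈ S, ∃ z ∈ S, r = discForm x y z}))

/-- `S_p = ℤ_p ⊗ S` contains a `ℤ_p`-subalgebra isomorphic to `ℤ_p × ℤ_p`. -/
def ResiduallySplitAt (p : ℕ) [Fact p.Prime] (S : Subring B) : Prop :=
  ∃ f : (ℤ_[p] × ℤ_[p]) →ₐ[ℤ_[p]] TensorProduct ℤ ℤ_[p] S, Function.Injective f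

/-- The structure map from `ℤ_p = W(𝔽_p)` to `ℤ_{p²} = W(𝔽_{p²})`. -/
noncomputable def padicToWitt (p : ℕ) [Fact p.Prime] :
    ℤ_[p] →+* WittVector p (GaloisField p 2) :=
  (WittVector.map (algebraMap (ZMod p) (GaloisField p 2))).comp
    (WittVector.equiv p).symm.toRingHom

/-- `S_p = ℤ_p ⊗ S` contains a `ℤ_p`-subalgebra isomorphic to `ℤ_{p²} = W(𝔽_{p²})`. -/
def ResiduallyInertAt (p : ℕ) [Fact p.Prime] (S : Subring B) : Prop :=
  ∃ f : WittVector p (GaloisField p 2) →+* TensorProduct ℤ ℤ_[p] S,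
    Function.Injective f ∧
      ∀ z : ℤ_[p], f (padicToWitt p z) = algebraMap ℤ_[p] (TensorProduct ℤ ℤ_[p] S) z

/-- `S` is residually split or residually inert at every prime that divides its reduced
discriminant. -/
def IsResiduallyUnramified (S : Subring B) : Prop :=
  ∀ (p : ℕ) [Fact p.Prime], p ∣ reducedDisc S → ResiduallySplitAt p S ∨ ResiduallyInertAt p S

/-- `S` is a mixed Cartan order of type `(Nspl, Nns)`: a residually unramified order, of index
`N ^ 2` with `N = Nspl * Nns` in any maximal order that contains it, residually split at the primes
that divide `Nspl` and residually inert at the primes that divide `Nns`. -/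
structure IsMixedCartanOrder (Nspl Nns : ℕ) (S : Subring B) : Prop where
  isZOrder : IsZOrder S
  residuallyUnramified : IsResiduallyUnramified S
  index_eq : ∀ R : Subring B, IsMaximalZOrder R → S ≤ R →
    S.toAddSubgroup.relIndex R.toAddSubgroup = (Nspl * Nns) ^ 2
  split_of_dvd : ∀ (p : ℕ) [Fact p.Prime], p ∣ Nspl → ResiduallySplitAt p S
  inert_of_dvd : ∀ (p : ℕ) [Fact p.Prime], p ∣ Nns → ResiduallyInertAt p S

end Orders

/-! ### The Clifford order -/

/-- The binary quadratic form `Δ₁ X² + 2 t X Y + Δ₂ Y²` over `ℚ`. -/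
noncomputable def binaryForm (Δ₁ Δ₂ t : ℤ) : QuadraticForm ℚ (ℚ × ℚ) :=
  (Δ₁ : ℚ) • QuadraticMap.linMulLin (LinearMap.fst ℚ ℚ ℚ) (LinearMap.fst ℚ ℚ ℚ) +
    (2 * t : ℚ) • QuadraticMap.linMulLin (LinearMap.fst ℚ ℚ ℚ) (LinearMap.snd ℚ ℚ ℚ) +
    (Δ₂ : ℚ) • QuadraticMap.linMulLin (LinearMap.snd ℚ ℚ ℚ) (LinearMap.snd ℚ ℚ ℚ)

theorem binaryForm_apply (Δ₁ Δ₂ t : ℤ) (x y : ℚ) :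
    binaryForm Δ₁ Δ₂ t (x, y) = Δ₁ * x ^ 2 + 2 * t * x * y + Δ₂ * y ^ 2 := by
  simp [binaryForm]
  ring

/-- The Clifford algebra `B_t` of the form `Δ₁ X² + 2 t X Y + Δ₂ Y²`.  Its generators
`e₁ = ι (1, 0)` and `e₂ = ι (0, 1)` satisfy `e₁² = Δ₁`, `e₂² = Δ₂`, `e₁ e₂ + e₂ e₁ = 2 t`. -/
abbrev CliffordQuat (Δ₁ Δ₂ t : ℤ) : Type := CliffordAlgebra (binaryForm Δ₁ Δ₂ t)

/-- `γ₁ = (Δ₁ + e₁) / 2`. -/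
noncomputable def cliffordGen₁ (Δ₁ Δ₂ t : ℤ) : CliffordQuat Δ₁ Δ₂ t :=
  (1 / 2 : ℚ) • (algebraMap ℚ _ (Δ₁ : ℚ) + CliffordAlgebra.ι (binaryForm Δ₁ Δ₂ t) (1, 0))

/-- `γ₂ = (Δ₂ + e₂) / 2`. -/
noncomputable def cliffordGen₂ (Δ₁ Δ₂ t : ℤ) : CliffordQuat Δ₁ Δ₂ t :=
  (1 / 2 : ℚ) • (algebraMap ℚ _ (Δ₂ : ℚ) + CliffordAlgebra.ι (binaryForm Δ₁ Δ₂ t) (0, 1))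

/-- The Clifford order `S_t`: the subring of `B_t` generated by `γ₁` and `γ₂`. -/
noncomputable def cliffordOrder (Δ₁ Δ₂ t : ℤ) : Subring (CliffordQuat Δ₁ Δ₂ t) :=
  Subring.closure {cliffordGen₁ Δ₁ Δ₂ t, cliffordGen₂ Δ₁ Δ₂ t}

/-- `Car_t(Nspl, Nns)`: the mixed Cartan orders of type `(Nspl, Nns)` in `B_t` that contain `S_t`. -/
def mixedCartanOver (Δ₁ Δ₂ t : ℤ) (Nspl Nns : ℕ) : Set (Subring (CliffordQuat Δ₁ Δ₂ t)) :=
  {R | IsMixedCartanOrder Nspl Nns R ∧ cliffordOrder Δ₁ Δ₂ t ≤ R}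

set_option linter.unusedSimpArgs false

/-! Put c = (t² - Δ₁Δ₂)/4, a nonzero integer. The commutator j = γ₁γ₂ - γ₂γ₁ satisfies j² = c and
jγ₁ = (Δ₁ - γ₁)j, so B_t = K + Kj with K = ℚ(γ₁) = ℚ(√Δ₁), and disc(S_t) = |c|
(`reducedDisc_cliffordOrder`). Since Δ₁ and Δ₂ are coprime, every prime p misses one of them, say
Δ₁; the other case is symmetric. Then O = ℤ_p[γ₁] is unramified over ℤ_p, and S_t ⊗ ℤ_p = O + Oj
(`exists_isCompletionAt`).

A ring of finite index over O + Oj is an O-bimodule. Left and right multiplication by O agree on the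
first summand and differ by conjugation on the second, so the ring is the sum of its parts in the
two summands. Boundedness of powers makes the first part equal to O; the second is Ij for a
fractional ideal I ⊇ O with c I Ī ⊆ O. If O = ℤ_p × ℤ_p, then I = p^(-k)ℤ_p × p^(-l)ℤ_p with k + l ≤
ord_p c and the index is p^(k+l), which gives m + 1 rings of index p^m for m ≤ ord_p c
(`SplitRoots.overrings_eq`). If O = W(𝔽_{p²}), then I = p^(-k)O with 2k ≤ ord_p c and the index is
p^(2k), which gives one ring for each even exponent (`inert_overrings`).

The overrings of S_t of a given index are products of local choices (`ncard_overrings_prod`,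
`IsCompletionAt.ncard_overrings`). A local overring below the maximal exponent can be enlarged, so
all maximal orders over S_t have the same index over it, and having index N² in them amounts to
having a fixed index over S_t (`index_in_maximal_iff`). The residual conditions are then automatic:
an overring R contains γ₁ and γ₂, so ℤ_p ⊗ R contains O at every p, and the Heegner hypothesis makes
O split at p ∣ Nspl and inert at p ∣ Nns. Hence Car_t is the set of overrings of one fixed index,
and p ∣ c contributes 1 + ord_p c - 2 ord_p N if O splits and 1 if O is inert.

It remains to match the splitting of O with ε(p) = 1 for p ∣ c (`genusEpsilon_eq_one_iff`). The
integers of F are ℤ + ℤδ with δ = (t + √(Δ₁Δ₂))/2, and δ(t - δ) = c. So a prime 𝔮 of F above p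
contains δ or t - δ, and its residue field is 𝔽_p. As L = F(γ₁), the prime 𝔮 splits in L exactly
when the polynomial of γ₁ has a root in 𝔽_p, which is also the criterion for O to split. -/

/-- The rings between `S` and the ambient ring in which `S` has index `m`. -/
def overrings {B : Type*} [Ring B] (S : Subring B) (m : ℕ) : Set (Subring B) :=
  {R | S ≤ R ∧ S.toAddSubgroup.relIndex R.toAddSubgroup = m}

/-! ### Overrings whose index factors into coprime parts -/

section Coprime

variable {B : Type*} [Ring B] {S : Subring B}

theorem nsmul_mem_of_mem_overrings {m : ℕ} {R : Subring B} (hR : R ∈ overrings S m) {x : B}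
    (hx : x ∈ R) : m • x ∈ S := by
  have h := (S.toAddSubgroup.addSubgroupOf R.toAddSubgroup).nsmul_index_mem ⟨x, hx⟩
  have h2 : (S.toAddSubgroup.addSubgroupOf R.toAddSubgroup).index = m := hR.2
  rw [h2, AddSubgroup.mem_addSubgroupOf] at h
  exact h

/-- The elements of `R` that a power of `a` moves into `S`. -/
def primaryPart (S R : Subring B) (a : ℕ) : Subring B where
  carrier := {x | x ∈ R ∧ ∃ k : ℕ, a ^ k • x ∈ S}
  mul_mem' := by
    rintro x y ⟨hx, k, hk⟩ ⟨hy, l, hl⟩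
    refine ⟨R.mul_mem hx hy, k + l, ?_⟩
    have := S.mul_mem hk hl
    rwa [smul_mul_smul_comm, ← pow_add] at this
  one_mem' := ⟨R.one_mem, 0, by simp⟩
  add_mem' := by
    rintro x y ⟨hx, k, hk⟩ ⟨hy, l, hl⟩
    refine ⟨R.add_mem hx hy, k + l, ?_⟩
    rw [smul_add]
    refine S.add_mem ?_ ?_
    · rw [pow_add, mul_comm, mul_smul]
      exact S.nsmul_mem hk _
    · rw [pow_add, mul_smul]
      exact S.nsmul_mem hl _
  zero_mem' := ⟨R.zero_mem, 0, by simp⟩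
  neg_mem' := by
    rintro x ⟨hx, k, hk⟩
    exact ⟨R.neg_mem hx, k, by rw [smul_neg]; exact S.neg_mem hk⟩

theorem le_primaryPart {R : Subring B} (h : S ≤ R) (a : ℕ) : S ≤ primaryPart S R a :=
  fun x hx => ⟨h hx, 0, by simpa using hx⟩

theorem primaryPart_le (R : Subring B) (a : ℕ) : primaryPart S R a ≤ R := fun _ hx => hx.1

theorem mem_of_coprime_nsmul_mem {a b : ℕ} (hab : a.Coprime b) {x : B} (ha : a • x ∈ S)
    (hb : b • x ∈ S) : x ∈ S := by
  have h := Nat.gcd_eq_gcd_ab a b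
  rw [hab.gcd_eq_one] at h
  have : x = (Nat.gcdA a b) • (a • x) + (Nat.gcdB a b) • (b • x) := by
    rw [← natCast_zsmul x a, ← natCast_zsmul x b, smul_smul, smul_smul, ← add_smul, mul_comm _ (a : ℤ),
      mul_comm _ (b : ℤ), ← h]
    simp
  rw [this]
  exact S.add_mem (S.zsmul_mem ha _) (S.zsmul_mem hb _)

theorem exists_add_of_coprime {a b : ℕ} (hab : a.Coprime b) (x : B) :
    ∃ u v : ℤ, x = u • (b • x) + v • (a • x) := by
  have h := Nat.gcd_eq_gcd_ab a b
  rw [hab.gcd_eq_one] at h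
  refine ⟨Nat.gcdB a b, Nat.gcdA a b, ?_⟩
  rw [← natCast_zsmul x a, ← natCast_zsmul x b, smul_smul, smul_smul, ← add_smul, mul_comm _ (a : ℤ),
      mul_comm _ (b : ℤ), add_comm, ← h]
  simp

/-- The sum T + U is already a ring: for y in T and z in U, the element a(yz) = (ay)z lies in U and
b(yz) = y(bz) lies in T, so a Bézout relation splits yz into a part in T and a part in U. -/
theorem mem_sup_of_coprime {T U : Subring B} (hT : S ≤ T) (hU : S ≤ U) {a b : ℕ}
    (hab : a.Coprime b) (ha : ∀ x ∈ T, a • x ∈ S) (hb : ∀ x ∈ U, b • x ∈ S) {x : B} :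
    x ∈ T ⊔ U ↔ ∃ y ∈ T, ∃ z ∈ U, x = y + z := by
  have key : ∀ x : B, a • x ∈ U → b • x ∈ T → ∃ y ∈ T, ∃ z ∈ U, x = y + z := by
    intro x h1 h2
    obtain ⟨u, v, h⟩ := exists_add_of_coprime hab x
    exact ⟨_, T.zsmul_mem h2 u, _, U.zsmul_mem h1 v, h⟩
  let W : Subring B :=
    { carrier := {x | ∃ y ∈ T, ∃ z ∈ U, x = y + z}
      mul_mem' := by
        rintro _ _ ⟨y, hy, z, hz, rfl⟩ ⟨y', hy', z', hz', rfl⟩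
        obtain ⟨p, hp, q, hq, h1⟩ := key (y * z')
          (by rw [← smul_mul_assoc]; exact U.mul_mem (hU (ha y hy)) hz')
          (by rw [← mul_smul_comm]; exact T.mul_mem hy (hT (hb z' hz')))
        obtain ⟨p', hp', q', hq', h2⟩ := key (z * y')
          (by rw [← mul_smul_comm]; exact U.mul_mem hz (hU (ha y' hy')))
          (by rw [← smul_mul_assoc]; exact T.mul_mem (hT (hb z hz)) hy')
        refine ⟨y * y' + p + p', T.add_mem (T.add_mem (T.mul_mem hy hy') hp) hp',
          z * z' + q + q', U.add_mem (U.add_mem (U.mul_mem hz hz') hq) hq', ?_⟩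
        rw [add_mul, mul_add, mul_add, h1, h2]
        abel
      one_mem' := ⟨1, T.one_mem, 0, U.zero_mem, by simp⟩
      add_mem' := by
        rintro _ _ ⟨y, hy, z, hz, rfl⟩ ⟨y', hy', z', hz', rfl⟩
        exact ⟨y + y', T.add_mem hy hy', z + z', U.add_mem hz hz', by abel⟩
      zero_mem' := ⟨0, T.zero_mem, 0, U.zero_mem, by simp⟩
      neg_mem' := by
        rintro _ ⟨y, hy, z, hz, rfl⟩
        exact ⟨-y, T.neg_mem hy, -z, U.neg_mem hz, by abel⟩ }
  constructor
  · intro hx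
    have : T ⊔ U ≤ W := sup_le (fun y hy => ⟨y, hy, 0, U.zero_mem, by simp⟩)
      (fun y hy => ⟨0, T.zero_mem, y, hy, by simp⟩)
    exact this hx
  · rintro ⟨y, hy, z, hz, rfl⟩
    exact Subring.add_mem _ ((le_sup_left : T ≤ T ⊔ U) hy) ((le_sup_right : U ≤ T ⊔ U) hz)

/-- Second isomorphism theorem: (T + U)/T is U/(T ∩ U), and T ∩ U = S because an element killed
modulo S by both a and b lies in S. -/
theorem relIndex_sup_of_coprime {T U : Subring B} (hT : S ≤ T) (hU : S ≤ U) {a b : ℕ}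
    (hab : a.Coprime b) (ha : ∀ x ∈ T, a • x ∈ S) (hb : ∀ x ∈ U, b • x ∈ S) :
    S.toAddSubgroup.relIndex (T ⊔ U).toAddSubgroup =
      S.toAddSubgroup.relIndex T.toAddSubgroup * S.toAddSubgroup.relIndex U.toAddSubgroup := by
  have h1 : (T ⊔ U).toAddSubgroup = T.toAddSubgroup ⊔ U.toAddSubgroup := by
    ext x
    rw [Subring.mem_toAddSubgroup, mem_sup_of_coprime hT hU hab ha hb, AddSubgroup.mem_sup]
    simp only [Subring.mem_toAddSubgroup]
    constructor
    · rintro ⟨y, hy, z, hz, h⟩; exact ⟨y, hy, z, hz, h.symm⟩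
    · rintro ⟨y, hy, z, hz, h⟩; exact ⟨y, hy, z, hz, h.symm⟩
  have h2 : S.toAddSubgroup = T.toAddSubgroup ⊓ U.toAddSubgroup := by
    ext x
    simp only [AddSubgroup.mem_inf, Subring.mem_toAddSubgroup]
    exact ⟨fun h => ⟨hT h, hU h⟩,
      fun h => mem_of_coprime_nsmul_mem hab (ha x h.1) (hb x h.2)⟩
  rw [← AddSubgroup.relIndex_mul_relIndex S.toAddSubgroup T.toAddSubgroup (T ⊔ U).toAddSubgroup
    hT (le_sup_left : T ≤ T ⊔ U), h1, AddSubgroup.relIndex_sup_left]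
  congr 1
  conv_rhs => rw [h2]
  rw [AddSubgroup.inf_relIndex_right]

/-- By Cauchy's theorem T/S has an element of order q, and that order divides a power of a. -/
theorem dvd_of_prime_dvd_relIndex {T : Subring B} {a q : ℕ} (hq : q.Prime)
    (ha : ∀ x ∈ T, ∃ k : ℕ, a ^ k • x ∈ S) (h0 : S.toAddSubgroup.relIndex T.toAddSubgroup ≠ 0)
    (hd : q ∣ S.toAddSubgroup.relIndex T.toAddSubgroup) : q ∣ a := by
  have := Fact.mk hq
  let A := S.toAddSubgroup.addSubgroupOf T.toAddSubgroup
  have : Finite (T.toAddSubgroup ⧸ A) := Nat.finite_of_card_ne_zero h0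
  obtain ⟨g, hg⟩ := exists_prime_addOrderOf_dvd_card' (G := T.toAddSubgroup ⧸ A) q hd
  obtain ⟨x, rfl⟩ := QuotientAddGroup.mk_surjective g
  obtain ⟨k, hk⟩ := ha x.1 x.2
  have : a ^ k • (x : T.toAddSubgroup ⧸ A) = 0 := by
    rw [← QuotientAddGroup.mk_nsmul, QuotientAddGroup.eq_zero_iff]
    exact hk
  have h := addOrderOf_dvd_of_nsmul_eq_zero this
  rw [hg] at h
  exact hq.dvd_of_dvd_pow h

theorem sup_mem_overrings {a b : ℕ} (hab : a.Coprime b) {T U : Subring B}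
    (hT : T ∈ overrings S a) (hU : U ∈ overrings S b) : T ⊔ U ∈ overrings S (a * b) :=
  ⟨hT.1.trans le_sup_left, by
    rw [relIndex_sup_of_coprime hT.1 hU.1 hab (fun _ => nsmul_mem_of_mem_overrings hT)
      (fun _ => nsmul_mem_of_mem_overrings hU), hT.2, hU.2]⟩

/-- Recovers T from T ⊔ U, so that the pair of coprime parts is determined by the big ring. -/
theorem primaryPart_sup {a b : ℕ} (hab : a.Coprime b) {T U : Subring B}
    (hT : T ∈ overrings S a) (hU : U ∈ overrings S b) : primaryPart S (T ⊔ U) a = T := by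
  ext x
  constructor
  · rintro ⟨hx, k, hk⟩
    obtain ⟨y, hy, z, hz, rfl⟩ := (mem_sup_of_coprime hT.1 hU.1 hab
      (fun _ => nsmul_mem_of_mem_overrings hT) (fun _ => nsmul_mem_of_mem_overrings hU)).1 hx
    refine T.add_mem hy (hT.1 (mem_of_coprime_nsmul_mem (hab.pow_left (k + 1)) ?_
      (nsmul_mem_of_mem_overrings hU hz)))
    have h1 : a ^ (k + 1) • (y + z) ∈ S := by
      rw [pow_succ', mul_smul]; exact S.nsmul_mem hk _
    have h2 : a ^ (k + 1) • y ∈ S := by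
      rw [pow_succ, mul_smul]; exact S.nsmul_mem (nsmul_mem_of_mem_overrings hT hy) _
    have := S.sub_mem h1 h2
    rwa [smul_add, add_sub_cancel_left] at this
  · intro hx
    exact ⟨(le_sup_left : T ≤ T ⊔ U) hx, 1, by
      rw [pow_one]; exact nsmul_mem_of_mem_overrings hT hx⟩

theorem exists_sup_of_mem_overrings {a b : ℕ} (ha0 : a ≠ 0) (hb0 : b ≠ 0) (hab : a.Coprime b)
    {R : Subring B} (hR : R ∈ overrings S (a * b)) :
    ∃ T ∈ overrings S a, ∃ U ∈ overrings S b, R = T ⊔ U := by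
  let T := primaryPart S R a
  let U := primaryPart S R b
  have hT : S ≤ T := le_primaryPart hR.1 a
  have hU : S ≤ U := le_primaryPart hR.1 b
  have key : ∀ {a b : ℕ}, a.Coprime b → R ∈ overrings S (a * b) →
      ∀ x ∈ primaryPart S R a, a • x ∈ S := by
    rintro a b hab hR x ⟨hx, k, hk⟩
    refine mem_of_coprime_nsmul_mem (hab.pow_left k) ?_
      (?_ : b • (a • x) ∈ S)
    · rw [smul_comm]; exact S.nsmul_mem hk _
    · rw [smul_smul, mul_comm]; exact nsmul_mem_of_mem_overrings hR hx
  have haT : ∀ x ∈ T, a • x ∈ S := key hab hR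
  have hbU : ∀ x ∈ U, b • x ∈ S := key hab.symm (by rwa [mul_comm])
  have hsup : R = T ⊔ U := by
    refine le_antisymm ?_ (sup_le (primaryPart_le R a) (primaryPart_le R b))
    intro x hx
    rw [mem_sup_of_coprime hT hU hab haT hbU]
    obtain ⟨u, v, h⟩ := exists_add_of_coprime hab x
    refine ⟨_, T.zsmul_mem ⟨R.nsmul_mem hx b, 1, ?_⟩ u, _, U.zsmul_mem ⟨R.nsmul_mem hx a, 1, ?_⟩ v,
      h⟩
    · rw [pow_one, smul_smul]; exact nsmul_mem_of_mem_overrings hR hx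
    · rw [pow_one, smul_smul, mul_comm]; exact nsmul_mem_of_mem_overrings hR hx
  have hmul := relIndex_sup_of_coprime hT hU hab haT hbU
  rw [← hsup, hR.2] at hmul
  have hne : a * b ≠ 0 := mul_ne_zero ha0 hb0
  have h1 : S.toAddSubgroup.relIndex T.toAddSubgroup ≠ 0 := by
    intro h; rw [h, zero_mul] at hmul; exact hne hmul
  have h2 : S.toAddSubgroup.relIndex U.toAddSubgroup ≠ 0 := by
    intro h; rw [h, mul_zero] at hmul; exact hne hmul
  -- The index of T involves only primes of a and that of U only primes of b. Their product is ab,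
  -- so they are a and b.
  have c1 : (S.toAddSubgroup.relIndex T.toAddSubgroup).Coprime b :=
    Nat.coprime_of_dvd fun q hq hd hd' => hq.one_lt.ne' (Nat.dvd_one.1 (hab ▸ Nat.dvd_gcd
      (dvd_of_prime_dvd_relIndex hq (fun x hx => ⟨1, by rw [pow_one]; exact haT x hx⟩) h1 hd) hd'))
  have c2 : (S.toAddSubgroup.relIndex U.toAddSubgroup).Coprime a :=
    Nat.coprime_of_dvd fun q hq hd hd' => hq.one_lt.ne' (Nat.dvd_one.1 (hab ▸ Nat.dvd_gcd hd'
      (dvd_of_prime_dvd_relIndex hq (fun x hx => ⟨1, by rw [pow_one]; exact hbU x hx⟩) h2 hd)))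
  have d1 : a ∣ S.toAddSubgroup.relIndex T.toAddSubgroup :=
    c2.symm.dvd_of_dvd_mul_right (hmul ▸ dvd_mul_right a b)
  have d2 : S.toAddSubgroup.relIndex T.toAddSubgroup ∣ a :=
    c1.dvd_of_dvd_mul_right (hmul ▸ dvd_mul_right _ _)
  have e1 := Nat.dvd_antisymm d2 d1
  refine ⟨T, ⟨hT, e1⟩, U, ⟨hU, ?_⟩, hsup⟩
  rw [e1] at hmul
  exact (Nat.eq_of_mul_eq_mul_left (Nat.pos_of_ne_zero ha0) hmul).symm

theorem ncard_overrings_mul {a b : ℕ} (ha0 : a ≠ 0) (hb0 : b ≠ 0) (hab : a.Coprime b) :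
    (overrings S (a * b)).ncard = (overrings S a).ncard * (overrings S b).ncard := by
  rw [← Set.ncard_prod]
  symm
  refine Set.ncard_congr (fun P _ => P.1 ⊔ P.2) ?_ ?_ ?_
  · rintro ⟨T, U⟩ ⟨hT, hU⟩
    exact sup_mem_overrings hab hT hU
  · rintro ⟨T, U⟩ ⟨T', U'⟩ ⟨hT, hU⟩ ⟨hT', hU'⟩ h
    simp only at hT hU hT' hU' h
    have h1 := primaryPart_sup hab hT hU
    have h2 := primaryPart_sup hab.symm hU hT
    rw [h, primaryPart_sup hab hT' hU'] at h1
    rw [sup_comm, h, sup_comm, primaryPart_sup hab.symm hU' hT'] at h2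
    rw [h1, h2]
  · intro R hR
    obtain ⟨T, hT, U, hU, rfl⟩ := exists_sup_of_mem_overrings ha0 hb0 hab hR
    exact ⟨(T, U), ⟨hT, hU⟩, rfl⟩

theorem overrings_one : overrings S 1 = {S} := by
  ext R
  simp only [overrings, Set.mem_ofPred_eq, Set.mem_singleton_iff]
  constructor
  · rintro ⟨h1, h2⟩
    exact le_antisymm (AddSubgroup.relIndex_eq_one.1 h2) h1
  · rintro rfl
    exact ⟨le_rfl, AddSubgroup.relIndex_self _⟩

theorem ncard_overrings_prod (s : Finset ℕ) (hs : ∀ p ∈ s, p.Prime) (e : ℕ → ℕ) :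
    (overrings S (∏ p ∈ s, p ^ e p)).ncard = ∏ p ∈ s, (overrings S (p ^ e p)).ncard := by
  classical
  induction s using Finset.induction_on with
  | empty => simp [overrings_one]
  | insert p s hp ih =>
    have hs' : ∀ q ∈ s, q.Prime := fun q hq => hs q (Finset.mem_insert_of_mem hq)
    have hpp : p.Prime := hs p (Finset.mem_insert_self _ _)
    rw [Finset.prod_insert hp, Finset.prod_insert hp, ncard_overrings_mul, ih hs']
    · exact pow_ne_zero _ hpp.ne_zero
    · exact Finset.prod_ne_zero_iff.2 fun q hq => pow_ne_zero _ (hs' q hq).ne_zero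
    · refine Nat.Coprime.prod_right fun q hq => Nat.Coprime.pow _ _ ?_
      exact (Nat.coprime_primes hpp (hs' q hq)).2 fun h => hp (h ▸ hq)

end Coprime

/-! ### Overrings of p-power index and the completion at p -/

section Completion

variable {B C : Type*} [Ring B] [Ring C]

/-- A ring homomorphism `Φ` that behaves like the map from a ring `B ⊇ S[1/p]` to the
completion at `p`, with `Λ` the closure of the image of `S`. -/
structure IsCompletionAt (p : ℕ) (Φ : B →+* C) (S : Subring B) (Λ : Subring C) : Prop where
  map_mem : ∀ x ∈ S, Φ x ∈ Λ
  mem_of_map_mem : ∀ (x : B) (k : ℕ), p ^ k • x ∈ S → Φ x ∈ Λ → x ∈ S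
  approx : ∀ z ∈ Λ, ∀ k : ℕ, ∃ s ∈ S, ∃ w ∈ Λ, z = Φ s + p ^ k • w
  divisible : ∀ (x : B) (k : ℕ), ∃ y : B, p ^ k • y = x
  torsionFree : ∀ (z : C) (k : ℕ), p ^ k • z = 0 → z = 0

namespace IsCompletionAt

variable {p : ℕ} {Φ : B →+* C} {S : Subring B} {Λ : Subring C}

/-- The closure `Φ(T) + Λ` of an overring `T` of `S`. -/
def closure (h : IsCompletionAt p Φ S Λ) (T : Subring B) (hS : S ≤ T)
    (hT : ∀ x ∈ T, ∃ k : ℕ, p ^ k • x ∈ S) : Subring C where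
  carrier := {z | ∃ x ∈ T, ∃ w ∈ Λ, z = Φ x + w}
  mul_mem' := by
    rintro _ _ ⟨x, hx, w, hw, rfl⟩ ⟨y, hy, v, hv, rfl⟩
    obtain ⟨k, hk⟩ := hT x hx
    obtain ⟨l, hl⟩ := hT y hy
    -- The precisions are crossed: w is approximated modulo p^l, where p^l clears the denominator of
    -- y, and v modulo p^k, where p^k clears that of x. The error terms of the product then stay in
    -- Λ.
    obtain ⟨s, hs, w', hw', rfl⟩ := h.approx w hw l
    obtain ⟨r, hr, v', hv', rfl⟩ := h.approx v hv k
    refine ⟨(x + s) * (y + r), T.mul_mem (T.add_mem hx (hS hs)) (T.add_mem hy (hS hr)),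
      w' * Φ (p ^ l • y) + Φ (p ^ k • x) * v' + Φ s * (p ^ k • v') + (p ^ l • w') * Φ r
        + (p ^ l • w') * (p ^ k • v'), ?_, ?_⟩
    · refine Λ.add_mem (Λ.add_mem (Λ.add_mem (Λ.add_mem ?_ ?_) ?_) ?_) ?_
      · exact Λ.mul_mem hw' (h.map_mem _ hl)
      · exact Λ.mul_mem (h.map_mem _ hk) hv'
      · exact Λ.mul_mem (h.map_mem _ hs) (Λ.nsmul_mem hv' _)
      · exact Λ.mul_mem (Λ.nsmul_mem hw' _) (h.map_mem _ hr)
      · exact Λ.mul_mem (Λ.nsmul_mem hw' _) (Λ.nsmul_mem hv' _)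
    · simp only [map_mul, map_add, map_nsmul, mul_add, add_mul, smul_mul_assoc, mul_smul_comm,
        smul_add]
      abel
  one_mem' := ⟨1, T.one_mem, 0, Λ.zero_mem, by simp⟩
  add_mem' := by
    rintro _ _ ⟨x, hx, w, hw, rfl⟩ ⟨y, hy, v, hv, rfl⟩
    exact ⟨x + y, T.add_mem hx hy, w + v, Λ.add_mem hw hv, by rw [map_add]; abel⟩
  zero_mem' := ⟨0, T.zero_mem, 0, Λ.zero_mem, by simp⟩
  neg_mem' := by
    rintro _ ⟨x, hx, w, hw, rfl⟩
    exact ⟨-x, T.neg_mem hx, -w, Λ.neg_mem hw, by rw [map_neg]; abel⟩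

/-- The elements of `S[1/p]` that lie in the overring `T` of `Λ`. -/
def pullback (p : ℕ) (Φ : B →+* C) (S : Subring B) (T : Subring C) : Subring B :=
  primaryPart S (T.comap Φ) p

variable (h : IsCompletionAt p Φ S Λ)
include h

/-- Φ induces an isomorphism T/S ≅ T'/Λ, since S = Φ⁻¹(Λ) ∩ T and T' = Φ(T) + Λ. -/
theorem relIndex_eq {T : Subring B} {T' : Subring C} (hS : S ≤ T)
    (hT : ∀ x ∈ T, ∃ k : ℕ, p ^ k • x ∈ S)
    (hTT' : ∀ z, z ∈ T' ↔ ∃ x ∈ T, ∃ w ∈ Λ, z = Φ x + w) :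
    S.toAddSubgroup.relIndex T.toAddSubgroup = Λ.toAddSubgroup.relIndex T'.toAddSubgroup := by
  have h1 : S.toAddSubgroup = Λ.toAddSubgroup.comap Φ.toAddMonoidHom ⊓ T.toAddSubgroup := by
    ext x
    simp only [AddSubgroup.mem_inf, Subring.mem_toAddSubgroup, AddSubgroup.mem_comap]
    refine ⟨fun hx => ⟨h.map_mem x hx, hS hx⟩, fun hx => ?_⟩
    obtain ⟨k, hk⟩ := hT x hx.2
    exact h.mem_of_map_mem x k hk hx.1
  have h2 : T'.toAddSubgroup = T.toAddSubgroup.map Φ.toAddMonoidHom ⊔ Λ.toAddSubgroup := by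
    ext z
    rw [Subring.mem_toAddSubgroup, hTT', AddSubgroup.mem_sup]
    constructor
    · rintro ⟨x, hx, w, hw, rfl⟩
      exact ⟨Φ x, ⟨x, hx, rfl⟩, w, hw, rfl⟩
    · rintro ⟨_, ⟨x, hx, rfl⟩, w, hw, rfl⟩
      exact ⟨x, hx, w, hw, rfl⟩
  rw [h1, AddSubgroup.inf_relIndex_right, AddSubgroup.relIndex_comap, h2,
    AddSubgroup.relIndex_sup_right]

theorem closure_mem_overrings {m : ℕ} {T : Subring B} (hT : T ∈ overrings S (p ^ m)) :
    h.closure T hT.1 (fun _ hx => ⟨m, nsmul_mem_of_mem_overrings hT hx⟩) ∈ overrings Λ (p ^ m) :=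
  ⟨fun z hz => ⟨0, T.zero_mem, z, hz, by simp⟩, (h.relIndex_eq hT.1 (fun _ hx => ⟨m, nsmul_mem_of_mem_overrings hT hx⟩)
    fun _ => Iff.rfl).symm.trans hT.2⟩

/-- Density: p^m z lies in Λ and is congruent modulo p^m Λ to some Φ(s) with s in S. Dividing by p^m
in B and cancelling it in C approximates z itself. -/
theorem mem_iff_mem_pullback {m : ℕ} {T : Subring C} (hT : T ∈ overrings Λ (p ^ m)) (z : C) :
    z ∈ T ↔ ∃ x ∈ pullback p Φ S T, ∃ w ∈ Λ, z = Φ x + w := by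
  constructor
  · intro hz
    obtain ⟨s, hs, w, hw, hsw⟩ := h.approx _ (nsmul_mem_of_mem_overrings hT hz) m
    obtain ⟨y, rfl⟩ := h.divisible s m
    have : z - Φ y - w = 0 := h.torsionFree _ m (by
      rw [smul_sub, smul_sub, hsw, map_nsmul]; abel)
    have hz' : z = Φ y + w := by rw [← sub_eq_zero, ← this]; abel
    refine ⟨y, ⟨?_, m, hs⟩, w, hw, hz'⟩
    rw [Subring.mem_comap, show Φ y = z - w by rw [hz']; abel]
    exact T.sub_mem hz (hT.1 hw)
  · rintro ⟨x, hx, w, hw, rfl⟩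
    exact T.add_mem hx.1 (hT.1 hw)

theorem pullback_mem_overrings {m : ℕ} {T : Subring C} (hT : T ∈ overrings Λ (p ^ m)) :
    pullback p Φ S T ∈ overrings S (p ^ m) :=
  have hS : S ≤ pullback p Φ S T := 
    le_primaryPart (fun (x : B) hx => (hT.1 (h.map_mem x hx) : Φ x ∈ T)) p
  ⟨hS, (h.relIndex_eq hS (fun _ hx => hx.2) (h.mem_iff_mem_pullback hT)).trans hT.2⟩

theorem pullback_closure {m : ℕ} {T : Subring B} (hT : T ∈ overrings S (p ^ m)) :
    pullback p Φ S
      (h.closure T hT.1 (fun _ hx => ⟨m, nsmul_mem_of_mem_overrings hT hx⟩)) = T := by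
  ext x
  constructor
  · rintro ⟨⟨t, ht, w, hw, htw⟩, k, hk⟩
    have : x - t ∈ S := by
      refine h.mem_of_map_mem _ (k + m) ?_ (by rw [map_sub, htw, add_sub_cancel_left]; exact hw)
      rw [smul_sub]
      refine S.sub_mem ?_ ?_
      · rw [pow_add, mul_comm, mul_smul]; exact S.nsmul_mem hk _
      · rw [pow_add, mul_smul]; exact S.nsmul_mem (nsmul_mem_of_mem_overrings hT ht) _
    have := T.add_mem (hT.1 this) ht
    rwa [sub_add_cancel] at this
  · intro hx
    exact ⟨⟨x, hx, 0, Λ.zero_mem, by simp⟩, m, nsmul_mem_of_mem_overrings hT hx⟩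

theorem pullback_injOn {m : ℕ} :
    Set.InjOn (pullback p Φ S) (overrings Λ (p ^ m)) := by
  intro T hT T' hT' heq
  ext z
  rw [h.mem_iff_mem_pullback hT, h.mem_iff_mem_pullback hT', heq]

theorem ncard_overrings (m : ℕ) :
    (overrings S (p ^ m)).ncard = (overrings Λ (p ^ m)).ncard := by
  symm
  refine Set.ncard_congr (fun T _ => pullback p Φ S T) (fun T hT => h.pullback_mem_overrings hT)
    (fun T T' hT hT' heq => h.pullback_injOn hT hT' heq) ?_
  intro T hT
  exact ⟨_, h.closure_mem_overrings hT, h.pullback_closure hT⟩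

/-- If every overring of `Λ` of index less than `p ^ n` is contained in a larger one, then the same
holds for `S`. -/
theorem exists_lt_of_forall_exists_lt {n : ℕ}
    (hΛ : ∀ m < n, ∀ T ∈ overrings Λ (p ^ m), ∃ l, m < l ∧ ∃ T' ∈ overrings Λ (p ^ l), T ≤ T') :
    ∀ m < n, ∀ T ∈ overrings S (p ^ m), ∃ l, m < l ∧ ∃ T' ∈ overrings S (p ^ l), T ≤ T' := by
  intro m hm T hT
  obtain ⟨l, hl, T', hT', hle⟩ := hΛ m hm _ (h.closure_mem_overrings hT)
  refine ⟨l, hl, _, h.pullback_mem_overrings hT', ?_⟩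
  rw [← h.pullback_closure hT]
  exact fun x hx => ⟨hle hx.1, hx.2⟩

end IsCompletionAt

end Completion

/-! ### Fractional ideals of ℚ_p -/

section PadicBall

variable {p : ℕ} [hp : Fact p.Prime]

/-- The fractional ideal `p ^ (-k) ℤ_p` of `ℚ_p`. -/
def padicBall (p : ℕ) [Fact p.Prime] (k : ℕ) : AddSubgroup ℚ_[p] where
  carrier := {z | ‖z‖ ≤ (p : ℝ) ^ k}
  add_mem' := fun {x y} hx hy => (Padic.nonarchimedean x y).trans (max_le hx hy)
  zero_mem' := by
    show ‖(0 : ℚ_[p])‖ ≤ (p : ℝ) ^ k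
    rw [norm_zero]; positivity
  neg_mem' := fun {x} hx => by
    show ‖-x‖ ≤ (p : ℝ) ^ k
    rw [norm_neg]; exact hx

theorem mem_padicBall {k : ℕ} {z : ℚ_[p]} : z ∈ padicBall p k ↔ ‖z‖ ≤ (p : ℝ) ^ k := Iff.rfl

theorem mem_padicBall_iff {k : ℕ} {z : ℚ_[p]} :
    z ∈ padicBall p k ↔ ∃ w : ℤ_[p], z = w * ((p : ℚ_[p]) ^ k)⁻¹ := by
  have h0 : (p : ℚ_[p]) ^ k ≠ 0 := pow_ne_zero _ (Nat.cast_ne_zero.2 hp.1.ne_zero)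
  have h1 : (0 : ℝ) < (p : ℝ) ^ k := pow_pos (Nat.cast_pos.2 hp.1.pos) _
  rw [mem_padicBall]
  constructor
  · intro hz
    refine ⟨⟨z * (p : ℚ_[p]) ^ k, ?_⟩, ?_⟩
    · rw [norm_mul, norm_pow, Padic.norm_p, inv_pow, ← div_eq_mul_inv, div_le_one h1]
      exact hz
    · simp only []
      rw [mul_assoc, mul_inv_cancel₀ h0, mul_one]
  · rintro ⟨w, rfl⟩
    rw [norm_mul, norm_inv, norm_pow, Padic.norm_p, inv_pow, inv_inv]
    exact mul_le_of_le_one_left h1.le w.norm_le_one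

theorem padicBall_mono {k l : ℕ} (h : k ≤ l) : padicBall p k ≤ padicBall p l := fun _ hz =>
  (mem_padicBall.1 hz).trans
    (pow_le_pow_right₀ (Nat.one_le_cast.2 hp.1.one_lt.le) h)

theorem inv_pow_mem_padicBall {k l : ℕ} :
    ((p : ℚ_[p]) ^ k)⁻¹ ∈ padicBall p l ↔ k ≤ l := by
  rw [mem_padicBall, norm_inv, norm_pow, Padic.norm_p, inv_pow, inv_inv]
  exact pow_le_pow_iff_right₀ (Nat.one_lt_cast.2 hp.1.one_lt)

theorem mul_mem_padicBall {k l : ℕ} {x y : ℚ_[p]} (hx : x ∈ padicBall p k)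
    (hy : y ∈ padicBall p l) : x * y ∈ padicBall p (k + l) := by
  rw [mem_padicBall] at *
  rw [norm_mul, pow_add]
  exact mul_le_mul hx hy (norm_nonneg _) (by positivity)

theorem coe_mem_padicBall (k : ℕ) (w : ℤ_[p]) : (w : ℚ_[p]) ∈ padicBall p k := by
  refine padicBall_mono (Nat.zero_le k) ?_
  rw [mem_padicBall, pow_zero]
  exact w.norm_le_one

theorem mem_padicBall_zero {z : ℚ_[p]} : z ∈ padicBall p 0 ↔ ∃ w : ℤ_[p], z = w := by
  rw [mem_padicBall_iff]
  simp

/-- Multiplication by p^(-k) maps ℤ_p onto the larger ball and p^k ℤ_p onto the smaller one, so the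
index is the order of ℤ/p^k. -/
theorem relIndex_padicBall (k : ℕ) :
    (padicBall p 0).relIndex (padicBall p k) = p ^ k := by
  have h0 : (p : ℚ_[p]) ^ k ≠ 0 := pow_ne_zero _ (Nat.cast_ne_zero.2 hp.1.ne_zero)
  let f : ℤ_[p] →+ ℚ_[p] :=
    (AddMonoidHom.mulRight (((p : ℚ_[p]) ^ k)⁻¹)).comp (PadicInt.Coe.ringHom (p := p)).toAddMonoidHom
  have hf : ∀ w : ℤ_[p], f w = w * ((p : ℚ_[p]) ^ k)⁻¹ := fun w => rfl
  have h1 : padicBall p k = f.range := by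
    ext z
    rw [mem_padicBall_iff, AddMonoidHom.mem_range]
    simp only [hf, eq_comm]
  have h2 : (padicBall p 0).comap f = (PadicInt.toZModPow (p := p) k).toAddMonoidHom.ker := by
    ext w
    rw [AddSubgroup.mem_comap, mem_padicBall_zero, hf]
    have : w ∈ (PadicInt.toZModPow (p := p) k).toAddMonoidHom.ker ↔
      w ∈ RingHom.ker (PadicInt.toZModPow (p := p) k) := Iff.rfl
    rw [this, PadicInt.ker_toZModPow, Ideal.mem_span_singleton]
    constructor
    · rintro ⟨v, hv⟩
      refine ⟨v, ?_⟩
      apply Subtype.coe_injective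
      push_cast
      rw [← hv, mul_comm, mul_assoc, inv_mul_cancel₀ h0, mul_one]
    · rintro ⟨v, rfl⟩
      refine ⟨v, ?_⟩
      push_cast
      rw [mul_comm, ← mul_assoc, inv_mul_cancel₀ h0, one_mul]
  rw [h1, AddMonoidHom.range_eq_map, ← AddSubgroup.relIndex_comap, AddSubgroup.relIndex_top_right,
    h2, AddSubgroup.index_ker]
  have : (PadicInt.toZModPow (p := p) k).toAddMonoidHom.range = ⊤ := by
    rw [AddMonoidHom.range_eq_top]
    exact ZMod.ringHom_surjective _
  rw [this]
  have : NeZero (p ^ k) := ⟨pow_ne_zero _ hp.1.ne_zero⟩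
  simp

/-- A bounded `ℤ_p`-submodule of `ℚ_p` that contains `1` is one of the `p ^ (-k) ℤ_p`. -/
theorem exists_eq_padicBall (A : AddSubgroup ℚ_[p]) (h1 : (1 : ℚ_[p]) ∈ A)
    (hmul : ∀ (w : ℤ_[p]), ∀ z ∈ A, (w : ℚ_[p]) * z ∈ A) (m : ℕ) (hm : A ≤ padicBall p m) :
    ∃ k ≤ m, A = padicBall p k := by
  classical
  have hp0 : (p : ℚ_[p]) ≠ 0 := Nat.cast_ne_zero.2 hp.1.ne_zero
  let P : ℕ → Prop := fun k => ((p : ℚ_[p]) ^ k)⁻¹ ∈ A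
  have hP0 : P 0 := by simpa [P] using h1
  have hPb : ∀ k, P k → k ≤ m := fun k hk => inv_pow_mem_padicBall.1 (hm hk)
  refine ⟨Nat.findGreatest P m, Nat.findGreatest_le m, ?_⟩
  have hk : P (Nat.findGreatest P m) := Nat.findGreatest_spec (Nat.zero_le m) hP0
  apply le_antisymm
  · intro z hz
    by_cases hz0 : z = 0
    · rw [hz0]; exact zero_mem _
    by_contra hlt
    rw [mem_padicBall, not_le] at hlt
    obtain ⟨l, hl⟩ : ∃ l : ℕ, ‖z‖ = (p : ℝ) ^ l := by
      rw [Padic.norm_eq_zpow_neg_valuation hz0] at hlt ⊢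
      rw [← zpow_natCast, zpow_lt_zpow_iff_right₀ (Nat.one_lt_cast.2 hp.1.one_lt)] at hlt
      refine ⟨(-z.valuation).toNat, ?_⟩
      rw [← zpow_natCast]
      congr 1
      omega
    -- p^(-l) is the multiple of z by p^(-l) z⁻¹, which has norm 1.
    have hPl : P l := by
      have hn : ‖((p : ℚ_[p]) ^ l)⁻¹ * z⁻¹‖ ≤ 1 := by
        rw [norm_mul, norm_inv, norm_inv, norm_pow, Padic.norm_p, hl, inv_pow, inv_inv,
          mul_inv_cancel₀]
        exact pow_ne_zero _ (Nat.cast_ne_zero.2 hp.1.ne_zero)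
      have := hmul ⟨_, hn⟩ z hz
      simp only [] at this
      rwa [mul_assoc, inv_mul_cancel₀ hz0, mul_one] at this
    have := Nat.le_findGreatest (hPb l hPl) hPl
    rw [hl] at hlt
    exact absurd this (not_le.2 ((pow_lt_pow_iff_right₀ (Nat.one_lt_cast.2 hp.1.one_lt)).1 hlt))
  · intro z hz
    obtain ⟨w, rfl⟩ := mem_padicBall_iff.1 hz
    exact hmul w _ hk

/-- An element whose powers are uniformly bounded is integral. -/
theorem mem_padicBall_zero_of_pow {z : ℚ_[p]} {m : ℕ} (h : ∀ n : ℕ, z ^ n ∈ padicBall p m) :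
    z ∈ padicBall p 0 := by
  rw [mem_padicBall, pow_zero]
  by_contra hlt
  rw [not_le] at hlt
  obtain ⟨n, hn⟩ := pow_unbounded_of_one_lt ((p : ℝ) ^ m) hlt
  have := mem_padicBall.1 (h n)
  rw [norm_pow] at this
  exact absurd hn (not_lt.2 this)

end PadicBall

open Quaternion in
/-- The quaternion algebra over `ℚ_p` with `i² = a + b i`, `j² = c`, `j i = (b - i) j`. -/
abbrev PadicQuat (p : ℕ) [Fact p.Prime] (a b c : ℤ_[p]) : Type :=
  ℍ[ℚ_[p],(a : ℚ_[p]),(b : ℚ_[p]),(c : ℚ_[p])]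

/-! ### Local overorders: the inert case -/

section Inert

variable {p : ℕ} [hp : Fact p.Prime] {a b c : ℤ_[p]}

theorem padic_pow_ne_zero (k : ℕ) : (p : ℚ_[p]) ^ k ≠ 0 :=
  pow_ne_zero _ (Nat.cast_ne_zero.2 hp.1.ne_zero)

/-- The order of elements `u + v j` with `u` integral and `p ^ k v` integral. -/
def inertRing (a b c : ℤ_[p]) (k : ℕ) (h : (p : ℤ_[p]) ^ (2 * k) ∣ c) :
    Subring (PadicQuat p a b c) where
  carrier := {x | x.re ∈ padicBall p 0 ∧ x.imI ∈ padicBall p 0 ∧ x.imJ ∈ padicBall p k ∧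
    x.imK ∈ padicBall p k}
  mul_mem' := by
    rintro x y ⟨h1, h2, h3, h4⟩ ⟨g1, g2, g3, g4⟩
    obtain ⟨x1, h1⟩ := mem_padicBall_zero.1 h1
    obtain ⟨x2, h2⟩ := mem_padicBall_zero.1 h2
    obtain ⟨x3, h3⟩ := mem_padicBall_iff.1 h3
    obtain ⟨x4, h4⟩ := mem_padicBall_iff.1 h4
    obtain ⟨y1, g1⟩ := mem_padicBall_zero.1 g1
    obtain ⟨y2, g2⟩ := mem_padicBall_zero.1 g2
    obtain ⟨y3, g3⟩ := mem_padicBall_iff.1 g3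
    obtain ⟨y4, g4⟩ := mem_padicBall_iff.1 g4
    obtain ⟨d, rfl⟩ := h
    have h0 := padic_pow_ne_zero (p := p) k
    refine ⟨mem_padicBall_zero.2 ⟨x1 * y1 + a * x2 * y2 + d * x3 * y3 + b * d * x3 * y4
        - a * d * x4 * y4, ?_⟩,
      mem_padicBall_zero.2 ⟨x1 * y2 + x2 * y1 + b * x2 * y2 - d * x3 * y4 + d * x4 * y3, ?_⟩,
      mem_padicBall_iff.2 ⟨x1 * y3 + a * x2 * y4 + x3 * y1 + b * x3 * y2 - a * x4 * y2, ?_⟩,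
      mem_padicBall_iff.2 ⟨x1 * y4 + x2 * y3 + b * x2 * y4 - x3 * y2 + x4 * y1, ?_⟩⟩
    · simp only [QuaternionAlgebra.re_mul, h1, h2, h3, h4, g1, g2, g3, g4]
      push_cast
      field_simp
      ring
    · simp only [QuaternionAlgebra.imI_mul, h1, h2, h3, h4, g1, g2, g3, g4]
      push_cast
      field_simp
      ring
    · simp only [QuaternionAlgebra.imJ_mul, h1, h2, h3, h4, g1, g2, g3, g4]
      push_cast
      ring
    · simp only [QuaternionAlgebra.imK_mul, h1, h2, h3, h4, g1, g2, g3, g4]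
      push_cast
      ring
  one_mem' := ⟨mem_padicBall_zero.2 ⟨1, by simp⟩, by simp [zero_mem], by simp [zero_mem],
    by simp [zero_mem]⟩
  add_mem' := fun h g => ⟨add_mem h.1 g.1, add_mem h.2.1 g.2.1, add_mem h.2.2.1 g.2.2.1,
    add_mem h.2.2.2 g.2.2.2⟩
  zero_mem' := ⟨zero_mem _, zero_mem _, zero_mem _, zero_mem _⟩
  neg_mem' := fun h => ⟨neg_mem h.1, neg_mem h.2.1, neg_mem h.2.2.1, neg_mem h.2.2.2⟩

/-- The order of quaternions with integral coordinates. -/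
def integralQuat (a b c : ℤ_[p]) : Subring (PadicQuat p a b c) := inertRing a b c 0 (by simp)

theorem mk_coe_mem_integralQuat (x y z w : ℤ_[p]) :
    (⟨x, y, z, w⟩ : PadicQuat p a b c) ∈ integralQuat a b c :=
  ⟨coe_mem_padicBall 0 _, coe_mem_padicBall 0 _, coe_mem_padicBall 0 _, coe_mem_padicBall 0 _⟩

theorem inertRing_mono {k l : ℕ} (hkl : k ≤ l) (hk : (p : ℤ_[p]) ^ (2 * k) ∣ c)
    (hl : (p : ℤ_[p]) ^ (2 * l) ∣ c) : inertRing a b c k hk ≤ inertRing a b c l hl :=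
  fun _ h => ⟨h.1, h.2.1, padicBall_mono hkl h.2.2.1, padicBall_mono hkl h.2.2.2⟩

/-- The index is computed one coordinate of v at a time, through the intermediate group where only
the j-coordinate is integral. Each coordinate contributes p^k. -/
theorem inertRing_mem_overrings (k : ℕ) (h : (p : ℤ_[p]) ^ (2 * k) ∣ c) :
    inertRing a b c k h ∈ overrings (integralQuat a b c) (p ^ (2 * k)) := by
  refine ⟨inertRing_mono (Nat.zero_le k) _ h, ?_⟩
  let fJ : PadicQuat p a b c →+ ℚ_[p] := ⟨⟨fun x => x.imJ, rfl⟩, fun _ _ => rfl⟩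
  let fK : PadicQuat p a b c →+ ℚ_[p] := ⟨⟨fun x => x.imK, rfl⟩, fun _ _ => rfl⟩
  let T := (inertRing a b c k h).toAddSubgroup
  let T' := (padicBall p 0).comap fJ ⊓ T
  have h1 : (integralQuat a b c).toAddSubgroup = (padicBall p 0).comap fK ⊓ T' := by
    ext x
    constructor
    · rintro ⟨h1, h2, h3, h4⟩
      exact ⟨h4, h3, h1, h2, padicBall_mono (Nat.zero_le k) h3, padicBall_mono (Nat.zero_le k) h4⟩
    · rintro ⟨h4, h3, h1, h2, _, _⟩
      exact ⟨h1, h2, h3, h4⟩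
  have hT' : T' ≤ T := inf_le_right
  rw [h1, ← AddSubgroup.relIndex_mul_relIndex _ T' T inf_le_right hT',
    AddSubgroup.inf_relIndex_right, AddSubgroup.inf_relIndex_right, AddSubgroup.relIndex_comap,
    AddSubgroup.relIndex_comap]
  have hJ : T.map fJ = padicBall p k := by
    ext z
    constructor
    · rintro ⟨x, hx, rfl⟩
      exact hx.2.2.1
    · intro hz
      exact ⟨⟨0, 0, z, 0⟩, ⟨zero_mem _, zero_mem _, hz, zero_mem _⟩, rfl⟩
  have hK : T'.map fK = padicBall p k := by
    ext z
    constructor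
    · rintro ⟨x, hx, rfl⟩
      exact hx.2.2.2.2
    · intro hz
      exact ⟨⟨0, 0, 0, z⟩, ⟨zero_mem (padicBall p 0), zero_mem _, zero_mem _, zero_mem _, hz⟩, rfl⟩
  rw [hJ, hK, relIndex_padicBall, two_mul, pow_add]

theorem mem_padicBall_of_mem_overrings {m : ℕ} {T : Subring (PadicQuat p a b c)}
    (hT : T ∈ overrings (integralQuat a b c) (p ^ m)) {x : PadicQuat p a b c} (hx : x ∈ T) :
    x.re ∈ padicBall p m ∧ x.imI ∈ padicBall p m ∧ x.imJ ∈ padicBall p m ∧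
      x.imK ∈ padicBall p m := by
  have key : ∀ z : ℚ_[p], (p ^ m) • z ∈ padicBall p 0 → z ∈ padicBall p m := by
    intro z hz
    obtain ⟨w, hw⟩ := mem_padicBall_zero.1 hz
    refine mem_padicBall_iff.2 ⟨w, ?_⟩
    rw [← hw, nsmul_eq_mul, mul_comm, ← mul_assoc]
    push_cast
    rw [inv_mul_cancel₀ (padic_pow_ne_zero m), one_mul]
  have h := nsmul_mem_of_mem_overrings hT hx
  exact ⟨key _ h.1, key _ h.2.1, key _ h.2.2.1, key _ h.2.2.2⟩

/-- Isolates the exact denominator of a pair. In the inert case a primitive pair is a unit of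
ℤ_p[i], so only the power of p matters. -/
theorem exists_primitive {x y : ℚ_[p]} (h : ¬ (x ∈ padicBall p 0 ∧ y ∈ padicBall p 0)) :
    ∃ k : ℕ, 0 < k ∧ ∃ u v : ℤ_[p], x = u * ((p : ℚ_[p]) ^ k)⁻¹ ∧ y = v * ((p : ℚ_[p]) ^ k)⁻¹ ∧
      ¬ ((p : ℤ_[p]) ∣ u ∧ (p : ℤ_[p]) ∣ v) := by
  classical
  have hex : ∃ k : ℕ, x ∈ padicBall p k ∧ y ∈ padicBall p k := by
    have hp1 : (1 : ℝ) < p := Nat.one_lt_cast.2 hp.1.one_lt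
    obtain ⟨k, hk⟩ := pow_unbounded_of_one_lt (max ‖x‖ ‖y‖) hp1
    exact ⟨k, (le_max_left _ _).trans hk.le, (le_max_right _ _).trans hk.le⟩
  obtain ⟨h1, h2⟩ := Nat.find_spec hex
  have hmin := fun m => Nat.find_min (m := m) hex
  generalize Nat.find hex = k at h1 h2 hmin
  have hk : 0 < k := by
    rcases Nat.eq_zero_or_pos k with rfl | h0
    · exact absurd ⟨h1, h2⟩ h
    · exact h0
  obtain ⟨u, hu⟩ := mem_padicBall_iff.1 h1
  obtain ⟨v, hv⟩ := mem_padicBall_iff.1 h2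
  refine ⟨k, hk, u, v, hu, hv, ?_⟩
  rintro ⟨⟨u', rfl⟩, ⟨v', rfl⟩⟩
  obtain ⟨l, rfl⟩ : ∃ l, k = l + 1 := ⟨k - 1, by omega⟩
  have h0 := padic_pow_ne_zero (p := p) l
  have h0' : (p : ℚ_[p]) ≠ 0 := Nat.cast_ne_zero.2 hp.1.ne_zero
  refine hmin l (Nat.lt_succ_self l) ⟨mem_padicBall_iff.2 ⟨u', ?_⟩, mem_padicBall_iff.2 ⟨v', ?_⟩⟩
  · rw [hu]; push_cast; rw [pow_succ]; field_simp
  · rw [hv]; push_cast; rw [pow_succ]; field_simp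

variable {m : ℕ} {T : Subring (PadicQuat p a b c)}
  (hT : T ∈ overrings (integralQuat a b c) (p ^ m))
include hT

theorem smul_coe_mem {w : ℚ_[p]} (hw : w ∈ padicBall p 0) {x : PadicQuat p a b c} (hx : x ∈ T) :
    w • x ∈ T := by
  have : w • x = (⟨w, 0, 0, 0⟩ : PadicQuat p a b c) * x := by
    ext <;> simp
  rw [this]
  exact T.mul_mem (hT.1 ⟨hw, zero_mem _, zero_mem _, zero_mem _⟩) hx

/-- The finite index bounds the denominators of all of T, in particular those of the powers of the
scalar, and bounded powers mean integral. -/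
theorem scalar_mem_padicBall_zero {z : ℚ_[p]} (hz : (⟨z, 0, 0, 0⟩ : PadicQuat p a b c) ∈ T) :
    z ∈ padicBall p 0 := by
  refine mem_padicBall_zero_of_pow (m := m) fun n => ?_
  have h1 : (⟨z ^ n, 0, 0, 0⟩ : PadicQuat p a b c) = (⟨z, 0, 0, 0⟩ : PadicQuat p a b c) ^ n := by
    induction n with
    | zero => ext <;> simp
    | succ n ih =>
      refine Eq.trans ?_ (pow_succ _ n).symm
      rw [← ih]; ext <;> simp [pow_succ]
  have := T.pow_mem hz n
  rw [← h1] at this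
  exact (mem_padicBall_of_mem_overrings hT this).1

/-- The unit discriminant separates u from v inside T. The anisotropic norm form makes ℤ_p[i] a ring
whose primitive elements are units, so each part is generated by powers of p: integrality of scalars
forces u to be integral, and the v form p^(-k) ℤ_p[i] for the largest k with p^(-k) j in T. -/
theorem inert_overrings (hdisc : IsUnit (b ^ 2 + 4 * a))
    (haniso : ∀ x y : ℤ_[p], (p : ℤ_[p]) ∣ x ^ 2 + b * x * y - a * y ^ 2 →
      (p : ℤ_[p]) ∣ x ∧ (p : ℤ_[p]) ∣ y) :
    ∃ (k : ℕ) (h : (p : ℤ_[p]) ^ (2 * k) ∣ c), m = 2 * k ∧ T = inertRing a b c k h := by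
  obtain ⟨d, hd⟩ := hdisc
  obtain ⟨e, he⟩ : ∃ e : ℤ_[p], (b ^ 2 + 4 * a) * e = 1 :=
    ⟨_, by rw [← hd]; exact d.mul_inv⟩
  have heq : ((b : ℚ_[p]) ^ 2 + (4 : ℤ_[p]) * a) * e = 1 := by
    simpa using congrArg (fun z : ℤ_[p] => (z : ℚ_[p])) he
  rw [show ((4 : ℤ_[p]) : ℚ_[p]) = 4 from rfl] at heq
  -- the two components of an element of `T` lie in `T`
  have hv : ∀ x ∈ T, (⟨0, 0, x.imJ, x.imK⟩ : PadicQuat p a b c) ∈ T := by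
    intro x hx
    -- For x = u + v j the commutator with i is (2 i - b) v j, which no longer sees u. As (2 i - b)²
    -- = b² + 4 a is a unit with inverse e, the left factor e (2 i - b) undoes the multiplication.
    have h1 : (⟨0, 0, x.imJ, x.imK⟩ : PadicQuat p a b c) =
        (⟨-(b * e : ℤ_[p]), (e + e : ℤ_[p]), (0 : ℤ_[p]), (0 : ℤ_[p])⟩ : PadicQuat p a b c) *
          ((⟨(0 : ℤ_[p]), (1 : ℤ_[p]), (0 : ℤ_[p]), (0 : ℤ_[p])⟩ : PadicQuat p a b c) * x -
            x * (⟨(0 : ℤ_[p]), (1 : ℤ_[p]), (0 : ℤ_[p]), (0 : ℤ_[p])⟩ : PadicQuat p a b c)) := by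
      ext
      · simp
      · simp
      · simp; linear_combination (-x.imJ) * heq
      · simp; linear_combination (-x.imK) * heq
    rw [h1]
    refine T.mul_mem (hT.1 ?_) (T.sub_mem (T.mul_mem (hT.1 ?_) hx) (T.mul_mem hx (hT.1 ?_)))
    · rw [← PadicInt.coe_neg]; exact mk_coe_mem_integralQuat _ _ _ _
    · exact mk_coe_mem_integralQuat _ _ _ _
    · exact mk_coe_mem_integralQuat _ _ _ _
  have hu : ∀ x ∈ T, (⟨x.re, x.imI, 0, 0⟩ : PadicQuat p a b c) ∈ T := by
    intro x hx
    have := T.sub_mem hx (hv x hx)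
    have h2 : x - (⟨0, 0, x.imJ, x.imK⟩ : PadicQuat p a b c) = ⟨x.re, x.imI, 0, 0⟩ := by
      ext <;> simp
    rwa [h2] at this
  -- primitive elements are units
  have hprim : ∀ u v : ℤ_[p], ¬ ((p : ℤ_[p]) ∣ u ∧ (p : ℤ_[p]) ∣ v) →
      ∃ u' v' : ℤ_[p], u * u' + a * v * v' = 1 ∧ u * v' + v * u' + b * v * v' = 0 := by
    intro u v huv
    have : IsUnit (u ^ 2 + b * u * v - a * v ^ 2) := by
      by_contra hnu
      refine huv (haniso u v ?_)
      rw [PadicInt.isUnit_iff] at hnu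
      rw [← PadicInt.norm_lt_one_iff_dvd]
      exact lt_of_le_of_ne (PadicInt.norm_le_one _) hnu
    obtain ⟨n, hn⟩ := this
    have hn' : (u ^ 2 + b * u * v - a * v ^ 2) * (↑n⁻¹ : ℤ_[p]) = 1 := by rw [← hn]; exact n.mul_inv
    exact ⟨(u + b * v) * (↑n⁻¹ : ℤ_[p]), -v * (↑n⁻¹ : ℤ_[p]), by linear_combination hn', by ring⟩
  have hre : ∀ x ∈ T, x.re ∈ padicBall p 0 ∧ x.imI ∈ padicBall p 0 := by
    intro x hx
    by_contra hcon
    obtain ⟨k, hk, u, v, hxu, hxv, hp'⟩ := exists_primitive hcon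
    obtain ⟨u', v', e1, e2⟩ := hprim u v hp'
    have e1' : (u * u' + a * v * v' : ℚ_[p]) = 1 := by
      simpa using congrArg (fun z : ℤ_[p] => (z : ℚ_[p])) e1
    have e2' : (u * v' + v * u' + b * v * v' : ℚ_[p]) = 0 := by
      simpa using congrArg (fun z : ℤ_[p] => (z : ℚ_[p])) e2
    -- Cancelling the primitive unit leaves the scalar p^(-k) with k > 0, which cannot lie in T.
    have h1 := T.mul_mem (hu x hx) (hT.1 (mk_coe_mem_integralQuat (a := a) (b := b) (c := c)
      u' v' 0 0))
    have h2 : (⟨x.re, x.imI, 0, 0⟩ : PadicQuat p a b c) *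
        (⟨u', v', (0 : ℤ_[p]), (0 : ℤ_[p])⟩ : PadicQuat p a b c) =
        ⟨((p : ℚ_[p]) ^ k)⁻¹, 0, 0, 0⟩ := by
      ext
      · simp [hxu, hxv]; linear_combination ((p : ℚ_[p]) ^ k)⁻¹ * e1'
      · simp [hxu, hxv]; linear_combination ((p : ℚ_[p]) ^ k)⁻¹ * e2'
      · simp
      · simp
    rw [h2] at h1
    have := inv_pow_mem_padicBall.1 (scalar_mem_padicBall_zero hT h1)
    omega
  let A : AddSubgroup ℚ_[p] :=
    { carrier := {z | (⟨0, 0, z, 0⟩ : PadicQuat p a b c) ∈ T}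
      add_mem' := fun {x y} hx hy => by
        have := T.add_mem hx hy
        simpa using this
      zero_mem' := T.zero_mem
      neg_mem' := fun {x} hx => by
        have := T.neg_mem hx
        simpa using this }
  have hA : ∀ z, z ∈ A ↔ (⟨0, 0, z, 0⟩ : PadicQuat p a b c) ∈ T := fun _ => Iff.rfl
  obtain ⟨k, -, hk⟩ := exists_eq_padicBall A
    (by rw [hA]
        have := hT.1 (mk_coe_mem_integralQuat (a := a) (b := b) (c := c) 0 0 1 0)
        simpa using this)
    (fun w z hz => by
      rw [hA] at hz ⊢
      have := smul_coe_mem hT (coe_mem_padicBall 0 w) hz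
      simpa using this) m
    (fun z hz => (mem_padicBall_of_mem_overrings hT hz).2.2.1)
  have hv2 : ∀ x ∈ T, x.imJ ∈ padicBall p k ∧ x.imK ∈ padicBall p k := by
    intro x hx
    by_cases hint : x.imJ ∈ padicBall p 0 ∧ x.imK ∈ padicBall p 0
    · exact ⟨padicBall_mono (Nat.zero_le k) hint.1, padicBall_mono (Nat.zero_le k) hint.2⟩
    obtain ⟨l, hl, u, v, hxu, hxv, hp'⟩ := exists_primitive hint
    obtain ⟨u', v', e1, e2⟩ := hprim u v hp'
    have e1' : (u * u' + a * v * v' : ℚ_[p]) = 1 := by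
      simpa using congrArg (fun z : ℤ_[p] => (z : ℚ_[p])) e1
    have e2' : (u * v' + v * u' + b * v * v' : ℚ_[p]) = 0 := by
      simpa using congrArg (fun z : ℤ_[p] => (z : ℚ_[p])) e2
    have h1 := T.mul_mem (hT.1 (mk_coe_mem_integralQuat (a := a) (b := b) (c := c)
      u' v' 0 0)) (hv x hx)
    have h2 : (⟨u', v', (0 : ℤ_[p]), (0 : ℤ_[p])⟩ : PadicQuat p a b c) *
        (⟨0, 0, x.imJ, x.imK⟩ : PadicQuat p a b c) =
        ⟨0, 0, ((p : ℚ_[p]) ^ l)⁻¹, 0⟩ := by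
      ext
      · simp
      · simp
      · simp [hxu, hxv]; linear_combination ((p : ℚ_[p]) ^ l)⁻¹ * e1'
      · simp [hxu, hxv]; linear_combination ((p : ℚ_[p]) ^ l)⁻¹ * e2'
    rw [h2, ← hA, hk, inv_pow_mem_padicBall] at h1
    rw [hxu, hxv]
    exact ⟨padicBall_mono h1 (mem_padicBall_iff.2 ⟨u, rfl⟩),
      padicBall_mono h1 (mem_padicBall_iff.2 ⟨v, rfl⟩)⟩
  -- The square of p^(-k) j is p^(-2k) c, an element of T and hence integral.
  have hdvd : (p : ℤ_[p]) ^ (2 * k) ∣ c := by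
    have h1 : ((p : ℚ_[p]) ^ k)⁻¹ ∈ A := hk ▸ inv_pow_mem_padicBall.2 le_rfl
    have h2 := T.mul_mem h1 h1
    have h3 := (hre _ h2).1
    obtain ⟨w, hw⟩ := mem_padicBall_zero.1 h3
    refine ⟨w, Subtype.coe_injective ?_⟩
    have h0 := padic_pow_ne_zero (p := p) k
    simp at hw
    push_cast
    rw [← hw, mul_comm 2 k, pow_mul]
    field_simp
  have hTk : T = inertRing a b c k hdvd := by
    ext x
    constructor
    · intro hx
      exact ⟨(hre x hx).1, (hre x hx).2, (hv2 x hx).1, (hv2 x hx).2⟩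
    · rintro ⟨h1, h2, h3, h4⟩
      rw [← hk, hA] at h3 h4
      have h5 : x = (⟨x.re, x.imI, 0, 0⟩ : PadicQuat p a b c) + ⟨0, 0, x.imJ, 0⟩ +
          (⟨(0 : ℤ_[p]), (1 : ℤ_[p]), (0 : ℤ_[p]), (0 : ℤ_[p])⟩ : PadicQuat p a b c) *
            ⟨0, 0, x.imK, 0⟩ := by
        ext <;> simp
      rw [h5]
      exact T.add_mem (T.add_mem (hT.1 ⟨h1, h2, zero_mem _, zero_mem _⟩) h3)
        (T.mul_mem (hT.1 (mk_coe_mem_integralQuat _ _ _ _)) h4)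
  refine ⟨k, hdvd, ?_, hTk⟩
  have h1 := (inertRing_mem_overrings (a := a) (b := b) k hdvd).2
  rw [← hTk, hT.2] at h1
  exact Nat.pow_right_injective hp.1.two_le h1

end Inert

/-! ### Local overorders: the split case -/

section Split

variable {p : ℕ} [hp : Fact p.Prime] {a b c : ℤ_[p]}

/-- For `x = u + v j`, the value of `u` at a root `r` of `X² - b X - a`. -/
noncomputable def evalU (r : ℤ_[p]) : PadicQuat p a b c →+ ℚ_[p] where
  toFun x := x.re + r * x.imI
  map_zero' := by simp
  map_add' x y := by simp; ring

/-- For `x = u + v j`, the value of `v` at a root `r` of `X² - b X - a`. -/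
noncomputable def evalV (r : ℤ_[p]) : PadicQuat p a b c →+ ℚ_[p] where
  toFun x := x.imJ + r * x.imK
  map_zero' := by simp
  map_add' x y := by simp; ring

theorem evalU_apply (r : ℤ_[p]) (x : PadicQuat p a b c) : evalU r x = x.re + r * x.imI := rfl

theorem evalV_apply (r : ℤ_[p]) (x : PadicQuat p a b c) : evalV r x = x.imJ + r * x.imK := rfl

theorem evalU_one (r : ℤ_[p]) : evalU r (1 : PadicQuat p a b c) = 1 := by
  simp [evalU_apply]

theorem evalV_one (r : ℤ_[p]) : evalV r (1 : PadicQuat p a b c) = 0 := by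
  simp [evalV_apply]

/-- `r` and `s` are the two roots of `X² - b X - a`, and they are distinct modulo `p`. -/
structure SplitRoots (a b r s : ℤ_[p]) : Prop where
  add_eq : r + s = b
  mul_eq : r * s = -a
  isUnit : IsUnit (r - s)

namespace SplitRoots

variable {r s : ℤ_[p]}

theorem symm (h : SplitRoots a b r s) : SplitRoots a b s r :=
  ⟨by rw [add_comm, h.add_eq], by rw [mul_comm, h.mul_eq], by
    rw [← neg_sub]; exact h.isUnit.neg⟩

theorem exists_inv (h : SplitRoots a b r s) : ∃ e : ℤ_[p], (r - s) * e = 1 :=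
  h.isUnit.exists_right_inv

/-- Since j u = ū j and conjugation exchanges the two roots, x ↦ ((u(r), v(r)), (c v(s), u(s))) is
multiplicative as a map to 2 × 2 matrices. This rule and `evalV_mul` are its first row; the second
row comes by exchanging r and s. -/
theorem evalU_mul (h : SplitRoots a b r s) (x y : PadicQuat p a b c) :
    evalU r (x * y) = evalU r x * evalU r y + c * evalV r x * evalV s y := by
  have h1 : (b : ℚ_[p]) = r + s := by
    simpa using congrArg (fun z : ℤ_[p] => (z : ℚ_[p])) h.add_eq.symm
  have h2 : (a : ℚ_[p]) = -(r * s) := by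
    have := congrArg (fun z : ℤ_[p] => (z : ℚ_[p])) h.mul_eq
    simp at this
    rw [this, neg_neg]
  simp only [evalU_apply, evalV_apply, QuaternionAlgebra.re_mul, QuaternionAlgebra.imI_mul]
  linear_combination (c * x.imJ * y.imK + r * x.imI * y.imI) * h1 +
    (x.imI * y.imI - c * x.imK * y.imK) * h2

theorem evalV_mul (h : SplitRoots a b r s) (x y : PadicQuat p a b c) :
    evalV r (x * y) = evalU r x * evalV r y + evalV r x * evalU s y := by
  have h1 : (b : ℚ_[p]) = r + s := by
    simpa using congrArg (fun z : ℤ_[p] => (z : ℚ_[p])) h.add_eq.symm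
  have h2 : (a : ℚ_[p]) = -(r * s) := by
    have := congrArg (fun z : ℤ_[p] => (z : ℚ_[p])) h.mul_eq
    simp at this
    rw [this, neg_neg]
  simp only [evalU_apply, evalV_apply, QuaternionAlgebra.imJ_mul, QuaternionAlgebra.imK_mul]
  linear_combination (x.imJ * y.imI + r * x.imI * y.imK) * h1 +
    (x.imI * y.imK - x.imK * y.imI) * h2

/-- Every quadruple is `(u(r), u(s), v(r), v(s))` for a quaternion `u + v j`. -/
theorem exists_eval (h : SplitRoots a b r s) (k l : ℕ) {P Q X Y : ℚ_[p]}
    (hP : P ∈ padicBall p k) (hQ : Q ∈ padicBall p k)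
    (hX : X ∈ padicBall p l) (hY : Y ∈ padicBall p l) :
    ∃ x : PadicQuat p a b c, evalU r x = P ∧ evalU s x = Q ∧ evalV r x = X ∧ evalV s x = Y ∧
      x.re ∈ padicBall p k ∧ x.imI ∈ padicBall p k ∧ x.imJ ∈ padicBall p l ∧
      x.imK ∈ padicBall p l := by
  obtain ⟨e, he⟩ := h.exists_inv
  have he' : ((r : ℚ_[p]) - s) * e = 1 := by
    simpa using congrArg (fun z : ℤ_[p] => (z : ℚ_[p])) he
  have hmul : ∀ (w : ℤ_[p]) {n : ℕ} {z : ℚ_[p]}, z ∈ padicBall p n → (w : ℚ_[p]) * z ∈ padicBall p n :=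
    fun w n z hz => by simpa using mul_mem_padicBall (coe_mem_padicBall 0 w) hz
  refine ⟨⟨P - r * (e * (P - Q)), e * (P - Q), X - r * (e * (X - Y)), e * (X - Y)⟩,
    ?_, ?_, ?_, ?_, ?_, ?_, ?_, ?_⟩
  · simp [evalU_apply]
  · simp only [evalU_apply]; linear_combination (-(P - Q)) * he'
  · simp [evalV_apply]
  · simp only [evalV_apply]; linear_combination (-(X - Y)) * he'
  · exact sub_mem hP (hmul _ (hmul _ (sub_mem hP hQ)))
  · exact hmul _ (sub_mem hP hQ)
  · exact sub_mem hX (hmul _ (hmul _ (sub_mem hX hY)))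
  · exact hmul _ (sub_mem hX hY)

theorem ext (h : SplitRoots a b r s) {x y : PadicQuat p a b c} (h1 : evalU r x = evalU r y)
    (h2 : evalU s x = evalU s y) (h3 : evalV r x = evalV r y) (h4 : evalV s x = evalV s y) :
    x = y := by
  obtain ⟨e, he⟩ := h.exists_inv
  have he' : ((r : ℚ_[p]) - s) * e = 1 := by
    simpa using congrArg (fun z : ℤ_[p] => (z : ℚ_[p])) he
  simp only [evalU_apply, evalV_apply] at h1 h2 h3 h4
  have hI : x.imI = y.imI := by
    linear_combination e * h1 - e * h2 - (x.imI - y.imI) * he'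
  have hK : x.imK = y.imK := by
    linear_combination e * h3 - e * h4 - (x.imK - y.imK) * he'
  rw [hI] at h1
  rw [hK] at h3
  exact QuaternionAlgebra.ext (add_right_cancel h1) hI (add_right_cancel h3) hK

theorem mem_integralQuat_iff (h : SplitRoots a b r s) {x : PadicQuat p a b c} :
    x ∈ integralQuat a b c ↔ evalU r x ∈ padicBall p 0 ∧ evalU s x ∈ padicBall p 0 ∧
      evalV r x ∈ padicBall p 0 ∧ evalV s x ∈ padicBall p 0 := by
  have hmul : ∀ (w : ℤ_[p]) {z : ℚ_[p]}, z ∈ padicBall p 0 → (w : ℚ_[p]) * z ∈ padicBall p 0 :=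
    fun w z hz => by simpa using mul_mem_padicBall (coe_mem_padicBall 0 w) hz
  constructor
  · rintro ⟨h1, h2, h3, h4⟩
    exact ⟨add_mem h1 (hmul r h2), add_mem h1 (hmul s h2), add_mem h3 (hmul r h4),
      add_mem h3 (hmul s h4)⟩
  · rintro ⟨h1, h2, h3, h4⟩
    obtain ⟨y, e1, e2, e3, e4, hy⟩ := h.exists_eval (c := c) 0 0 h1 h2 h3 h4
    rw [← h.ext e1 e2 e3 e4]
    exact hy

/-- The order of `u + v j` with `u` integral and `p ^ k v(r)`, `p ^ l v(s)` integral. -/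
def order (h : SplitRoots a b r s) (k l : ℕ) (hc : (p : ℤ_[p]) ^ (k + l) ∣ c) :
    Subring (PadicQuat p a b c) where
  carrier := {x | evalU r x ∈ padicBall p 0 ∧ evalU s x ∈ padicBall p 0 ∧
    evalV r x ∈ padicBall p k ∧ evalV s x ∈ padicBall p l}
  mul_mem' := by
    have hmul : ∀ {n : ℕ} {w z : ℚ_[p]}, w ∈ padicBall p 0 → z ∈ padicBall p n →
        w * z ∈ padicBall p n := fun {n w z} hw hz => by
      simpa using mul_mem_padicBall hw hz
    have hcm : ∀ {w z : ℚ_[p]}, w ∈ padicBall p k → z ∈ padicBall p l →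
        c * w * z ∈ padicBall p 0 := fun {w z} hw hz => by
      obtain ⟨w', rfl⟩ := mem_padicBall_iff.1 hw
      obtain ⟨z', rfl⟩ := mem_padicBall_iff.1 hz
      obtain ⟨d, rfl⟩ := hc
      refine mem_padicBall_zero.2 ⟨d * w' * z', ?_⟩
      have h0 := padic_pow_ne_zero (p := p) k
      have h1 := padic_pow_ne_zero (p := p) l
      push_cast
      rw [pow_add]
      field_simp
    rintro x y ⟨h1, h2, h3, h4⟩ ⟨g1, g2, g3, g4⟩
    refine ⟨?_, ?_, ?_, ?_⟩
    · rw [h.evalU_mul]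
      exact add_mem (hmul h1 g1) (hcm h3 g4)
    · rw [h.symm.evalU_mul, mul_right_comm]
      exact add_mem (hmul h2 g2) (hcm g3 h4)
    · rw [h.evalV_mul, mul_comm (evalV r x)]
      exact add_mem (hmul h1 g3) (hmul g2 h3)
    · rw [h.symm.evalV_mul, mul_comm (evalV s x)]
      exact add_mem (hmul h2 g4) (hmul g1 h4)
  one_mem' := by
    refine ⟨?_, ?_, ?_, ?_⟩
    · rw [evalU_one]; exact mem_padicBall_zero.2 ⟨1, by simp⟩
    · rw [evalU_one]; exact mem_padicBall_zero.2 ⟨1, by simp⟩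
    · rw [evalV_one]; exact zero_mem _
    · rw [evalV_one]; exact zero_mem _
  add_mem' := fun {x y} h g => by
    simp only [Set.mem_ofPred_eq, map_add] at *
    exact ⟨add_mem h.1 g.1, add_mem h.2.1 g.2.1, add_mem h.2.2.1 g.2.2.1,
      add_mem h.2.2.2 g.2.2.2⟩
  zero_mem' := by
    simp only [Set.mem_ofPred_eq, map_zero]
    exact ⟨zero_mem _, zero_mem _, zero_mem _, zero_mem _⟩
  neg_mem' := fun {x} h => by
    simp only [Set.mem_ofPred_eq, map_neg] at *
    exact ⟨neg_mem h.1, neg_mem h.2.1, neg_mem h.2.2.1, neg_mem h.2.2.2⟩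

theorem mem_order (h : SplitRoots a b r s) {k l : ℕ} {hc : (p : ℤ_[p]) ^ (k + l) ∣ c}
    {x : PadicQuat p a b c} : x ∈ h.order k l hc ↔ evalU r x ∈ padicBall p 0 ∧
      evalU s x ∈ padicBall p 0 ∧ evalV r x ∈ padicBall p k ∧ evalV s x ∈ padicBall p l := Iff.rfl

theorem order_mono (h : SplitRoots a b r s) {k l k' l' : ℕ} (hk : k ≤ k') (hl : l ≤ l')
    (hc : (p : ℤ_[p]) ^ (k + l) ∣ c) (hc' : (p : ℤ_[p]) ^ (k' + l') ∣ c) :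
    h.order k l hc ≤ h.order k' l' hc' := fun _ hx =>
  ⟨hx.1, hx.2.1, padicBall_mono hk hx.2.2.1, padicBall_mono hl hx.2.2.2⟩

theorem order_zero (h : SplitRoots a b r s) (hc : (p : ℤ_[p]) ^ (0 + 0) ∣ c) :
    h.order 0 0 hc = integralQuat a b c := by
  ext x
  rw [h.mem_integralQuat_iff]
  rfl

theorem order_mem_overrings (h : SplitRoots a b r s) (k l : ℕ) (hc : (p : ℤ_[p]) ^ (k + l) ∣ c) :
    h.order k l hc ∈ overrings (integralQuat a b c) (p ^ (k + l)) := by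
  rw [← h.order_zero (by simp)]
  refine ⟨h.order_mono (Nat.zero_le k) (Nat.zero_le l) _ hc, ?_⟩
  let T := (h.order k l hc).toAddSubgroup
  let T' := (padicBall p 0).comap (evalV r) ⊓ T
  have h1 : (h.order 0 0 (by simp)).toAddSubgroup = (padicBall p 0).comap (evalV s) ⊓ T' := by
    ext x
    constructor
    · rintro ⟨h1, h2, h3, h4⟩
      exact ⟨h4, h3, h1, h2, padicBall_mono (Nat.zero_le k) h3, padicBall_mono (Nat.zero_le l) h4⟩
    · rintro ⟨h4, h3, h1, h2, _, _⟩
      exact ⟨h1, h2, h3, h4⟩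
  have hT' : T' ≤ T := inf_le_right
  rw [h1, ← AddSubgroup.relIndex_mul_relIndex _ T' T inf_le_right hT',
    AddSubgroup.inf_relIndex_right, AddSubgroup.inf_relIndex_right, AddSubgroup.relIndex_comap,
    AddSubgroup.relIndex_comap]
  have hJ : T.map (evalV r) = padicBall p k := by
    ext z
    constructor
    · rintro ⟨x, hx, rfl⟩
      exact hx.2.2.1
    · intro hz
      obtain ⟨x, e1, e2, e3, e4, -⟩ := h.exists_eval (c := c) 0 k (zero_mem _) (zero_mem _) hz
        (zero_mem _)
      refine ⟨x, ⟨?_, ?_, ?_, ?_⟩, e3⟩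
      · rw [e1]; exact zero_mem _
      · rw [e2]; exact zero_mem _
      · rwa [e3]
      · rw [e4]; exact zero_mem _
  have hK : T'.map (evalV s) = padicBall p l := by
    ext z
    constructor
    · rintro ⟨x, hx, rfl⟩
      exact hx.2.2.2.2
    · intro hz
      obtain ⟨x, e1, e2, e3, e4, -⟩ := h.exists_eval (c := c) 0 l (zero_mem _) (zero_mem _)
        (zero_mem _) hz
      refine ⟨x, ⟨?_, ?_, ?_, ?_, ?_⟩, e4⟩
      · show evalV r x ∈ padicBall p 0
        rw [e3]; exact zero_mem _
      · rw [e1]; exact zero_mem _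
      · rw [e2]; exact zero_mem _
      · rw [e3]; exact zero_mem _
      · rwa [e4]
  rw [hJ, hK, relIndex_padicBall, relIndex_padicBall, pow_add, mul_comm]

theorem eq_of_order_eq (h : SplitRoots a b r s) {k l k' l' : ℕ}
    {hc : (p : ℤ_[p]) ^ (k + l) ∣ c} {hc' : (p : ℤ_[p]) ^ (k' + l') ∣ c}
    (heq : h.order k l hc = h.order k' l' hc') : k = k' ∧ l = l' := by
  have key : ∀ {k l k' l' : ℕ} (hc : (p : ℤ_[p]) ^ (k + l) ∣ c)
      (hc' : (p : ℤ_[p]) ^ (k' + l') ∣ c), h.order k l hc = h.order k' l' hc' → k ≤ k' ∧ l ≤ l' := by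
    intro k l k' l' hc hc' heq
    constructor
    · obtain ⟨x, e1, e2, e3, e4, -⟩ := h.exists_eval (c := c) 0 k (zero_mem _) (zero_mem _)
        (inv_pow_mem_padicBall.2 le_rfl) (zero_mem _)
      have : x ∈ h.order k l hc := by
        rw [mem_order, e1, e2, e3, e4]
        exact ⟨zero_mem _, zero_mem _, inv_pow_mem_padicBall.2 le_rfl, zero_mem _⟩
      rw [heq, mem_order, e3] at this
      exact inv_pow_mem_padicBall.1 this.2.2.1
    · obtain ⟨x, e1, e2, e3, e4, -⟩ := h.exists_eval (c := c) 0 l (zero_mem _) (zero_mem _)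
        (zero_mem _) (inv_pow_mem_padicBall.2 le_rfl)
      have : x ∈ h.order k l hc := by
        rw [mem_order, e1, e2, e3, e4]
        exact ⟨zero_mem _, zero_mem _, zero_mem _, inv_pow_mem_padicBall.2 le_rfl⟩
      rw [heq, mem_order, e4] at this
      exact inv_pow_mem_padicBall.1 this.2.2.2
  have h1 := key hc hc' heq
  have h2 := key hc' hc heq.symm
  omega

variable {m : ℕ} {T : Subring (PadicQuat p a b c)}

theorem evalU_mem_of_mem_overrings (r : ℤ_[p])
    (hT : T ∈ overrings (integralQuat a b c) (p ^ m)) {x : PadicQuat p a b c} (hx : x ∈ T) :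
    evalU r x ∈ padicBall p m ∧ evalV r x ∈ padicBall p m := by
  have hmul : ∀ (w : ℤ_[p]) {z : ℚ_[p]}, z ∈ padicBall p m → (w : ℚ_[p]) * z ∈ padicBall p m :=
    fun w z hz => by simpa using mul_mem_padicBall (coe_mem_padicBall 0 w) hz
  obtain ⟨h1, h2, h3, h4⟩ := mem_padicBall_of_mem_overrings hT hx
  exact ⟨add_mem h1 (hmul r h2), add_mem h3 (hmul r h4)⟩

/-- An overring of the order of integral quaternions contains the four components of its
elements. -/
theorem exists_component (h : SplitRoots a b r s)
    (hT : T ∈ overrings (integralQuat a b c) (p ^ m)) {x : PadicQuat p a b c} (hx : x ∈ T) :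
    (∃ y ∈ T, evalU r y = evalU r x ∧ evalU s y = 0 ∧ evalV r y = 0 ∧ evalV s y = 0) ∧
      (∃ y ∈ T, evalU r y = 0 ∧ evalU s y = 0 ∧ evalV r y = evalV r x ∧ evalV s y = 0) := by
  have h10 : (1 : ℚ_[p]) ∈ padicBall p 0 := mem_padicBall_zero.2 ⟨1, by simp⟩
  -- E and F are the two diagonal idempotents of the matrix picture; both are integral, and E x E
  -- and E x F cut out single matrix entries.
  obtain ⟨E, e1, e2, e3, e4, hE⟩ := h.exists_eval (c := c) 0 0 h10 (zero_mem _) (zero_mem _)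
    (zero_mem _)
  obtain ⟨F, f1, f2, f3, f4, hF⟩ := h.exists_eval (c := c) 0 0 (zero_mem _) h10 (zero_mem _)
    (zero_mem _)
  have hE : E ∈ T := hT.1 hE
  have hF : F ∈ T := hT.1 hF
  refine ⟨⟨E * x * E, T.mul_mem (T.mul_mem hE hx) hE, ?_⟩,
    ⟨E * x * F, T.mul_mem (T.mul_mem hE hx) hF, ?_⟩⟩ <;>
  simp [h.evalU_mul, h.evalV_mul, h.symm.evalU_mul, h.symm.evalV_mul, e1, e2, e3, e4, f1, f2, f3,
    f4]

/-- Replacing x by its diagonal component makes u(r) multiplicative on powers, and these are bounded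
because T has finite index. -/
theorem evalU_integral (h : SplitRoots a b r s)
    (hT : T ∈ overrings (integralQuat a b c) (p ^ m)) {x : PadicQuat p a b c} (hx : x ∈ T) :
    evalU r x ∈ padicBall p 0 := by
  obtain ⟨⟨y, hy, h1, h2, h3, h4⟩, -⟩ := h.exists_component hT hx
  refine mem_padicBall_zero_of_pow (m := m) fun n => ?_
  have key : evalU r (y ^ n) = evalU r y ^ n ∧ evalV r (y ^ n) = 0 ∧ evalV s (y ^ n) = 0 := by
    induction n with
    | zero => exact ⟨by simp [evalU_one], by simp [evalV_one], by simp [evalV_one]⟩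
    | succ n ih =>
      have hpow : y ^ (n + 1) = y ^ n * y := pow_succ _ _
      rw [hpow]
      refine ⟨?_, ?_, ?_⟩
      · rw [h.evalU_mul, ih.1, h4]; simp [pow_succ]
      · rw [h.evalV_mul, ih.2.1, h3]; simp
      · rw [h.symm.evalV_mul, ih.2.2, h4]; simp
  have := (evalU_mem_of_mem_overrings r hT (T.pow_mem hy n)).1
  rwa [key.1, h1] at this

/-- The set of the values at `r` of the `v` with `u + v j` in an overring. -/
theorem exists_padicBall_evalV (h : SplitRoots a b r s)
    (hT : T ∈ overrings (integralQuat a b c) (p ^ m)) :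
    ∃ k ≤ m, (∀ x ∈ T, evalV r x ∈ padicBall p k) ∧ ∀ x : PadicQuat p a b c, evalU r x = 0 →
      evalU s x = 0 → evalV r x ∈ padicBall p k → evalV s x = 0 → x ∈ T := by
  have h10 : (1 : ℚ_[p]) ∈ padicBall p 0 := mem_padicBall_zero.2 ⟨1, by simp⟩
  obtain ⟨k, hkm, hk⟩ := exists_eq_padicBall (T.toAddSubgroup.map (evalV r)) (by
      obtain ⟨y, -, -, h3, -, hy⟩ := h.exists_eval (c := c) 0 0 (zero_mem _) (zero_mem _) h10
        (zero_mem _)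
      exact ⟨y, hT.1 hy, h3⟩)
    (by
      rintro w _ ⟨x, hx, rfl⟩
      refine ⟨_, smul_coe_mem hT (coe_mem_padicBall 0 w) hx, ?_⟩
      simp only [evalV_apply, QuaternionAlgebra.imJ_smul, QuaternionAlgebra.imK_smul, smul_eq_mul]
      ring)
    m (by
      rintro _ ⟨x, hx, rfl⟩
      exact (evalU_mem_of_mem_overrings r hT hx).2)
  refine ⟨k, hkm, fun x hx => hk ▸ ⟨x, hx, rfl⟩, fun x h1 h2 h3 h4 => ?_⟩
  rw [← hk] at h3
  obtain ⟨y, hy, hyx⟩ := h3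
  obtain ⟨z, hz, z1, z2, z3, z4⟩ := (h.exists_component hT hy).2
  rwa [h.ext (h1.trans z1.symm) (h2.trans z2.symm) (hyx.symm.trans z3.symm) (h4.trans z4.symm)]

/-- T contains the matrix components of its elements, so it is the direct sum of four ℤ_p-modules:
the two diagonal ones are ℤ_p and the off-diagonal ones are fractional ideals p^(-k) and p^(-l).
Multiplying generators of the latter gives the diagonal entry c p^(-k-l), whose integrality is the
only constraint. -/
theorem overrings_eq (h : SplitRoots a b r s)
    (hT : T ∈ overrings (integralQuat a b c) (p ^ m)) :
    ∃ (k l : ℕ) (hc : (p : ℤ_[p]) ^ (k + l) ∣ c), m = k + l ∧ T = h.order k l hc := by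
  have h10 : (1 : ℚ_[p]) ∈ padicBall p 0 := mem_padicBall_zero.2 ⟨1, by simp⟩
  obtain ⟨k, -, hk1, hk2⟩ := h.exists_padicBall_evalV hT
  obtain ⟨l, -, hl1, hl2⟩ := h.symm.exists_padicBall_evalV hT
  have hc : (p : ℤ_[p]) ^ (k + l) ∣ c := by
    obtain ⟨x, e1, e2, e3, e4, -⟩ := h.exists_eval (c := c) 0 k (zero_mem _) (zero_mem _)
      (inv_pow_mem_padicBall.2 le_rfl) (zero_mem _)
    obtain ⟨y, f1, f2, f3, f4, -⟩ := h.exists_eval (c := c) 0 l (zero_mem _) (zero_mem _)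
      (zero_mem _) (inv_pow_mem_padicBall.2 le_rfl)
    have hx : x ∈ T := hk2 x e1 e2 (by rw [e3]; exact inv_pow_mem_padicBall.2 le_rfl) e4
    have hy : y ∈ T := hl2 y f2 f1 (by rw [f4]; exact inv_pow_mem_padicBall.2 le_rfl) f3
    have hxy := h.evalU_integral hT (T.mul_mem hx hy)
    rw [h.evalU_mul, e1, e3, f4, zero_mul, zero_add] at hxy
    obtain ⟨w, hw⟩ := mem_padicBall_zero.1 hxy
    refine ⟨w, Subtype.coe_injective ?_⟩
    have h0 := padic_pow_ne_zero (p := p) k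
    have h1 := padic_pow_ne_zero (p := p) l
    push_cast
    rw [← hw, pow_add]
    field_simp
  have hTk : T = h.order k l hc := by
    ext x
    constructor
    · intro hx
      exact ⟨h.evalU_integral hT hx, h.symm.evalU_integral hT hx, hk1 x hx, hl1 x hx⟩
    · rintro ⟨h1, h2, h3, h4⟩
      obtain ⟨y, y1, y2, y3, y4, hy⟩ := h.exists_eval (c := c) 0 0 h1 h2 (zero_mem _) (zero_mem _)
      obtain ⟨z, z1, z2, z3, z4, -⟩ := h.exists_eval (c := c) 0 k (zero_mem _) (zero_mem _)
        h3 (zero_mem _)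
      obtain ⟨w, w1, w2, w3, w4, -⟩ := h.exists_eval (c := c) 0 l (zero_mem _) (zero_mem _)
        (zero_mem _) h4
      have : x = y + z + w := h.ext (by simp [y1, z1, w1]) (by simp [y2, z2, w2])
        (by simp [y3, z3, w3]) (by simp [y4, z4, w4])
      rw [this]
      exact T.add_mem (T.add_mem (hT.1 hy) (hk2 z z1 z2 (by rwa [z3]) z4))
        (hl2 w w2 w1 (by rwa [w4]) w3)
  refine ⟨k, l, hc, ?_, hTk⟩
  have h1 := (h.order_mem_overrings k l hc).2
  rw [← hTk, hT.2] at h1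
  exact Nat.pow_right_injective hp.1.two_le h1

end SplitRoots

end Split

/-! ### Counting local overorders -/

section LocalCount

variable {B : Type*} [Ring B]

/-- Every overring of `S` of `p`-power index has index at most `p ^ n`, and it lies in a larger one
as long as its index is less than `p ^ n`. -/
structure HasMaximalExponent (S : Subring B) (p n : ℕ) : Prop where
  le : ∀ m, ∀ T ∈ overrings S (p ^ m), m ≤ n
  exists_lt : ∀ m < n, ∀ T ∈ overrings S (p ^ m), ∃ l, m < l ∧ ∃ T' ∈ overrings S (p ^ l), T ≤ T'

theorem IsCompletionAt.hasMaximalExponent {C : Type*} [Ring C] {p : ℕ} {Φ : B →+* C}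
    {S : Subring B} {Λ : Subring C} (h : IsCompletionAt p Φ S Λ) {n : ℕ}
    (hΛ : HasMaximalExponent Λ p n) : HasMaximalExponent S p n where
  le m _ hT := hΛ.le m _ (h.closure_mem_overrings hT)
  exists_lt := h.exists_lt_of_forall_exists_lt hΛ.exists_lt

variable {p : ℕ} [hp : Fact p.Prime] {a b c : ℤ_[p]} {n : ℕ}

theorem SplitRoots.hasMaximalExponent {r s : ℤ_[p]} (h : SplitRoots a b r s)
    (hn : ∀ m, (p : ℤ_[p]) ^ m ∣ c ↔ m ≤ n) : HasMaximalExponent (integralQuat a b c) p n where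
  le m T hT := by
    obtain ⟨k, l, hc, rfl, -⟩ := h.overrings_eq hT
    exact (hn _).1 hc
  exists_lt m hm T hT := by
    obtain ⟨k, l, hc, rfl, rfl⟩ := h.overrings_eq hT
    refine ⟨k + (l + 1), by omega, _, h.order_mem_overrings k (l + 1) ((hn _).2 (by omega)),
      h.order_mono le_rfl (Nat.le_succ l) _ _⟩

theorem SplitRoots.ncard_overrings {r s : ℤ_[p]} (h : SplitRoots a b r s) {m : ℕ}
    (hc : (p : ℤ_[p]) ^ m ∣ c) : (overrings (integralQuat a b c) (p ^ m)).ncard = m + 1 := by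
  have hle : ∀ k : Fin (m + 1), (k : ℕ) + (m - k) = m := fun k => by omega
  have hc' : ∀ k : Fin (m + 1), (p : ℤ_[p]) ^ ((k : ℕ) + (m - k)) ∣ c := fun k => by rwa [hle]
  have : overrings (integralQuat a b c) (p ^ m) =
      Set.range fun k : Fin (m + 1) => h.order k (m - k) (hc' k) := by
    ext T
    constructor
    · intro hT
      obtain ⟨k, l, hc, rfl, rfl⟩ := h.overrings_eq hT
      refine ⟨⟨k, by omega⟩, ?_⟩
      simp only [Nat.add_sub_cancel_left]
    · rintro ⟨k, rfl⟩
      have := h.order_mem_overrings (k : ℕ) (m - k) (hc' k)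
      rwa [hle] at this
  rw [this, ← Nat.card_coe_set_eq, Nat.card_range_of_injective, Nat.card_fin]
  intro k l hkl
  exact Fin.ext (h.eq_of_order_eq hkl).1

/-- Only even powers of p occur as indices, so an odd n is rounded down to 2 * (n / 2). -/
theorem inert_hasMaximalExponent (hdisc : IsUnit (b ^ 2 + 4 * a))
    (haniso : ∀ x y : ℤ_[p], (p : ℤ_[p]) ∣ x ^ 2 + b * x * y - a * y ^ 2 →
      (p : ℤ_[p]) ∣ x ∧ (p : ℤ_[p]) ∣ y)
    (hn : ∀ m, (p : ℤ_[p]) ^ m ∣ c ↔ m ≤ n) :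
    HasMaximalExponent (integralQuat a b c) p (2 * (n / 2)) where
  le m T hT := by
    obtain ⟨k, hc, rfl, -⟩ := inert_overrings hT hdisc haniso
    have := (hn _).1 hc
    omega
  exists_lt m hm T hT := by
    obtain ⟨k, hc, rfl, rfl⟩ := inert_overrings hT hdisc haniso
    have hk : 2 * (k + 1) ≤ n := by omega
    exact ⟨2 * (k + 1), by omega, _, inertRing_mem_overrings (k + 1) ((hn _).2 hk),
      inertRing_mono (Nat.le_succ k) _ _⟩

theorem inert_ncard_overrings (hdisc : IsUnit (b ^ 2 + 4 * a))
    (haniso : ∀ x y : ℤ_[p], (p : ℤ_[p]) ∣ x ^ 2 + b * x * y - a * y ^ 2 →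
      (p : ℤ_[p]) ∣ x ∧ (p : ℤ_[p]) ∣ y) {k : ℕ} (hc : (p : ℤ_[p]) ^ (2 * k) ∣ c) :
    (overrings (integralQuat a b c) (p ^ (2 * k))).ncard = 1 := by
  rw [Set.ncard_eq_one]
  refine ⟨inertRing a b c k hc, ?_⟩
  ext T
  constructor
  · intro hT
    obtain ⟨l, hl, hkl, rfl⟩ := inert_overrings hT hdisc haniso
    obtain rfl : k = l := by omega
    rfl
  · rintro rfl
    exact inertRing_mem_overrings k hc

end LocalCount

/-! ### From rational to p-adic quaternions -/

section RationalQuat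

open Quaternion

/-- The quaternion algebra over `ℚ` with `i² = a + b i`, `j² = c`, `j i = (b - i) j`. -/
abbrev RatQuat (a b c : ℤ) : Type := ℍ[ℚ,(a : ℚ),(b : ℚ),(c : ℚ)]

variable (p : ℕ) [hp : Fact p.Prime] (a b c : ℤ)

/-- The map from rational to `p`-adic quaternions. -/
noncomputable def ratToPadicQuat :
    RatQuat a b c →+* PadicQuat p (a : ℤ_[p]) (b : ℤ_[p]) (c : ℤ_[p]) where
  toFun x := ⟨x.re, x.imI, x.imJ, x.imK⟩
  map_one' := by ext <;> simp
  map_zero' := by ext <;> simp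
  map_add' x y := QuaternionAlgebra.ext (Rat.cast_add _ _) (Rat.cast_add _ _) (Rat.cast_add _ _)
    (Rat.cast_add _ _)
  map_mul' x y := by
    refine QuaternionAlgebra.ext ?_ ?_ ?_ ?_
    · change (((x * y).re : ℚ) : ℚ_[p]) = x.re * y.re + (a : ℤ_[p]) * x.imI * y.imI +
        (c : ℤ_[p]) * x.imJ * y.imJ + (b : ℤ_[p]) * (c : ℤ_[p]) * x.imJ * y.imK -
        (a : ℤ_[p]) * (c : ℤ_[p]) * x.imK * y.imK
      rw [QuaternionAlgebra.re_mul]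
      push_cast
      ring
    · change (((x * y).imI : ℚ) : ℚ_[p]) = x.re * y.imI + x.imI * y.re +
        (b : ℤ_[p]) * x.imI * y.imI - (c : ℤ_[p]) * x.imJ * y.imK + (c : ℤ_[p]) * x.imK * y.imJ
      rw [QuaternionAlgebra.imI_mul]
      push_cast
      ring
    · change (((x * y).imJ : ℚ) : ℚ_[p]) = x.re * y.imJ + (a : ℤ_[p]) * x.imI * y.imK +
        x.imJ * y.re + (b : ℤ_[p]) * x.imJ * y.imI - (a : ℤ_[p]) * x.imK * y.imI
      rw [QuaternionAlgebra.imJ_mul]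
      push_cast
      ring
    · change (((x * y).imK : ℚ) : ℚ_[p]) = x.re * y.imK + x.imI * y.imJ +
        (b : ℤ_[p]) * x.imI * y.imK - x.imJ * y.imI + x.imK * y.re
      rw [QuaternionAlgebra.imK_mul]
      push_cast
      ring

variable {p a b c}

theorem ratCast_mem_padicBall_zero {q : ℚ} {d : ℤ} (hd : ¬ (p : ℤ) ∣ d) {z : ℤ}
    (h : q * d = z) : (q : ℚ_[p]) ∈ padicBall p 0 := by
  have h1 : ‖(d : ℚ_[p])‖ = 1 := by
    refine le_antisymm (Padic.norm_int_le_one d) (not_lt.1 fun hlt => hd ?_)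
    rwa [Padic.norm_intCast_lt_one_iff] at hlt
  have h2 : (q : ℚ_[p]) * d = z := by exact_mod_cast congrArg (fun r : ℚ => (r : ℚ_[p])) h
  rw [mem_padicBall, pow_zero]
  calc ‖(q : ℚ_[p])‖ = ‖(q : ℚ_[p]) * d‖ := by rw [norm_mul, h1, mul_one]
    _ ≤ 1 := by rw [h2]; exact Padic.norm_int_le_one z

theorem den_coprime_of_mem_padicBall_zero {q : ℚ} (h : (q : ℚ_[p]) ∈ padicBall p 0) :
    q.den.Coprime p := by
  rw [mem_padicBall, pow_zero] at h
  rw [Nat.coprime_comm, hp.1.coprime_iff_not_dvd]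
  intro hd
  have h2 : ¬ (p : ℤ) ∣ q.num := fun hn => by
    have := Nat.dvd_gcd (Int.natCast_dvd.1 hn) hd
    rw [q.reduced.gcd_eq_one] at this
    exact hp.1.one_lt.ne' (Nat.dvd_one.1 this)
  have h3 : ‖(q.den : ℚ_[p])‖ < 1 := by
    have := (Padic.norm_intCast_lt_one_iff (p := p) (k := (q.den : ℤ))).2 (Int.natCast_dvd_natCast.2 hd)
    simpa using this
  have h4 : ‖(q.num : ℚ_[p])‖ = 1 :=
    le_antisymm (Padic.norm_int_le_one _) (not_lt.1 fun hlt => h2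
      ((Padic.norm_intCast_lt_one_iff).1 hlt))
  have h5 : (q : ℚ_[p]) * q.den = q.num := by exact_mod_cast congrArg (fun r : ℚ => (r : ℚ_[p])) (Rat.mul_den_eq_num q)
  have h6 : ‖(q : ℚ_[p])‖ * ‖(q.den : ℚ_[p])‖ = 1 := by rw [← norm_mul, h5, h4]
  have := mul_lt_one_of_nonneg_of_lt_one_right h (norm_nonneg _) h3
  linarith

/-- An order of a rational quaternion algebra that contains `i` and `j` and whose elements have
`p`-integral coordinates completes to the order of integral quaternions at `p`. -/
theorem isCompletionAt_of_algEquiv {B : Type*} [Ring B] [Algebra ℚ B] (F : B ≃ₐ[ℚ] RatQuat a b c)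
    {S : Subring B} (hi : F.symm ⟨0, 1, 0, 0⟩ ∈ S) (hj : F.symm ⟨0, 0, 1, 0⟩ ∈ S)
    (hS : ∀ x ∈ S, ratToPadicQuat p a b c (F x) ∈ integralQuat (a : ℤ_[p]) (b : ℤ_[p]) (c : ℤ_[p])) :
    IsCompletionAt p ((ratToPadicQuat p a b c).comp F.toRingEquiv.toRingHom) S
      (integralQuat (a : ℤ_[p]) (b : ℤ_[p]) (c : ℤ_[p])) := by
  have hint : ∀ x y z w : ℤ, F.symm ⟨x, y, z, w⟩ ∈ S := by
    intro x y z w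
    have : (⟨x, y, z, w⟩ : RatQuat a b c) = x • (1 : RatQuat a b c) + y • ⟨0, 1, 0, 0⟩ +
        z • ⟨0, 0, 1, 0⟩ + w • ((⟨0, 1, 0, 0⟩ : RatQuat a b c) * ⟨0, 0, 1, 0⟩) := by
      ext <;> simp
    rw [this, map_add, map_add, map_add, map_zsmul, map_zsmul, map_zsmul, map_zsmul, map_mul,
      map_one]
    exact S.add_mem (S.add_mem (S.add_mem (S.zsmul_mem S.one_mem _) (S.zsmul_mem hi _))
      (S.zsmul_mem hj _)) (S.zsmul_mem (S.mul_mem hi hj) _)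
  have hp0 : ∀ k : ℕ, (p ^ k : ℚ) ≠ 0 := fun k => pow_ne_zero _ (Nat.cast_ne_zero.2 hp.1.ne_zero)
  refine ⟨hS, ?_, ?_, ?_, ?_⟩
  · rintro x k hk ⟨h1, h2, h3, h4⟩
    have c1 : (F x).re.den.Coprime p := den_coprime_of_mem_padicBall_zero h1
    have c2 : (F x).imI.den.Coprime p := den_coprime_of_mem_padicBall_zero h2
    have c3 : (F x).imJ.den.Coprime p := den_coprime_of_mem_padicBall_zero h3
    have c4 : (F x).imK.den.Coprime p := den_coprime_of_mem_padicBall_zero h4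
    -- A common denominator prime to p. Both d • x, whose coordinates are integers, and p ^ k • x
    -- lie in S, hence so does x.
    set d := (F x).re.den * (F x).imI.den * ((F x).imJ.den * (F x).imK.den) with hd
    have hden : ∀ q : ℚ, q.den ∣ d → ∃ n : ℤ, (d : ℚ) * q = n := by
      rintro q ⟨e, he⟩
      refine ⟨e * q.num, ?_⟩
      rw [he]
      push_cast
      rw [mul_comm (q.den : ℚ), mul_assoc, Rat.den_mul_eq_num]
    obtain ⟨n1, e1⟩ := hden (F x).re ⟨(F x).imI.den * ((F x).imJ.den * (F x).imK.den), by
      rw [hd]; ring⟩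
    obtain ⟨n2, e2⟩ := hden (F x).imI ⟨(F x).re.den * ((F x).imJ.den * (F x).imK.den), by
      rw [hd]; ring⟩
    obtain ⟨n3, e3⟩ := hden (F x).imJ ⟨(F x).re.den * ((F x).imI.den * (F x).imK.den), by
      rw [hd]; ring⟩
    obtain ⟨n4, e4⟩ := hden (F x).imK ⟨(F x).re.den * ((F x).imI.den * (F x).imJ.den), by
      rw [hd]; ring⟩
    refine mem_of_coprime_nsmul_mem (((c1.mul_left c2).mul_left (c3.mul_left c4)).pow_right k) ?_ hk
    have : d • x = F.symm ⟨n1, n2, n3, n4⟩ := by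
      apply F.injective
      rw [AlgEquiv.apply_symm_apply, map_nsmul, ← e1, ← e2, ← e3, ← e4]
      ext <;> simp
    rw [← hd, this]
    exact hint _ _ _ _
  · rintro z ⟨h1, h2, h3, h4⟩ k
    have happ : ∀ q : ℚ_[p], q ∈ padicBall p 0 → ∃ (n : ℤ) (w : ℤ_[p]), q = n + (p : ℚ_[p]) ^ k * w := by
      intro q hq
      obtain ⟨w, rfl⟩ := mem_padicBall_zero.1 hq
      obtain ⟨v, hv⟩ := Ideal.mem_span_singleton.1 (PadicInt.appr_spec k w)
      refine ⟨w.appr k, v, ?_⟩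
      have := congrArg (fun z : ℤ_[p] => (z : ℚ_[p])) hv
      push_cast at this
      push_cast
      linear_combination this
    obtain ⟨n1, w1, e1⟩ := happ _ h1
    obtain ⟨n2, w2, e2⟩ := happ _ h2
    obtain ⟨n3, w3, e3⟩ := happ _ h3
    obtain ⟨n4, w4, e4⟩ := happ _ h4
    refine ⟨_, hint n1 n2 n3 n4, _, mk_coe_mem_integralQuat w1 w2 w3 w4, ?_⟩
    have : ((ratToPadicQuat p a b c).comp F.toRingEquiv.toRingHom) (F.symm ⟨n1, n2, n3, n4⟩) =
        ⟨((n1 : ℚ) : ℚ_[p]), ((n2 : ℚ) : ℚ_[p]), ((n3 : ℚ) : ℚ_[p]), ((n4 : ℚ) : ℚ_[p])⟩ := by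
      change ratToPadicQuat p a b c (F (F.symm _)) = _
      rw [AlgEquiv.apply_symm_apply]
      rfl
    rw [this]
    refine QuaternionAlgebra.ext ?_ ?_ ?_ ?_
    · change z.re = ((n1 : ℚ) : ℚ_[p]) + p ^ k • (w1 : ℚ_[p])
      rw [e1, nsmul_eq_mul]; push_cast; rfl
    · change z.imI = ((n2 : ℚ) : ℚ_[p]) + p ^ k • (w2 : ℚ_[p])
      rw [e2, nsmul_eq_mul]; push_cast; rfl
    · change z.imJ = ((n3 : ℚ) : ℚ_[p]) + p ^ k • (w3 : ℚ_[p])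
      rw [e3, nsmul_eq_mul]; push_cast; rfl
    · change z.imK = ((n4 : ℚ) : ℚ_[p]) + p ^ k • (w4 : ℚ_[p])
      rw [e4, nsmul_eq_mul]; push_cast; rfl
  · intro x k
    refine ⟨((p : ℚ) ^ k)⁻¹ • x, ?_⟩
    rw [← Nat.cast_smul_eq_nsmul ℚ, smul_smul]
    push_cast
    rw [mul_inv_cancel₀ (hp0 k), one_smul]
  · intro z k hz
    rw [← Nat.cast_smul_eq_nsmul ℚ_[p]] at hz
    refine (smul_eq_zero.1 hz).resolve_left ?_
    push_cast
    exact padic_pow_ne_zero k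

end RationalQuat

/-! ### The Clifford algebra as a quaternion algebra -/

section CliffordIso

variable {Δ₁ Δ₂ t a c : ℤ}

/-- `e₁ ↦ 2 i - Δ₁`, `e₂ ↦ e₁ (t + 2 j) / Δ₁`. -/
noncomputable def cliffordToQuat (ha : 4 * a = Δ₁ - Δ₁ ^ 2) (hc : 4 * c = t ^ 2 - Δ₁ * Δ₂)
    (h0 : Δ₁ ≠ 0) : CliffordQuat Δ₁ Δ₂ t →ₐ[ℚ] RatQuat a Δ₁ c :=
  CliffordAlgebra.lift (binaryForm Δ₁ Δ₂ t)
    -- The commutator of γ₁ and γ₂ is (e₁e₂ - t)/2. If it is to be j, then e₁e₂ = t + 2j, and e₁⁻¹ =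
    -- e₁/Δ₁ determines the image of e₂.
    ⟨(LinearMap.fst ℚ ℚ ℚ).smulRight (⟨-Δ₁, 2, 0, 0⟩ : RatQuat a Δ₁ c) +
      (LinearMap.snd ℚ ℚ ℚ).smulRight (⟨-t, 2 * t / Δ₁, -2, 4 / Δ₁⟩ : RatQuat a Δ₁ c), by
      rintro ⟨x, y⟩
      have h0' : (Δ₁ : ℚ) ≠ 0 := Int.cast_ne_zero.2 h0
      have ha' : (a : ℚ) = (Δ₁ - Δ₁ ^ 2) / 4 := by
        rw [eq_div_iff (by norm_num), mul_comm]; exact_mod_cast ha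
      have hc' : (c : ℚ) = (t ^ 2 - Δ₁ * Δ₂) / 4 := by
        rw [eq_div_iff (by norm_num), mul_comm]; exact_mod_cast hc
      rw [binaryForm_apply]
      generalize hq : (Δ₁ * x ^ 2 + 2 * t * x * y + Δ₂ * y ^ 2 : ℚ) = q
      ext
      · simp
        generalize (a : ℚ) = a' at *
        generalize (c : ℚ) = c' at *
        subst ha' hc'
        rw [← hq]
        field_simp
        ring
      · simp
        generalize (c : ℚ) = c' at *
        subst hc'
        field_simp
        ring
      · simp
        generalize (a : ℚ) = a' at *
        subst ha'
        field_simp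
        ring
      · simp
        field_simp
        ring⟩

theorem cliffordToQuat_ι (ha : 4 * a = Δ₁ - Δ₁ ^ 2) (hc : 4 * c = t ^ 2 - Δ₁ * Δ₂)
    (h0 : Δ₁ ≠ 0) (x y : ℚ) :
    cliffordToQuat ha hc h0 (CliffordAlgebra.ι _ (x, y)) =
      x • (⟨-Δ₁, 2, 0, 0⟩ : RatQuat a Δ₁ c) + y • ⟨-t, 2 * t / Δ₁, -2, 4 / Δ₁⟩ := by
  rw [cliffordToQuat, CliffordAlgebra.lift_ι_apply]
  rfl

theorem cliffordToQuat_gen₁ (ha : 4 * a = Δ₁ - Δ₁ ^ 2) (hc : 4 * c = t ^ 2 - Δ₁ * Δ₂)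
    (h0 : Δ₁ ≠ 0) : cliffordToQuat ha hc h0 (cliffordGen₁ Δ₁ Δ₂ t) = ⟨0, 1, 0, 0⟩ := by
  rw [cliffordGen₁, map_smul, map_add, AlgHom.commutes, cliffordToQuat_ι]
  ext <;> simp

theorem cliffordToQuat_gen₂ (ha : 4 * a = Δ₁ - Δ₁ ^ 2) (hc : 4 * c = t ^ 2 - Δ₁ * Δ₂)
    (h0 : Δ₁ ≠ 0) : cliffordToQuat ha hc h0 (cliffordGen₂ Δ₁ Δ₂ t) =
      ⟨(Δ₂ - t) / 2, t / Δ₁, -1, 2 / Δ₁⟩ := by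
  rw [cliffordGen₂, map_smul, map_add, AlgHom.commutes, cliffordToQuat_ι]
  ext <;> simp <;> ring

theorem ι_mul_ι_add (x y x' y' : ℚ) :
    (CliffordAlgebra.ι (binaryForm Δ₁ Δ₂ t) (x, y)) * CliffordAlgebra.ι _ (x', y') +
      CliffordAlgebra.ι _ (x', y') * CliffordAlgebra.ι _ (x, y) =
      algebraMap ℚ _ (2 * Δ₁ * x * x' + 2 * t * (x * y' + x' * y) + 2 * Δ₂ * y * y') := by
  rw [CliffordAlgebra.ι_mul_ι_add_swap, QuadraticMap.polar, Prod.mk_add_mk, binaryForm_apply,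
    binaryForm_apply, binaryForm_apply]
  congr 1
  ring

/-- The commutator of the two generators of the Clifford order. -/
noncomputable def cliffordComm (Δ₁ Δ₂ t : ℤ) : CliffordQuat Δ₁ Δ₂ t :=
  cliffordGen₁ Δ₁ Δ₂ t * cliffordGen₂ Δ₁ Δ₂ t - cliffordGen₂ Δ₁ Δ₂ t * cliffordGen₁ Δ₁ Δ₂ t

theorem cliffordToQuat_comm (ha : 4 * a = Δ₁ - Δ₁ ^ 2) (hc : 4 * c = t ^ 2 - Δ₁ * Δ₂)
    (h0 : Δ₁ ≠ 0) : cliffordToQuat ha hc h0 (cliffordComm Δ₁ Δ₂ t) = ⟨0, 0, 1, 0⟩ := by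
  have h0' : (Δ₁ : ℚ) ≠ 0 := Int.cast_ne_zero.2 h0
  have ha' : (4 * a : ℚ) = Δ₁ - Δ₁ ^ 2 := by exact_mod_cast ha
  rw [cliffordComm, map_sub, map_mul, map_mul, cliffordToQuat_gen₁, cliffordToQuat_gen₂]
  ext
  · simp
  · simp
  · simp
    field_simp
    linear_combination ha'
  · simp
    field_simp
    norm_num

/-- Rewriting rules that bring every word in X and Y to a combination of 1, X, Y, XY. The versions
with z act inside right-associated products. -/
theorem ι_relations (z : CliffordQuat Δ₁ Δ₂ t) :
    let X := CliffordAlgebra.ι (binaryForm Δ₁ Δ₂ t) (1, 0)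
    let Y := CliffordAlgebra.ι (binaryForm Δ₁ Δ₂ t) (0, 1)
    X * X = (Δ₁ : ℚ) • 1 ∧ Y * Y = (Δ₂ : ℚ) • 1 ∧ Y * X = (2 * t : ℚ) • 1 - X * Y ∧
      X * (X * z) = (Δ₁ : ℚ) • z ∧ Y * (Y * z) = (Δ₂ : ℚ) • z ∧
        Y * (X * z) = (2 * t : ℚ) • z - X * (Y * z) := by
  intro X Y
  have hXX : X * X = (Δ₁ : ℚ) • 1 := by
    rw [CliffordAlgebra.ι_sq_scalar, binaryForm_apply, Algebra.algebraMap_eq_smul_one]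
    congr 1
    ring
  have hYY : Y * Y = (Δ₂ : ℚ) • 1 := by
    rw [CliffordAlgebra.ι_sq_scalar, binaryForm_apply, Algebra.algebraMap_eq_smul_one]
    congr 1
    ring
  have hYX : Y * X = (2 * t : ℚ) • 1 - X * Y := by
    rw [eq_sub_iff_add_eq, ι_mul_ι_add, Algebra.algebraMap_eq_smul_one]
    congr 1
    ring
  refine ⟨hXX, hYY, hYX, ?_, ?_, ?_⟩
  · rw [← mul_assoc, hXX, smul_one_mul]
  · rw [← mul_assoc, hYY, smul_one_mul]
  · rw [← mul_assoc, hYX, sub_mul, smul_one_mul, mul_assoc]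

theorem cliffordComm_eq : cliffordComm Δ₁ Δ₂ t = (1 / 2 : ℚ) •
    (CliffordAlgebra.ι (binaryForm Δ₁ Δ₂ t) (1, 0) * CliffordAlgebra.ι (binaryForm Δ₁ Δ₂ t) (0, 1)) -
      (t / 2 : ℚ) • 1 := by
  obtain ⟨h1, h2, h3, -⟩ := ι_relations (1 : CliffordQuat Δ₁ Δ₂ t)
  simp only [cliffordComm, cliffordGen₁, cliffordGen₂, Algebra.algebraMap_eq_smul_one, smul_mul_assoc,
    mul_smul_comm, mul_add, add_mul, one_mul, mul_one, h1, h2, h3]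
  module

/-- The quaternion basis `i = γ₁`, `j = γ₁ γ₂ - γ₂ γ₁` of the Clifford algebra. -/
noncomputable def cliffordBasis (ha : 4 * a = Δ₁ - Δ₁ ^ 2) (hc : 4 * c = t ^ 2 - Δ₁ * Δ₂) :
    QuaternionAlgebra.Basis (CliffordQuat Δ₁ Δ₂ t) (a : ℚ) (Δ₁ : ℚ) (c : ℚ) where
  i := cliffordGen₁ Δ₁ Δ₂ t
  j := cliffordComm Δ₁ Δ₂ t
  k := cliffordGen₁ Δ₁ Δ₂ t * cliffordComm Δ₁ Δ₂ t
  i_mul_i := by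
    have ha' : (4 * a : ℚ) = Δ₁ - Δ₁ ^ 2 := by exact_mod_cast ha
    obtain ⟨h1, -⟩ := ι_relations (1 : CliffordQuat Δ₁ Δ₂ t)
    simp only [cliffordGen₁, Algebra.algebraMap_eq_smul_one, smul_mul_assoc,
      mul_smul_comm, mul_add, add_mul, one_mul, mul_one, h1]
    match_scalars
    · linear_combination -ha' / 4
    · ring
  j_mul_j := by
    have hc' : (4 * c : ℚ) = t ^ 2 - Δ₁ * Δ₂ := by exact_mod_cast hc
    have h := fun z : CliffordQuat Δ₁ Δ₂ t => ι_relations z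
    simp only [cliffordComm_eq, smul_mul_assoc, mul_assoc,
      mul_smul_comm, mul_sub, sub_mul, one_mul, mul_one, (h 1).1, (h 1).2.1,
      fun z => (h z).2.2.2.1, fun z => (h z).2.2.2.2.1, fun z => (h z).2.2.2.2.2]
    match_scalars
    · ring
    · linear_combination -hc' / 4
  i_mul_j := rfl
  j_mul_i := by
    have h := fun z : CliffordQuat Δ₁ Δ₂ t => ι_relations z
    simp only [cliffordComm_eq, cliffordGen₁, Algebra.algebraMap_eq_smul_one, smul_mul_assoc,
      mul_assoc, mul_smul_comm, mul_add, add_mul, mul_sub, sub_mul, one_mul, mul_one, (h 1).1,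
      (h 1).2.1, (h 1).2.2.1,
      fun z => (h z).2.2.2.1, fun z => (h z).2.2.2.2.1, fun z => (h z).2.2.2.2.2]
    module

/-- The Clifford algebra as a quaternion algebra. -/
noncomputable def cliffordEquivQuat (ha : 4 * a = Δ₁ - Δ₁ ^ 2) (hc : 4 * c = t ^ 2 - Δ₁ * Δ₂)
    (h0 : Δ₁ ≠ 0) : CliffordQuat Δ₁ Δ₂ t ≃ₐ[ℚ] RatQuat a Δ₁ c :=
  AlgEquiv.ofAlgHom (cliffordToQuat ha hc h0) (cliffordBasis ha hc).liftHom
    (by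
      ext1
      · change cliffordToQuat ha hc h0 ((cliffordBasis ha hc).lift ⟨0, 1, 0, 0⟩) = ⟨0, 1, 0, 0⟩
        have : (cliffordBasis ha hc).lift (⟨0, 1, 0, 0⟩ : RatQuat a Δ₁ c) =
          cliffordGen₁ Δ₁ Δ₂ t := by simp [QuaternionAlgebra.Basis.lift, cliffordBasis]
        rw [this, cliffordToQuat_gen₁]
      · change cliffordToQuat ha hc h0 ((cliffordBasis ha hc).lift ⟨0, 0, 1, 0⟩) = ⟨0, 0, 1, 0⟩
        have : (cliffordBasis ha hc).lift (⟨0, 0, 1, 0⟩ : RatQuat a Δ₁ c) =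
          cliffordComm Δ₁ Δ₂ t := by simp [QuaternionAlgebra.Basis.lift, cliffordBasis]
        rw [this, cliffordToQuat_comm])
    (by
      apply CliffordAlgebra.hom_ext
      apply LinearMap.ext
      rintro ⟨x, y⟩
      have h0' : (Δ₁ : ℚ) ≠ 0 := Int.cast_ne_zero.2 h0
      have hxy : CliffordAlgebra.ι (binaryForm Δ₁ Δ₂ t) (x, y) =
          x • CliffordAlgebra.ι (binaryForm Δ₁ Δ₂ t) (1, 0) +
            y • CliffordAlgebra.ι (binaryForm Δ₁ Δ₂ t) (0, 1) := by
        rw [← map_smul, ← map_smul, ← map_add]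
        simp
      change (cliffordBasis ha hc).lift (cliffordToQuat ha hc h0 (CliffordAlgebra.ι _ (x, y))) =
        CliffordAlgebra.ι _ (x, y)
      have h := fun z : CliffordQuat Δ₁ Δ₂ t => ι_relations z
      rw [cliffordToQuat_ι, hxy]
      change algebraMap ℚ _ (x * -Δ₁ + y * -t) +
        (x * 2 + y * (2 * t / Δ₁) : ℚ) • cliffordGen₁ Δ₁ Δ₂ t +
        (x * 0 + y * -2 : ℚ) • cliffordComm Δ₁ Δ₂ t +
        (x * 0 + y * (4 / Δ₁) : ℚ) • (cliffordGen₁ Δ₁ Δ₂ t * cliffordComm Δ₁ Δ₂ t) = _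
      simp only [cliffordComm_eq, cliffordGen₁, Algebra.algebraMap_eq_smul_one, smul_mul_assoc,
        mul_assoc, mul_smul_comm, mul_add, add_mul, mul_sub, sub_mul, one_mul, mul_one, (h 1).1,
        (h 1).2.1, (h 1).2.2.1,
        fun z => (h z).2.2.2.1, fun z => (h z).2.2.2.2.1, fun z => (h z).2.2.2.2.2]
      match_scalars <;> field_simp <;> ring)

end CliffordIso

/-! ### The Clifford order at a prime -/

section CliffordOrder

variable {Δ₁ Δ₂ t a c : ℤ}

theorem gen₁_mem : cliffordGen₁ Δ₁ Δ₂ t ∈ cliffordOrder Δ₁ Δ₂ t :=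
  Subring.subset_closure (by simp)

theorem gen₂_mem : cliffordGen₂ Δ₁ Δ₂ t ∈ cliffordOrder Δ₁ Δ₂ t :=
  Subring.subset_closure (by simp)

theorem comm_mem : cliffordComm Δ₁ Δ₂ t ∈ cliffordOrder Δ₁ Δ₂ t :=
  sub_mem (mul_mem gen₁_mem gen₂_mem) (mul_mem gen₂_mem gen₁_mem)

/-- Needed at p = 2: the real coordinate (Δ₂ - t)/2 of γ₂ becomes an integer after multiplication by
Δ₁. -/
theorem two_dvd_mul_sub (ht : t ≡ Δ₁ * Δ₂ [ZMOD 2]) : (2 : ℤ) ∣ Δ₁ * (Δ₂ - t) := by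
  have h := ht.dvd
  have h2 : (2 : ℤ) ∣ (1 - Δ₁) * t * 1 + (Δ₁ * Δ₂ - t) := by
    refine dvd_add ?_ h
    rcases Int.even_or_odd Δ₁ with he | ho
    · have h3 : (2 : ℤ) ∣ Δ₁ * Δ₂ := (even_iff_two_dvd.1 he).mul_right _
      have h4 : (2 : ℤ) ∣ t := (Int.dvd_iff_dvd_of_dvd_sub h).1 h3
      exact (h4.mul_left _).mul_right _
    · have : (2 : ℤ) ∣ 1 - Δ₁ := even_iff_two_dvd.1 (odd_one.sub_odd ho)
      exact (this.mul_right _).mul_right _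
  have h3 : Δ₁ * (Δ₂ - t) = (1 - Δ₁) * t * 1 + (Δ₁ * Δ₂ - t) := by ring
  rwa [h3]

/-- The coordinates of γ₁ and γ₂ become integers after multiplication by Δ₁, a unit at p, and the
p-integral quaternions form a ring. -/
theorem cliffordOrder_integral (ha : 4 * a = Δ₁ - Δ₁ ^ 2) (hc : 4 * c = t ^ 2 - Δ₁ * Δ₂)
    (h0 : Δ₁ ≠ 0) (ht : t ≡ Δ₁ * Δ₂ [ZMOD 2]) {p : ℕ} [hp : Fact p.Prime] (hpΔ : ¬ (p : ℤ) ∣ Δ₁)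
    {x : CliffordQuat Δ₁ Δ₂ t} (hx : x ∈ cliffordOrder Δ₁ Δ₂ t) :
    ratToPadicQuat p a Δ₁ c (cliffordEquivQuat ha hc h0 x) ∈
      integralQuat (a : ℤ_[p]) (Δ₁ : ℤ_[p]) (c : ℤ_[p]) := by
  have h0' : (Δ₁ : ℚ) ≠ 0 := Int.cast_ne_zero.2 h0
  have : cliffordOrder Δ₁ Δ₂ t ≤ (integralQuat (a : ℤ_[p]) (Δ₁ : ℤ_[p]) (c : ℤ_[p])).comap
      ((ratToPadicQuat p a Δ₁ c).comp (cliffordEquivQuat ha hc h0).toRingEquiv.toRingHom) := by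
    refine Subring.closure_le.2 ?_
    have key : ∀ (q : ℚ) (z : ℤ), q * Δ₁ = z → ((q : ℚ) : ℚ_[p]) ∈ padicBall p 0 :=
      fun q z h => ratCast_mem_padicBall_zero hpΔ h
    rintro y (rfl | rfl)
    · change ratToPadicQuat p a Δ₁ c (cliffordToQuat ha hc h0 _) ∈ integralQuat _ _ _
      rw [cliffordToQuat_gen₁]
      exact ⟨key 0 0 (by simp), key 1 Δ₁ (by simp), key 0 0 (by simp), key 0 0 (by simp)⟩
    · change ratToPadicQuat p a Δ₁ c (cliffordToQuat ha hc h0 _) ∈ integralQuat _ _ _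
      rw [cliffordToQuat_gen₂]
      obtain ⟨d, hd⟩ := two_dvd_mul_sub ht
      have hd' : (Δ₁ * (Δ₂ - t) : ℚ) = 2 * d := by exact_mod_cast hd
      refine ⟨key _ d ?_, key _ t ?_, key _ (-Δ₁) ?_, key _ 2 ?_⟩
      · linear_combination hd' / 2
      · field_simp
      · push_cast; ring
      · field_simp; norm_num
  exact this hx

theorem cliffordEquivQuat_symm_i (ha : 4 * a = Δ₁ - Δ₁ ^ 2) (hc : 4 * c = t ^ 2 - Δ₁ * Δ₂)
    (h0 : Δ₁ ≠ 0) : (cliffordEquivQuat ha hc h0).symm ⟨0, 1, 0, 0⟩ = cliffordGen₁ Δ₁ Δ₂ t := by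
  rw [AlgEquiv.symm_apply_eq]
  exact (cliffordToQuat_gen₁ ha hc h0).symm

theorem cliffordEquivQuat_symm_j (ha : 4 * a = Δ₁ - Δ₁ ^ 2) (hc : 4 * c = t ^ 2 - Δ₁ * Δ₂)
    (h0 : Δ₁ ≠ 0) : (cliffordEquivQuat ha hc h0).symm ⟨0, 0, 1, 0⟩ = cliffordComm Δ₁ Δ₂ t := by
  rw [AlgEquiv.symm_apply_eq]
  exact (cliffordToQuat_comm ha hc h0).symm

/-- The Clifford order at a prime that does not divide the first discriminant. -/
theorem exists_isCompletionAt (ha : 4 * a = Δ₁ - Δ₁ ^ 2) (hc : 4 * c = t ^ 2 - Δ₁ * Δ₂)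
    (h0 : Δ₁ ≠ 0) (ht : t ≡ Δ₁ * Δ₂ [ZMOD 2]) {p : ℕ} [hp : Fact p.Prime] (hpΔ : ¬ (p : ℤ) ∣ Δ₁) :
    ∃ Φ : CliffordQuat Δ₁ Δ₂ t →+* PadicQuat p (a : ℤ_[p]) (Δ₁ : ℤ_[p]) (c : ℤ_[p]),
      IsCompletionAt p Φ (cliffordOrder Δ₁ Δ₂ t) (integralQuat (a : ℤ_[p]) Δ₁ c) :=
  ⟨_, isCompletionAt_of_algEquiv (cliffordEquivQuat ha hc h0)
    (by rw [cliffordEquivQuat_symm_i]; exact gen₁_mem)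
    (by rw [cliffordEquivQuat_symm_j]; exact comm_mem)
    (fun _ hx => cliffordOrder_integral ha hc h0 ht hpΔ hx)⟩

/-- Exchanging the two generators. -/
noncomputable def cliffordSwap (Δ₁ Δ₂ t : ℤ) : CliffordQuat Δ₁ Δ₂ t ≃ₐ[ℚ] CliffordQuat Δ₂ Δ₁ t :=
  CliffordAlgebra.equivOfIsometry
    { LinearEquiv.prodComm ℚ ℚ ℚ with
      map_app' := by
        rintro ⟨x, y⟩
        change binaryForm Δ₂ Δ₁ t (y, x) = binaryForm Δ₁ Δ₂ t (x, y)
        rw [binaryForm_apply, binaryForm_apply]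
        ring }

theorem cliffordSwap_gen₁ : cliffordSwap Δ₁ Δ₂ t (cliffordGen₁ Δ₁ Δ₂ t) = cliffordGen₂ Δ₂ Δ₁ t := by
  rw [cliffordGen₁, cliffordGen₂, map_smul, map_add, AlgEquiv.commutes, cliffordSwap,
    CliffordAlgebra.equivOfIsometry_apply, CliffordAlgebra.map_apply_ι]
  rfl

theorem cliffordSwap_gen₂ : cliffordSwap Δ₁ Δ₂ t (cliffordGen₂ Δ₁ Δ₂ t) = cliffordGen₁ Δ₂ Δ₁ t := by
  rw [cliffordGen₁, cliffordGen₂, map_smul, map_add, AlgEquiv.commutes, cliffordSwap,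
    CliffordAlgebra.equivOfIsometry_apply, CliffordAlgebra.map_apply_ι]
  rfl

/-- Exchanging the generators turns the commutator into its negative, which is still in the order,
so the case of Δ₁ applies. -/
theorem exists_isCompletionAt' (ha : 4 * a = Δ₂ - Δ₂ ^ 2) (hc : 4 * c = t ^ 2 - Δ₁ * Δ₂)
    (h0 : Δ₂ ≠ 0) (ht : t ≡ Δ₁ * Δ₂ [ZMOD 2]) {p : ℕ} [hp : Fact p.Prime] (hpΔ : ¬ (p : ℤ) ∣ Δ₂) :
    ∃ Φ : CliffordQuat Δ₁ Δ₂ t →+* PadicQuat p (a : ℤ_[p]) (Δ₂ : ℤ_[p]) (c : ℤ_[p]),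
      IsCompletionAt p Φ (cliffordOrder Δ₁ Δ₂ t) (integralQuat (a : ℤ_[p]) Δ₂ c) := by
  have hc' : 4 * c = t ^ 2 - Δ₂ * Δ₁ := by rw [hc]; ring
  have ht' : t ≡ Δ₂ * Δ₁ [ZMOD 2] := by rwa [mul_comm]
  refine ⟨_, isCompletionAt_of_algEquiv
    ((cliffordSwap Δ₁ Δ₂ t).trans (cliffordEquivQuat ha hc' h0)) ?_ ?_ ?_⟩
  · have : ((cliffordSwap Δ₁ Δ₂ t).trans (cliffordEquivQuat ha hc' h0)).symm ⟨0, 1, 0, 0⟩ =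
        cliffordGen₂ Δ₁ Δ₂ t := by
      rw [AlgEquiv.symm_apply_eq, AlgEquiv.trans_apply, cliffordSwap_gen₂, ← AlgEquiv.symm_apply_eq,
        cliffordEquivQuat_symm_i]
    rw [this]
    exact gen₂_mem
  · have : ((cliffordSwap Δ₁ Δ₂ t).trans (cliffordEquivQuat ha hc' h0)).symm ⟨0, 0, 1, 0⟩ =
        -cliffordComm Δ₁ Δ₂ t := by
      rw [AlgEquiv.symm_apply_eq, AlgEquiv.trans_apply, cliffordComm, neg_sub, map_sub, map_mul,
        map_mul, cliffordSwap_gen₂, cliffordSwap_gen₁, ← AlgEquiv.symm_apply_eq,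
        cliffordEquivQuat_symm_j]
      rfl
    rw [this]
    exact neg_mem comm_mem
  · intro x hx
    rw [AlgEquiv.trans_apply]
    refine cliffordOrder_integral ha hc' h0 ht' hpΔ ?_
    have : cliffordOrder Δ₁ Δ₂ t ≤
        (cliffordOrder Δ₂ Δ₁ t).comap (cliffordSwap Δ₁ Δ₂ t).toRingEquiv.toRingHom := by
      refine Subring.closure_le.2 ?_
      rintro y (rfl | rfl)
      · change cliffordSwap Δ₁ Δ₂ t _ ∈ cliffordOrder _ _ _
        rw [cliffordSwap_gen₁]
        exact gen₂_mem
      · change cliffordSwap Δ₁ Δ₂ t _ ∈ cliffordOrder _ _ _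
        rw [cliffordSwap_gen₂]
        exact gen₁_mem
    exact this hx

end CliffordOrder

/-! ### The reduced discriminant of the Clifford order -/

section ReducedDisc

variable {a b c : ℤ}

theorem reducedTrace_ratQuat (x : RatQuat a b c) : reducedTrace x = 2 * x.re + b * x.imI := by
  rw [reducedTrace, LinearMap.trace_eq_matrix_trace ℚ
    (QuaternionAlgebra.basisOneIJK (a : ℚ) (b : ℚ) (c : ℚ)), Matrix.trace, Fin.sum_univ_four]
  have h0 : QuaternionAlgebra.basisOneIJK (a : ℚ) (b : ℚ) (c : ℚ) 0 = ⟨1, 0, 0, 0⟩ := by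
    simp [QuaternionAlgebra.basisOneIJK]
  have h1 : QuaternionAlgebra.basisOneIJK (a : ℚ) (b : ℚ) (c : ℚ) 1 = ⟨0, 1, 0, 0⟩ := by
    simp [QuaternionAlgebra.basisOneIJK]
  have h2 : QuaternionAlgebra.basisOneIJK (a : ℚ) (b : ℚ) (c : ℚ) 2 = ⟨0, 0, 1, 0⟩ := by
    simp [QuaternionAlgebra.basisOneIJK]
  have h3 : QuaternionAlgebra.basisOneIJK (a : ℚ) (b : ℚ) (c : ℚ) 3 = ⟨0, 0, 0, 1⟩ := by
    simp [QuaternionAlgebra.basisOneIJK]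
  simp only [Matrix.diag_apply, LinearMap.toMatrix_apply, LinearMap.mulLeft_apply,
    QuaternionAlgebra.coe_basisOneIJK_repr, h0, h1, h2, h3]
  simp
  ring

theorem reducedTrace_algEquiv {B C : Type*} [Ring B] [Algebra ℚ B] [Ring C] [Algebra ℚ C]
    (F : B ≃ₐ[ℚ] C) (x : B) : reducedTrace (F x) = reducedTrace x := by
  rw [reducedTrace, reducedTrace, ← LinearMap.trace_conj' _ F.toLinearEquiv]
  congr 2
  ext y
  simp [LinearEquiv.conj_apply]

theorem discForm_algEquiv {B C : Type*} [Ring B] [Algebra ℚ B] [Ring C] [Algebra ℚ C]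
    (F : B ≃ₐ[ℚ] C) (x y z : B) : discForm (F x) (F y) (F z) = discForm x y z := by
  rw [discForm, discForm, ← reducedTrace_algEquiv F, quatConj, quatConj, reducedTrace_algEquiv F z]
  simp only [map_mul, map_sub, AlgEquiv.commutes]

/-- The form is alternating and vanishes on scalars, so it is a multiple of the determinant of the
i, j, k coordinates; the factor is its value at (i, j, k). -/
theorem discForm_ratQuat (x y z : RatQuat a b c) : discForm x y z = c * (b ^ 2 + 4 * a) *
    (x.imI * (y.imJ * z.imK - y.imK * z.imJ) - x.imJ * (y.imI * z.imK - y.imK * z.imI) +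
      x.imK * (y.imI * z.imJ - y.imJ * z.imI)) := by
  rw [discForm, quatConj, reducedTrace_ratQuat, reducedTrace_ratQuat]
  simp [QuaternionAlgebra.algebraMap_eq]
  ring

/-- A ring generated by two elements that satisfy quadratic relations. -/
theorem closure_pair_le_span {B : Type*} [Ring B] {x y : B} {a b a' b' m n k : ℤ}
    (hx : x * x = a • 1 + b • x) (hy : y * y = a' • 1 + b' • y)
    (hyx : y * x = m • 1 + n • x + k • y - x * y) {z : B} (hz : z ∈ Subring.closure {x, y}) :
    z ∈ Submodule.span ℤ ({1, x, y, x * y} : Set B) := by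
  set W := Submodule.span ℤ ({1, x, y, x * y} : Set B) with hW
  have w1 : (1 : B) ∈ W := Submodule.subset_span (by simp)
  have w2 : x ∈ W := Submodule.subset_span (by simp)
  have w3 : y ∈ W := Submodule.subset_span (by simp)
  have w4 : x * y ∈ W := Submodule.subset_span (by simp)
  -- The left stabilizer of W. It is a ring containing x and y, hence the closure, and applying its
  -- elements to 1 lands in W.
  let V : Subring B :=
    { carrier := {z | ∀ w ∈ W, z * w ∈ W}
      mul_mem' := fun {u v} hu hv w hw => by rw [mul_assoc]; exact hu _ (hv _ hw)
      one_mem' := fun w hw => by rwa [one_mul]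
      add_mem' := fun {u v} hu hv w hw => by rw [add_mul]; exact W.add_mem (hu _ hw) (hv _ hw)
      zero_mem' := fun w hw => by rw [zero_mul]; exact W.zero_mem
      neg_mem' := fun {u} hu w hw => by rw [neg_mul]; exact W.neg_mem (hu _ hw) }
  have hV : ∀ u : B, u * 1 ∈ W → u * x ∈ W → u * y ∈ W → u * (x * y) ∈ W → u ∈ V := by
    intro u h1 h2 h3 h4 w hw
    induction hw using Submodule.span_induction with
    | mem w hw =>
      rcases hw with rfl | rfl | rfl | rfl
      · exact h1
      · exact h2
      · exact h3
      · exact h4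
    | zero => rw [mul_zero]; exact W.zero_mem
    | add v w _ _ hv hw => rw [mul_add]; exact W.add_mem hv hw
    | smul r w _ hw => rw [mul_smul_comm]; exact W.smul_mem _ hw
  have hle : Subring.closure {x, y} ≤ V := by
    refine Subring.closure_le.2 ?_
    rintro u (rfl | rfl)
    · refine hV _ (by rwa [mul_one]) ?_ w4 ?_
      · rw [hx]; exact W.add_mem (W.smul_mem _ w1) (W.smul_mem _ w2)
      · rw [← mul_assoc, hx, add_mul, smul_mul_assoc, one_mul, smul_mul_assoc]
        exact W.add_mem (W.smul_mem _ w3) (W.smul_mem _ w4)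
    · refine hV _ (by rwa [mul_one]) ?_ ?_ ?_
      · rw [hyx]
        exact W.sub_mem (W.add_mem (W.add_mem (W.smul_mem _ w1) (W.smul_mem _ w2))
          (W.smul_mem _ w3)) w4
      · rw [hy]; exact W.add_mem (W.smul_mem _ w1) (W.smul_mem _ w3)
      · rw [← mul_assoc, hyx, sub_mul, add_mul, add_mul, smul_mul_assoc, one_mul, smul_mul_assoc,
          smul_mul_assoc, mul_assoc x, hy, mul_add, mul_smul_comm, mul_smul_comm, mul_one]
        exact W.sub_mem (W.add_mem (W.add_mem (W.smul_mem _ w3) (W.smul_mem _ w4))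
          (W.smul_mem _ (W.add_mem (W.smul_mem _ w1) (W.smul_mem _ w3))))
          (W.add_mem (W.smul_mem _ w2) (W.smul_mem _ w4))
  have := hle hz 1 w1
  rwa [mul_one] at this

variable {Δ₁ Δ₂ t a' : ℤ}

theorem gen₁_mul_gen₁ (ha : 4 * a = Δ₁ - Δ₁ ^ 2) : cliffordGen₁ Δ₁ Δ₂ t * cliffordGen₁ Δ₁ Δ₂ t =
    a • 1 + Δ₁ • cliffordGen₁ Δ₁ Δ₂ t := by
  have ha' : (4 * a : ℚ) = Δ₁ - Δ₁ ^ 2 := by exact_mod_cast ha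
  obtain ⟨h1, -⟩ := ι_relations (1 : CliffordQuat Δ₁ Δ₂ t)
  simp only [← Int.cast_smul_eq_zsmul ℚ, cliffordGen₁, Algebra.algebraMap_eq_smul_one,
    smul_mul_assoc, mul_smul_comm, mul_add, add_mul, one_mul, mul_one, h1]
  match_scalars
  · linear_combination -ha' / 4
  · ring

theorem gen₂_mul_gen₂ (ha : 4 * a = Δ₂ - Δ₂ ^ 2) : cliffordGen₂ Δ₁ Δ₂ t * cliffordGen₂ Δ₁ Δ₂ t =
    a • 1 + Δ₂ • cliffordGen₂ Δ₁ Δ₂ t := by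
  apply (cliffordSwap Δ₁ Δ₂ t).injective
  rw [map_mul, map_add, map_zsmul, map_zsmul, map_one, cliffordSwap_gen₂, gen₁_mul_gen₁ ha]

theorem gen₂_mul_gen₁ {m : ℤ} (hm : t - Δ₁ * Δ₂ = 2 * m) :
    cliffordGen₂ Δ₁ Δ₂ t * cliffordGen₁ Δ₁ Δ₂ t = m • 1 + Δ₂ • cliffordGen₁ Δ₁ Δ₂ t +
      Δ₁ • cliffordGen₂ Δ₁ Δ₂ t - cliffordGen₁ Δ₁ Δ₂ t * cliffordGen₂ Δ₁ Δ₂ t := by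
  have hm' : (t - Δ₁ * Δ₂ : ℚ) = 2 * m := by exact_mod_cast hm
  obtain ⟨-, -, h1, -⟩ := ι_relations (1 : CliffordQuat Δ₁ Δ₂ t)
  simp only [← Int.cast_smul_eq_zsmul ℚ, cliffordGen₁, cliffordGen₂, Algebra.algebraMap_eq_smul_one,
    smul_mul_assoc, mul_smul_comm, mul_add, add_mul, one_mul, mul_one, h1]
  match_scalars
  · linear_combination hm' / 2
  all_goals ring

theorem mem_cliffordOrder_span (ha : 4 * a = Δ₁ - Δ₁ ^ 2) (ha' : 4 * a' = Δ₂ - Δ₂ ^ 2)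
    (ht : t ≡ Δ₁ * Δ₂ [ZMOD 2]) {x : CliffordQuat Δ₁ Δ₂ t} (hx : x ∈ cliffordOrder Δ₁ Δ₂ t) :
    x ∈ Submodule.span ℤ ({1, cliffordGen₁ Δ₁ Δ₂ t, cliffordGen₂ Δ₁ Δ₂ t,
      cliffordGen₁ Δ₁ Δ₂ t * cliffordGen₂ Δ₁ Δ₂ t} : Set (CliffordQuat Δ₁ Δ₂ t)) := by
  obtain ⟨m, hm⟩ := ht.symm.dvd
  exact closure_pair_le_span (gen₁_mul_gen₁ ha) (gen₂_mul_gen₂ ha') (gen₂_mul_gen₁ hm) hx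

/-- Only the i, j, k coordinates are recorded, because the discriminant form ignores scalars. -/
theorem cliffordOrder_coords (ha : 4 * a = Δ₁ - Δ₁ ^ 2) (ha' : 4 * a' = Δ₂ - Δ₂ ^ 2)
    (hc : 4 * c = t ^ 2 - Δ₁ * Δ₂) (h0 : Δ₁ ≠ 0)
    (ht : t ≡ Δ₁ * Δ₂ [ZMOD 2]) {x : CliffordQuat Δ₁ Δ₂ t} (hx : x ∈ cliffordOrder Δ₁ Δ₂ t) :
    ∃ n₁ n₂ n₃ : ℤ, (cliffordEquivQuat ha hc h0 x).imI =
        n₁ + n₂ * (t / Δ₁) + n₃ * ((Δ₂ - t) / 2 + t) ∧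
      (cliffordEquivQuat ha hc h0 x).imJ = -n₂ + n₃ * (2 * a / Δ₁) ∧
      (cliffordEquivQuat ha hc h0 x).imK = n₂ * (2 / Δ₁) + n₃ := by
  have h0' : (Δ₁ : ℚ) ≠ 0 := Int.cast_ne_zero.2 h0
  have h := mem_cliffordOrder_span ha ha' ht hx
  have hx1 : cliffordEquivQuat ha hc h0 (cliffordGen₁ Δ₁ Δ₂ t) = ⟨0, 1, 0, 0⟩ :=
    cliffordToQuat_gen₁ ha hc h0
  have hx2 : cliffordEquivQuat ha hc h0 (cliffordGen₂ Δ₁ Δ₂ t) =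
      ⟨(Δ₂ - t) / 2, t / Δ₁, -1, 2 / Δ₁⟩ := cliffordToQuat_gen₂ ha hc h0
  simp only [Submodule.mem_span_insert, Submodule.mem_span_singleton] at h
  obtain ⟨n0, _, ⟨n1, _, ⟨n2, _, ⟨n3, rfl⟩, rfl⟩, rfl⟩, rfl⟩ := h
  refine ⟨n1, n2, n3, ?_, ?_, ?_⟩ <;>
  · simp only [map_add, map_zsmul, map_mul, map_one, hx1, hx2]
    simp
    field_simp
    first | done | ring1 | simp

/-- Here b² + 4a = Δ₁, so the form takes the value cΔ₁ at (i, j, k). The coordinates of γ₁, γ₂, γ₁γ₂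
have determinant -1/Δ₁, so the values on the order are the integer multiples of c. -/
theorem reducedDisc_cliffordOrder (ha : 4 * a = Δ₁ - Δ₁ ^ 2) (ha' : 4 * a' = Δ₂ - Δ₂ ^ 2)
    (hc : 4 * c = t ^ 2 - Δ₁ * Δ₂) (h0 : Δ₁ ≠ 0) (ht : t ≡ Δ₁ * Δ₂ [ZMOD 2]) :
    reducedDisc (cliffordOrder Δ₁ Δ₂ t) = c.natAbs := by
  have h0' : (Δ₁ : ℚ) ≠ 0 := Int.cast_ne_zero.2 h0
  have ha'' : (a : ℚ) = (Δ₁ - Δ₁ ^ 2) / 4 := by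
    rw [eq_div_iff (by norm_num), mul_comm]; exact_mod_cast ha
  have hspan : Submodule.span ℤ {r : ℚ | ∃ x ∈ cliffordOrder Δ₁ Δ₂ t, ∃ y ∈ cliffordOrder Δ₁ Δ₂ t,
      ∃ z ∈ cliffordOrder Δ₁ Δ₂ t, r = discForm x y z} = Submodule.span ℤ {(c : ℚ)} := by
    apply le_antisymm
    · rw [Submodule.span_le]
      rintro _ ⟨x, hx, y, hy, z, hz, rfl⟩
      obtain ⟨x1, x2, x3, hx1, hx2, hx3⟩ := cliffordOrder_coords ha ha' hc h0 ht hx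
      obtain ⟨y1, y2, y3, hy1, hy2, hy3⟩ := cliffordOrder_coords ha ha' hc h0 ht hy
      obtain ⟨z1, z2, z3, hz1, hz2, hz3⟩ := cliffordOrder_coords ha ha' hc h0 ht hz
      refine Submodule.mem_span_singleton.2 ⟨-(x1 * (y2 * z3 - y3 * z2) - x2 * (y1 * z3 - y3 * z1) +
        x3 * (y1 * z2 - y2 * z1)), ?_⟩
      rw [← discForm_algEquiv (cliffordEquivQuat ha hc h0), discForm_ratQuat, hx1, hx2, hx3, hy1,
        hy2, hy3, hz1, hz2, hz3, ha'', zsmul_eq_mul]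
      push_cast
      field_simp
      ring
    · rw [Submodule.span_singleton_le_iff_mem]
      have hx1 : cliffordEquivQuat ha hc h0 (cliffordGen₁ Δ₁ Δ₂ t) = ⟨0, 1, 0, 0⟩ :=
        cliffordToQuat_gen₁ ha hc h0
      have hx2 : cliffordEquivQuat ha hc h0 (cliffordGen₂ Δ₁ Δ₂ t) =
          ⟨(Δ₂ - t) / 2, t / Δ₁, -1, 2 / Δ₁⟩ := cliffordToQuat_gen₂ ha hc h0
      -- With γ₂ before γ₁ the determinant is +1/Δ₁ and the value is exactly c.
      refine Submodule.subset_span ⟨_, gen₂_mem, _, gen₁_mem, _, mul_mem gen₁_mem gen₂_mem, ?_⟩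
      rw [← discForm_algEquiv (cliffordEquivQuat ha hc h0), discForm_ratQuat, map_mul, hx1, hx2]
      simp
      rw [ha'']
      field_simp
      ring
  have hcomap : Submodule.comap (Algebra.linearMap ℤ ℚ) (Submodule.span ℤ {(c : ℚ)}) =
      Ideal.span {c} := by
    ext n
    rw [Submodule.mem_comap, Submodule.mem_span_singleton, Ideal.mem_span_singleton']
    simp only [zsmul_eq_mul, Algebra.linearMap_apply, algebraMap_int_eq, eq_intCast]
    exact exists_congr fun k => by exact_mod_cast Iff.rfl
  rw [reducedDisc, hspan, hcomap, Ideal.absNorm_span_singleton, Algebra.norm_self]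
  rfl

end ReducedDisc

/-! ### Maximal orders and the index condition -/

section Global

variable {B : Type*} [Ring B] [Algebra ℚ B] {S : Subring B}

theorem exists_nsmul_mem_of_isZOrder (hS : IsZOrder S) (x : B) : ∃ d : ℕ, d ≠ 0 ∧ d • x ∈ S := by
  have hx : x ∈ Submodule.span ℚ (S : Set B) := hS.2 ▸ Submodule.mem_top
  induction hx using Submodule.span_induction with
  | mem y hy => exact ⟨1, one_ne_zero, by rwa [one_smul]⟩
  | zero => exact ⟨1, one_ne_zero, by rw [smul_zero]; exact S.zero_mem⟩
  | add y z _ _ hy hz =>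
    obtain ⟨d, hd, hdy⟩ := hy
    obtain ⟨e, he, hez⟩ := hz
    refine ⟨d * e, mul_ne_zero hd he, ?_⟩
    rw [smul_add]
    refine S.add_mem ?_ ?_
    · rw [mul_comm, mul_smul]; exact S.nsmul_mem hdy _
    · rw [mul_smul]; exact S.nsmul_mem hez _
  | smul q y _ hy =>
    obtain ⟨d, hd, hdy⟩ := hy
    refine ⟨q.den * d, mul_ne_zero q.den_nz hd, ?_⟩
    have : (q.den * d) • (q • y) = q.num • (d • y) := by
      rw [← Nat.cast_smul_eq_nsmul ℚ (q.den * d), ← Nat.cast_smul_eq_nsmul ℚ d,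
        ← Int.cast_smul_eq_zsmul ℚ, smul_smul, smul_smul]
      congr 1
      push_cast
      rw [← Rat.den_mul_eq_num]
      ring
    rw [this]
    exact S.zsmul_mem hdy _

/-- For an order R the quotient R/S is finitely generated and torsion, hence finite. Conversely,
multiplication by a nonzero index n embeds R into S. -/
theorem isZOrder_iff_relIndex_ne_zero (hS : IsZOrder S) {R : Subring B} (hSR : S ≤ R) :
    IsZOrder R ↔ S.toAddSubgroup.relIndex R.toAddSubgroup ≠ 0 := by
  constructor
  · intro hR
    let A : Submodule ℤ R := (S.toAddSubgroup.addSubgroupOf R.toAddSubgroup).toIntSubmodule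
    have hfin : Module.Finite ℤ R := hR.1
    have : Finite (R ⧸ A) := by
      refine Module.finite_of_fg_torsion (R ⧸ A) ?_
      intro x
      obtain ⟨y, rfl⟩ := Submodule.Quotient.mk_surjective A x
      obtain ⟨d, hd, hdy⟩ := exists_nsmul_mem_of_isZOrder hS (y : B)
      refine ⟨⟨(d : ℤ), mem_nonZeroDivisors_of_ne_zero (Int.natCast_ne_zero.2 hd)⟩, ?_⟩
      change (d : ℤ) • (Submodule.Quotient.mk y : R ⧸ A) = 0
      rw [← Submodule.Quotient.mk_smul, Submodule.Quotient.mk_eq_zero, natCast_zsmul]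
      exact hdy
    have h2 : S.toAddSubgroup.relIndex R.toAddSubgroup = Nat.card (R ⧸ A) := rfl
    rw [h2]
    exact Nat.card_pos.ne'
  · intro h
    refine ⟨?_, top_le_iff.1 (hS.2 ▸ Submodule.span_mono hSR)⟩
    have hfin : Module.Finite ℤ S := hS.1
    let n := S.toAddSubgroup.relIndex R.toAddSubgroup
    have hn : ∀ x ∈ R, n • x ∈ S := fun x hx => nsmul_mem_of_mem_overrings ⟨hSR, rfl⟩ hx
    let f : R →+ S :=
      { toFun := fun x => ⟨n • (x : B), hn x x.2⟩
        map_zero' := Subtype.ext (by simp)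
        map_add' := fun x y => Subtype.ext (by simp) }
    refine Module.Finite.of_injective f.toIntLinearMap ?_
    intro x y hxy
    have h1 : n • (x : B) = n • (y : B) := congrArg Subtype.val hxy
    rw [← Nat.cast_smul_eq_nsmul ℚ, ← Nat.cast_smul_eq_nsmul ℚ] at h1
    exact Subtype.ext (smul_right_injective B (Nat.cast_ne_zero.2 h) h1)

omit [Algebra ℚ B] in
theorem exists_primary_sup {m p : ℕ} (hp : p.Prime) (hm : m ≠ 0) {R : Subring B}
    (hR : R ∈ overrings S m) : (p ^ m.factorization p).Coprime (m / p ^ m.factorization p) ∧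
      ∃ T ∈ overrings S (p ^ m.factorization p), ∃ U ∈ overrings S (m / p ^ m.factorization p),
        R = T ⊔ U := by
  have h1 : (p ^ m.factorization p).Coprime (m / p ^ m.factorization p) :=
    (Nat.coprime_ordCompl hp hm).pow_left _
  refine ⟨h1, exists_sup_of_mem_overrings (pow_ne_zero _ hp.ne_zero) ?_ h1 ?_⟩
  · exact (Nat.ordCompl_pos p hm).ne'
  · rwa [Nat.ordProj_mul_ordCompl_eq_self]

variable {P : Finset ℕ} {μ : ℕ → ℕ}

theorem factorization_prod_primes (hP : ∀ p ∈ P, p.Prime) {p : ℕ} (hp : p ∈ P) :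
    (∏ q ∈ P, q ^ μ q).factorization p = μ p := by
  rw [Nat.factorization_prod fun q hq => pow_ne_zero _ (hP q hq).ne_zero, Finsupp.finsetSum_apply,
    Finset.sum_eq_single_of_mem p hp]
  · rw [(hP p hp).factorization_pow, Finsupp.single_eq_same]
  · intro q hq hqp
    rw [(hP q hq).factorization_pow, Finsupp.single_eq_of_ne hqp.symm]

section

variable (hP : ∀ p ∈ P, p.Prime) (hμ : ∀ p, p.Prime → HasMaximalExponent S p (μ p))
  (hμ0 : ∀ p, p.Prime → p ∉ P → μ p = 0)
include hP hμ hμ0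

omit [Algebra ℚ B] in
theorem index_dvd_maximal {m : ℕ} (hm : m ≠ 0) {R : Subring B} (hR : R ∈ overrings S m) :
    m ∣ ∏ q ∈ P, q ^ μ q := by
  rw [← Nat.factorization_prime_le_iff_dvd hm
    (Finset.prod_ne_zero_iff.2 fun q hq => pow_ne_zero _ (hP q hq).ne_zero)]
  intro p hp
  obtain ⟨-, T, hT, -⟩ := exists_primary_sup hp hm hR
  have h1 := (hμ p hp).le _ T hT
  by_cases hpP : p ∈ P
  · rwa [factorization_prod_primes hP hpP]
  · rw [hμ0 p hp hpP] at h1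
    omega

/-- If the p-primary part T of R stayed below the maximal exponent, it could be enlarged to T';
joining T' with the part of R prime to p would give an order strictly larger than R. -/
theorem index_of_isMaximalZOrder (hS : IsZOrder S) {R : Subring B} (hSR : S ≤ R)
    (hR : IsMaximalZOrder R) : R ∈ overrings S (∏ q ∈ P, q ^ μ q) := by
  refine ⟨hSR, ?_⟩
  have hm := (isZOrder_iff_relIndex_ne_zero hS hSR).1 hR.1
  have hRm : R ∈ overrings S (S.toAddSubgroup.relIndex R.toAddSubgroup) := ⟨hSR, rfl⟩
  generalize S.toAddSubgroup.relIndex R.toAddSubgroup = m at hm hRm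
  have hM0 : ∏ q ∈ P, q ^ μ q ≠ 0 :=
    Finset.prod_ne_zero_iff.2 fun q hq => pow_ne_zero _ (hP q hq).ne_zero
  refine Nat.dvd_antisymm (index_dvd_maximal hP hμ hμ0 hm hRm) ?_
  rw [← Nat.factorization_prime_le_iff_dvd hM0 hm]
  intro p hp
  by_cases hpP : p ∈ P
  · rw [factorization_prod_primes hP hpP]
    by_contra hlt
    obtain ⟨hcop, T, hT, U, hU, hTU⟩ := exists_primary_sup hp hm hRm
    obtain ⟨l, hl, T', hT', hTT'⟩ := (hμ p hp).exists_lt _ (not_le.1 hlt) T hT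
    have hpp : (p ^ l).Coprime (m / p ^ m.factorization p) :=
      (Nat.coprime_ordCompl hp hm).pow_left _
    have hR' := sup_mem_overrings hpp hT' hU
    have hle : R ≤ T' ⊔ U := hTU ▸ sup_le_sup_right hTT' U
    have hc0 : m / p ^ m.factorization p ≠ 0 := (Nat.ordCompl_pos p hm).ne'
    have hord : IsZOrder (T' ⊔ U) := by
      rw [isZOrder_iff_relIndex_ne_zero hS hR'.1, hR'.2]
      exact mul_ne_zero (pow_ne_zero _ hp.ne_zero) hc0
    rw [hR.2 _ hord hle] at hR'
    have h1 : p ^ l * (m / p ^ m.factorization p) = m := hR'.2.symm.trans hRm.2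
    have h2 := Nat.ordProj_mul_ordCompl_eq_self m p
    have h3 := Nat.eq_of_mul_eq_mul_right (Nat.pos_of_ne_zero hc0) (h1.trans h2.symm)
    exact hl.ne' (Nat.pow_right_injective hp.two_le h3)
  · rw [Nat.factorization_eq_zero_of_not_dvd]
    · exact Nat.zero_le _
    · intro hd
      obtain ⟨q, hq, hpq⟩ := (hp.prime.dvd_finsetProd_iff _).1 hd
      have := hp.prime.dvd_of_dvd_pow hpq
      rw [Nat.prime_dvd_prime_iff_eq hp (hP q hq)] at this
      exact hpP (this ▸ hq)

/-- The indices over S of orders containing R are bounded, and an order of largest index is maximal.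
-/
theorem exists_isMaximalZOrder_ge (hS : IsZOrder S) {R : Subring B} (hSR : S ≤ R)
    (hR : IsZOrder R) : ∃ R', IsMaximalZOrder R' ∧ R ≤ R' := by
  classical
  have hM0 : ∏ q ∈ P, q ^ μ q ≠ 0 :=
    Finset.prod_ne_zero_iff.2 fun q hq => pow_ne_zero _ (hP q hq).ne_zero
  let Q : ℕ → Prop := fun m => ∃ R' : Subring B, R ≤ R' ∧ IsZOrder R' ∧
    S.toAddSubgroup.relIndex R'.toAddSubgroup = m
  have hQb : ∀ m, Q m → m ≤ ∏ q ∈ P, q ^ μ q := by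
    rintro m ⟨R', hRR', hR', rfl⟩
    refine Nat.le_of_dvd (Nat.pos_of_ne_zero hM0) (index_dvd_maximal hP hμ hμ0
      ((isZOrder_iff_relIndex_ne_zero hS (hSR.trans hRR')).1 hR') ⟨hSR.trans hRR', rfl⟩)
  have hQ0 : Q (S.toAddSubgroup.relIndex R.toAddSubgroup) := ⟨R, le_rfl, hR, rfl⟩
  obtain ⟨R', hRR', hR', hidx⟩ := Nat.findGreatest_spec (hQb _ hQ0) hQ0
  refine ⟨R', ⟨hR', fun R'' hR'' hle => ?_⟩, hRR'⟩
  have hQ'' : Q (S.toAddSubgroup.relIndex R''.toAddSubgroup) := ⟨R'', hRR'.trans hle, hR'', rfl⟩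
  have h1 := Nat.le_findGreatest (hQb _ hQ'') hQ''
  have h2 := AddSubgroup.relIndex_mul_relIndex S.toAddSubgroup R'.toAddSubgroup R''.toAddSubgroup
    (hSR.trans hRR') hle
  have h3 := (isZOrder_iff_relIndex_ne_zero hS (hSR.trans (hRR'.trans hle))).1 hR''
  rw [← hidx] at h1
  have h4 : R'.toAddSubgroup.relIndex R''.toAddSubgroup = 1 := by
    rw [← h2] at h1 h3
    have h5 := Nat.pos_of_ne_zero (right_ne_zero_of_mul h3)
    have h6 := Nat.pos_of_ne_zero (left_ne_zero_of_mul h3)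
    have := Nat.le_of_mul_le_mul_left (h1.trans_eq (mul_one _).symm) h6
    omega
  exact le_antisymm (AddSubgroup.relIndex_eq_one.1 h4) hle

/-- An overorder has index `d` in all maximal orders that contain it if and only if its index over
`S` is `1 / d` times the maximal one. -/
theorem index_in_maximal_iff (hS : IsZOrder S) {d m : ℕ} (hd : d * m = ∏ q ∈ P, q ^ μ q)
    {R : Subring B} (hSR : S ≤ R) :
    (IsZOrder R ∧ ∀ R' : Subring B, IsMaximalZOrder R' → R ≤ R' →
      R.toAddSubgroup.relIndex R'.toAddSubgroup = d) ↔ R ∈ overrings S m := by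
  have hM0 : ∏ q ∈ P, q ^ μ q ≠ 0 :=
    Finset.prod_ne_zero_iff.2 fun q hq => pow_ne_zero _ (hP q hq).ne_zero
  rw [← hd] at hM0
  have key : ∀ R' : Subring B, IsMaximalZOrder R' → R ≤ R' →
      S.toAddSubgroup.relIndex R.toAddSubgroup * R.toAddSubgroup.relIndex R'.toAddSubgroup =
        d * m := by
    intro R' hR' hle
    rw [AddSubgroup.relIndex_mul_relIndex S.toAddSubgroup R.toAddSubgroup R'.toAddSubgroup hSR hle,
      hd]
    exact (index_of_isMaximalZOrder hP hμ hμ0 hS (hSR.trans hle) hR').2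
  constructor
  · rintro ⟨hR, h⟩
    -- The index condition quantifies over all maximal orders above R; it has content because one
    -- exists.
    obtain ⟨R', hR', hle⟩ := exists_isMaximalZOrder_ge hP hμ hμ0 hS hSR hR
    have h1 := key R' hR' hle
    rw [h R' hR' hle, mul_comm] at h1
    exact ⟨hSR, Nat.eq_of_mul_eq_mul_left (Nat.pos_of_ne_zero (left_ne_zero_of_mul hM0)) h1⟩
  · rintro ⟨-, h⟩
    refine ⟨?_, fun R' hR' hle => ?_⟩
    · rw [isZOrder_iff_relIndex_ne_zero hS hSR, h]
      exact right_ne_zero_of_mul hM0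
    · have h1 := key R' hR' hle
      rw [h, mul_comm d] at h1
      exact Nat.eq_of_mul_eq_mul_left (Nat.pos_of_ne_zero (right_ne_zero_of_mul hM0)) h1

end

end Global

/-! ### The polynomial X² - ΔX - a modulo p -/

theorem ZMod.sq_ne_add_one_two : ∀ x : ZMod 2, x ^ 2 ≠ 1 * x + 1 := by decide

section ModP

variable {p : ℕ} [hp : Fact p.Prime] {a Δ : ℤ}

/-- The polynomial `X² - Δ X - a` has a root modulo `p`. -/
def HasRootMod (p : ℕ) (a Δ : ℤ) : Prop := ∃ x : ZMod p, x ^ 2 = Δ * x + a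

/-- The discriminant Δ² + 4a of X² - ΔX - a equals Δ. For odd p one completes the square. For p = 2
the congruence Δ ≡ 1 mod 4 is forced, and Δ mod 8 decides between X² - X and the irreducible X² - X
- 1. -/
theorem kroneckerAtPrime_eq_one_or (hpΔ : ¬ (p : ℤ) ∣ Δ) (ha : 4 * a = Δ - Δ ^ 2) :
    (kroneckerAtPrime Δ p = 1 ∧ HasRootMod p a Δ) ∨
      (kroneckerAtPrime Δ p = -1 ∧ ¬ HasRootMod p a Δ) := by
  by_cases h2 : p = 2
  · subst h2
    have hodd : ¬ (2 : ℤ) ∣ Δ := hpΔ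
    have key : Δ % 8 = 1 ∧ a % 2 = 0 ∨ Δ % 8 = 5 ∧ a % 2 = 1 := by
      have h4 : Δ % 8 = 1 ∨ Δ % 8 = 5 ∨ Δ % 8 = 3 ∨ Δ % 8 = 7 := by omega
      obtain ⟨k, hk⟩ : ∃ k, Δ = 8 * k + Δ % 8 := ⟨Δ / 8, (Int.mul_ediv_add_emod Δ 8).symm⟩
      rcases h4 with h | h | h | h <;> rw [h] at hk <;> subst hk
      · left
        refine ⟨h, ?_⟩
        have : a = 2 * (-8 * k ^ 2 - k) := by linarith
        omega
      · right
        refine ⟨h, ?_⟩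
        have : a = 2 * (-8 * k ^ 2 - 9 * k - 3) + 1 := by linarith
        omega
      · exfalso
        have h3 : 4 * a = 4 * (-16 * k ^ 2 - 10 * k) - 6 := by linarith
        generalize -16 * k ^ 2 - 10 * k = l at h3
        omega
      · exfalso
        have h3 : 4 * a = 4 * (-16 * k ^ 2 - 26 * k) - 42 := by linarith
        generalize -16 * k ^ 2 - 26 * k = l at h3
        omega
    have hχ : kroneckerAtPrime Δ 2 = ZMod.χ₈ (Δ : ZMod 8) := if_pos rfl
    have h8 : (Δ : ZMod 8) = ((Δ % 8 : ℤ) : ZMod 8) := by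
      rw [← ZMod.intCast_mod Δ 8]; rfl
    have hΔ2 : (Δ : ZMod 2) = 1 := by
      have : (Δ : ZMod 2) = ((1 : ℤ) : ZMod 2) := by
        rw [ZMod.intCast_eq_intCast_iff]
        change Δ % 2 = 1 % 2
        omega
      simpa using this
    rcases key with ⟨hk, hk'⟩ | ⟨hk, hk'⟩
    · left
      refine ⟨by rw [hχ, h8, hk]; decide, 0, ?_⟩
      have : (a : ZMod 2) = 0 := (ZMod.intCast_zmod_eq_zero_iff_dvd a 2).2 (Int.dvd_of_emod_eq_zero hk')
      rw [this]
      simp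
    · right
      refine ⟨by rw [hχ, h8, hk]; decide, ?_⟩
      have ha2 : (a : ZMod 2) = 1 := by
        have : (a : ZMod 2) = ((1 : ℤ) : ZMod 2) := by
          rw [ZMod.intCast_eq_intCast_iff]
          exact hk'
        simpa using this
      rintro ⟨x, hx⟩
      rw [hΔ2, ha2] at hx
      exact ZMod.sq_ne_add_one_two x hx
  · have hJ : kroneckerAtPrime Δ p = jacobiSym Δ p := if_neg h2
    have h2' : (2 : ZMod p) ≠ 0 := by
      intro h
      have : ((2 : ℕ) : ZMod p) = 0 := by exact_mod_cast h
      rw [ZMod.natCast_eq_zero_iff] at this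
      exact h2 ((Nat.prime_dvd_prime_iff_eq hp.1 Nat.prime_two).1 this)
    have ha' : (4 * a : ZMod p) = Δ - Δ ^ 2 := by exact_mod_cast congrArg (Int.cast : ℤ → ZMod p) ha
    have hsq : HasRootMod p a Δ ↔ IsSquare (Δ : ZMod p) := by
      constructor
      · rintro ⟨x, hx⟩
        exact ⟨2 * x - Δ, by linear_combination (-4) * hx - ha'⟩
      · rintro ⟨y, hy⟩
        refine ⟨(y + Δ) / 2, ?_⟩
        field_simp
        linear_combination (-1) * hy - ha'
    have hgcd : Δ.gcd p = 1 := by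
      rw [Int.gcd_comm]
      exact (Int.isCoprime_iff_gcd_eq_one).1
        ((Nat.prime_iff_prime_int.1 hp.1).coprime_iff_not_dvd.2 hpΔ)
    rw [hJ, hsq]
    rcases jacobiSym.eq_one_or_neg_one hgcd with h | h
    · exact Or.inl ⟨h, ZMod.isSquare_of_jacobiSym_eq_one h⟩
    · exact Or.inr ⟨h, ZMod.nonsquare_of_jacobiSym_eq_neg_one h⟩

/-- p is zero in K, so φ factors through ℤ_p/p. -/
theorem padicInt_ringHom_apply {K : Type*} [CommRing K] [Algebra (ZMod p) K] (φ : ℤ_[p] →+* K)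
    (z : ℤ_[p]) : φ z = algebraMap (ZMod p) K (PadicInt.toZMod z) := by
  have hK : (p : K) = 0 := by
    rw [← map_natCast (algebraMap (ZMod p) K), CharP.cast_eq_zero, map_zero]
  obtain ⟨v, hv⟩ := Ideal.mem_span_singleton.1 (PadicInt.appr_spec 1 z)
  have hz : z = (z.appr 1 : ℤ_[p]) + p * v := by
    rw [pow_one] at hv; linear_combination hv
  rw [hz]
  simp only [map_add, map_mul, map_natCast, CharP.cast_eq_zero, hK, zero_mul, map_zero]

theorem toZMod_eq_zero_iff (z : ℤ_[p]) : PadicInt.toZMod z = 0 ↔ (p : ℤ_[p]) ∣ z := by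
  rw [← RingHom.mem_ker, PadicInt.ker_toZMod, PadicInt.maximalIdeal_eq_span_p,
    Ideal.mem_span_singleton]

theorem isUnit_of_toZMod_ne_zero {z : ℤ_[p]} (h : PadicInt.toZMod z ≠ 0) : IsUnit z := by
  by_contra hz
  refine h ?_
  rw [← RingHom.mem_ker, PadicInt.ker_toZMod]
  exact hz

/-- If y were nonzero modulo p, then -x/y would be a root. -/
theorem anisotropic_of_not_hasRootMod (h : ¬ HasRootMod p a Δ) (x y : ℤ_[p])
    (hxy : (p : ℤ_[p]) ∣ x ^ 2 + Δ * x * y - a * y ^ 2) : (p : ℤ_[p]) ∣ x ∧ (p : ℤ_[p]) ∣ y := by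
  rw [← toZMod_eq_zero_iff] at hxy ⊢
  rw [← toZMod_eq_zero_iff]
  simp only [map_sub, map_add, map_mul, map_pow, map_intCast] at hxy
  generalize PadicInt.toZMod x = u at *
  generalize PadicInt.toZMod y = v at *
  have hv : v = 0 := by
    by_contra hv
    refine h ⟨-u / v, ?_⟩
    field_simp
    linear_combination hxy
  subst hv
  refine ⟨?_, rfl⟩
  simpa using hxy

/-- Hensel's lemma applies even at p = 2, because the derivative at a root satisfies (2x - Δ)² = Δ²
+ 4a = Δ, which is nonzero modulo p. The same quantity is the difference of the two roots. -/
theorem exists_splitRoots (h : HasRootMod p a Δ) (hpΔ : ¬ (p : ℤ) ∣ Δ) (ha : 4 * a = Δ - Δ ^ 2) :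
    ∃ r s : ℤ_[p], SplitRoots (a : ℤ_[p]) (Δ : ℤ_[p]) r s := by
  obtain ⟨x, hx⟩ := h
  have ha' : (4 * a : ZMod p) = Δ - Δ ^ 2 := by exact_mod_cast congrArg (Int.cast : ℤ → ZMod p) ha
  have hΔ : (Δ : ZMod p) ≠ 0 := fun h0 => hpΔ ((ZMod.intCast_zmod_eq_zero_iff_dvd Δ p).1 h0)
  have hunit : ∀ z : ℤ_[p], PadicInt.toZMod z = x → IsUnit (2 * z - Δ) := by
    intro z hz
    apply isUnit_of_toZMod_ne_zero
    simp only [map_sub, map_mul, map_ofNat, map_intCast, hz]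
    intro h0
    refine hΔ ?_
    linear_combination (2 * x - Δ) * h0 - 4 * hx - ha'
  obtain ⟨z₀, hz₀⟩ : ∃ z : ℤ_[p], PadicInt.toZMod z = x := ZMod.ringHom_surjective _ x
  let f : Polynomial ℤ_[p] := Polynomial.X ^ 2 - (Polynomial.C (Δ : ℤ_[p]) * Polynomial.X +
    Polynomial.C (a : ℤ_[p]))
  have heval : ∀ z, f.eval z = z ^ 2 - (Δ * z + a) := fun z => by
    simp only [f, Polynomial.eval_sub, Polynomial.eval_pow, Polynomial.eval_X, Polynomial.eval_mul,
      Polynomial.eval_C, Polynomial.eval_add]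
  have hder : f.derivative.eval z₀ = 2 * z₀ - Δ := by
    simp only [f, Polynomial.derivative_sub, Polynomial.derivative_X_pow, Polynomial.derivative_add,
      Polynomial.derivative_C_mul, Polynomial.derivative_X, Polynomial.derivative_C,
      Polynomial.eval_sub, Polynomial.eval_pow, Polynomial.eval_X, Polynomial.eval_mul,
      Polynomial.eval_C, Polynomial.eval_add, Polynomial.eval_one, Polynomial.eval_zero]
    push_cast
    ring
  have hf : f.Monic := by
    refine Polynomial.monic_X_pow_sub ?_
    exact Polynomial.degree_linear_lt
  have hH : HenselianRing ℤ_[p] (IsLocalRing.maximalIdeal ℤ_[p]) := inferInstance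
  obtain ⟨r, hr, hr'⟩ := hH.is_henselian f hf z₀
    (by
      rw [← PadicInt.ker_toZMod, RingHom.mem_ker, heval]
      simp only [map_add, map_sub, map_mul, map_pow, map_intCast, hz₀]
      linear_combination hx)
    (by
      rw [hder]
      exact (hunit z₀ hz₀).map (Ideal.Quotient.mk (IsLocalRing.maximalIdeal ℤ_[p])))
  have hr0 : r ^ 2 - (Δ * r + a) = 0 := by rw [← heval]; exact hr
  refine ⟨r, Δ - r, by ring, by linear_combination -hr0, ?_⟩
  have : PadicInt.toZMod r = x := by
    rw [← PadicInt.ker_toZMod, RingHom.mem_ker, map_sub, hz₀, sub_eq_zero] at hr'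
    exact hr'
  have h2 := hunit r this
  rwa [show r - (Δ - r) = 2 * r - Δ by ring]

theorem isUnit_disc (hpΔ : ¬ (p : ℤ) ∣ Δ) (ha : 4 * a = Δ - Δ ^ 2) :
    IsUnit ((Δ : ℤ_[p]) ^ 2 + 4 * (a : ℤ_[p])) := by
  have ha' : (4 * a : ℤ_[p]) = Δ - Δ ^ 2 := by exact_mod_cast congrArg (Int.cast : ℤ → ℤ_[p]) ha
  rw [ha', add_sub_cancel]
  apply isUnit_of_toZMod_ne_zero
  rw [map_intCast]
  exact fun h0 => hpΔ ((ZMod.intCast_zmod_eq_zero_iff_dvd Δ p).1 h0)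

end ModP

/-! ### Generating W(𝔽_{p²}) by a quadratic root -/

section Witt

variable {p : ℕ} [hp : Fact p.Prime] {a Δ : ℤ}

/-- A quadratic without roots is irreducible, and the degree 2 extension that it defines embeds in
𝔽_{p²}. -/
theorem exists_root_galoisField (h : ¬ HasRootMod p a Δ) :
    ∃ x : GaloisField p 2, x ^ 2 = Δ * x + a := by
  let f : Polynomial (ZMod p) := Polynomial.X ^ 2 - (Polynomial.C (Δ : ZMod p) * Polynomial.X +
    Polynomial.C (a : ZMod p))
  have hdeg : f.natDegree = 2 := Polynomial.natDegree_eq_of_degree_eq_some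
    ((Polynomial.degree_sub_eq_left_of_degree_lt (by
      rw [Polynomial.degree_X_pow]; exact Polynomial.degree_linear_lt)).trans
      (Polynomial.degree_X_pow 2))
  have hf : Irreducible f := by
    refine Polynomial.irreducible_of_degree_le_three_of_not_isRoot (by simp [hdeg]) fun x hx => ?_
    refine h ⟨x, ?_⟩
    have : x ^ 2 - (Δ * x + a) = 0 := by simpa [f, Polynomial.IsRoot] using hx
    exact sub_eq_zero.1 this
  have : Fact (Irreducible f) := ⟨hf⟩
  have hfr : Module.finrank (ZMod p) (AdjoinRoot f) = 2 := by
    rw [← hdeg]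
    exact finrank_quotient_span_eq_natDegree
  have hdvd : Module.finrank (ZMod p) (AdjoinRoot f) ∣
      Module.finrank (ZMod p) (GaloisField p 2) := by
    rw [hfr, GaloisField.finrank p two_ne_zero]
  obtain ⟨φ⟩ := FiniteField.nonempty_algHom_of_finrank_dvd hdvd
  refine ⟨φ (AdjoinRoot.root f), ?_⟩
  have h0 : (AdjoinRoot.root f) ^ 2 - (Δ * AdjoinRoot.root f + a) = 0 := by
    have := AdjoinRoot.eval₂_root f
    simp only [f, Polynomial.eval₂_sub, Polynomial.eval₂_add, Polynomial.eval₂_mul,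
      Polynomial.eval₂_pow, Polynomial.eval₂_X, Polynomial.eval₂_C] at this
    rwa [map_intCast (AdjoinRoot.of f), map_intCast (AdjoinRoot.of f)] at this
  have := congrArg φ h0
  simp only [map_sub, map_add, map_mul, map_pow, map_intCast, map_zero] at this
  exact sub_eq_zero.1 this

theorem algebraMap_add_mul_eq_zero (h : ¬ HasRootMod p a Δ) {K : Type*} [Field K]
    [Algebra (ZMod p) K] {x : K} (hx : x ^ 2 = Δ * x + a) {u v : ZMod p}
    (huv : algebraMap (ZMod p) K u + algebraMap (ZMod p) K v * x = 0) : u = 0 ∧ v = 0 := by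
  have hv : v = 0 := by
    by_contra hv
    refine h ⟨-u / v, (algebraMap (ZMod p) K).injective ?_⟩
    have hv' : algebraMap (ZMod p) K v ≠ 0 := by
      rwa [map_ne_zero]
    have hxe : x = algebraMap (ZMod p) K (-u / v) := by
      rw [map_div₀, map_neg, eq_div_iff hv']
      linear_combination huv
    rw [hxe] at hx
    simpa only [map_add, map_mul, map_pow, map_intCast] using hx
  subst hv
  refine ⟨?_, rfl⟩
  rw [map_zero, zero_mul, add_zero] at huv
  exact (map_eq_zero _).1 huv

/-- The root in 𝔽_{p²} is simple, by the same discriminant identity, and lifts along the henselian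
ideal (p). -/
theorem exists_root_wittVector (h : ¬ HasRootMod p a Δ) (hpΔ : ¬ (p : ℤ) ∣ Δ)
    (ha : 4 * a = Δ - Δ ^ 2) : ∃ ρ : WittVector p (GaloisField p 2), ρ ^ 2 = Δ * ρ + a := by
  obtain ⟨x, hx⟩ := exists_root_galoisField h
  obtain ⟨z, hz⟩ := WittVector.constantCoeff_surjective p x
  let W := WittVector p (GaloisField p 2)
  let I : Ideal W := Ideal.span {(p : W)}
  have hI : I = RingHom.ker (WittVector.constantCoeff (p := p) (R := GaloisField p 2)) :=
    WittVector.ker_constantCoeff.symm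
  let f : Polynomial W := Polynomial.X ^ 2 - (Polynomial.C (Δ : W) * Polynomial.X +
    Polynomial.C (a : W))
  have heval : ∀ z, f.eval z = z ^ 2 - (Δ * z + a) := fun z => by
    simp only [f, Polynomial.eval_sub, Polynomial.eval_pow, Polynomial.eval_X, Polynomial.eval_mul,
      Polynomial.eval_C, Polynomial.eval_add]
  have hder : f.derivative.eval z = 2 * z - Δ := by
    simp only [f, Polynomial.derivative_sub, Polynomial.derivative_X_pow, Polynomial.derivative_add,
      Polynomial.derivative_C_mul, Polynomial.derivative_X, Polynomial.derivative_C,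
      Polynomial.eval_sub, Polynomial.eval_pow, Polynomial.eval_X, Polynomial.eval_mul,
      Polynomial.eval_C, Polynomial.eval_add, Polynomial.eval_one, Polynomial.eval_zero]
    push_cast
    ring
  have hf : f.Monic := Polynomial.monic_X_pow_sub Polynomial.degree_linear_lt
  have hH : HenselianRing W I := inferInstance
  obtain ⟨r, hr, -⟩ := hH.is_henselian f hf z
    (by
      rw [hI, RingHom.mem_ker, heval]
      rw [map_sub, map_add, map_mul, map_pow, hz]
      erw [map_intCast, map_intCast]
      exact sub_eq_zero.2 hx)
    (by
      have hΔ : (Δ : ZMod p) ≠ 0 := fun h0 => hpΔ ((ZMod.intCast_zmod_eq_zero_iff_dvd Δ p).1 h0)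
      have hne : 2 * x - Δ ≠ 0 := by
        intro h0
        have h2 : (Δ : GaloisField p 2) = 0 := by
          have ha' : (4 * a : GaloisField p 2) = Δ - Δ ^ 2 := by
            exact_mod_cast congrArg (Int.cast : ℤ → GaloisField p 2) ha
          linear_combination (2 * x - Δ) * h0 - 4 * hx - ha'
        refine hΔ ((algebraMap (ZMod p) (GaloisField p 2)).injective ?_)
        rw [map_intCast, h2, map_zero]
      let e := WittVector.quotientPEquiv (p := p) (k := GaloisField p 2)
      have he : e (Ideal.Quotient.mk I (f.derivative.eval z)) = 2 * x - Δ := by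
        change WittVector.constantCoeff (f.derivative.eval z) = _
        rw [hder, map_sub, map_mul, hz, map_ofNat, map_intCast]
      have hu : IsUnit (e (Ideal.Quotient.mk I (f.derivative.eval z))) := by
        rw [he]; exact hne.isUnit
      exact (MulEquiv.isUnit_map e).1 hu)
  refine ⟨r, sub_eq_zero.1 ?_⟩
  rw [← heval]; exact hr

theorem constantCoeff_padicToWitt (z : ℤ_[p]) :
    WittVector.constantCoeff (padicToWitt p z) =
      algebraMap (ZMod p) (GaloisField p 2) (PadicInt.toZMod z) :=
  padicInt_ringHom_apply ((WittVector.constantCoeff).comp (padicToWitt p)) z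

theorem padicInt_eq_zero_of_forall_pow_dvd {z : ℤ_[p]} (h : ∀ n : ℕ, (p : ℤ_[p]) ^ n ∣ z) :
    z = 0 := by
  have hH : IsHausdorff (IsLocalRing.maximalIdeal ℤ_[p]) ℤ_[p] := inferInstance
  refine hH.haus z fun n => ?_
  rw [SModEq.zero, smul_eq_mul, Ideal.mul_top, PadicInt.maximalIdeal_eq_span_p,
    Ideal.span_singleton_pow, Ideal.mem_span_singleton]
  exact h n

/-- The algebra is free of rank 2, so limits are taken coordinatewise. Completeness lets
surjectivity modulo p lift in the comparison with Witt vectors. -/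
theorem quadraticAlgebra_isPrecomplete {R : Type*} [CommRing R] (I : Ideal R) [hI : IsPrecomplete I R]
    (a b : R) : IsPrecomplete I (QuadraticAlgebra R a b) := by
  have key : ∀ (n : ℕ) (x : QuadraticAlgebra R a b),
      x ∈ (I ^ n • ⊤ : Submodule R (QuadraticAlgebra R a b)) ↔ x.re ∈ I ^ n ∧ x.im ∈ I ^ n := by
    intro n x
    constructor
    · intro hx
      refine Submodule.smul_induction_on hx (fun r hr y _ => ?_) fun y z hy hz => ?_
      · exact ⟨Ideal.mul_mem_right _ _ hr, Ideal.mul_mem_right _ _ hr⟩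
      · exact ⟨add_mem hy.1 hz.1, add_mem hy.2 hz.2⟩
    · rintro ⟨h1, h2⟩
      have : x = x.re • (1 : QuadraticAlgebra R a b) + x.im • QuadraticAlgebra.omega := by
        ext
        · change x.re = x.re * 1 + x.im * 0
          ring
        · change x.im = x.re * 0 + x.im * 1
          ring
      rw [this]
      exact add_mem (Submodule.smul_mem_smul h1 Submodule.mem_top)
        (Submodule.smul_mem_smul h2 Submodule.mem_top)
  have hR : ∀ (n : ℕ) (x y : R), x ≡ y [SMOD (I ^ n • ⊤ : Submodule R R)] ↔ x - y ∈ I ^ n := by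
    intro n x y
    rw [SModEq.sub_mem, smul_eq_mul, Ideal.mul_top]
  refine ⟨fun {f} hf => ?_⟩
  obtain ⟨x, hx⟩ := hI.prec (f := fun n => (f n).re) fun {m n} hmn => by
    rw [hR]
    exact ((key m _).1 (SModEq.sub_mem.1 (hf hmn))).1
  obtain ⟨y, hy⟩ := hI.prec (f := fun n => (f n).im) fun {m n} hmn => by
    rw [hR]
    exact ((key m _).1 (SModEq.sub_mem.1 (hf hmn))).2
  refine ⟨⟨x, y⟩, fun n => ?_⟩
  rw [SModEq.sub_mem, key]
  exact ⟨(hR n _ _).1 (hx n), (hR n _ _).1 (hy n)⟩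

/-- `W(𝔽_{p²})` is generated over `ℤ_p` by a root of a polynomial `X² - Δ X - a` that has no roots
modulo `p`. -/
theorem exists_quadraticAlgebra_equiv_wittVector (h : ¬ HasRootMod p a Δ) (hpΔ : ¬ (p : ℤ) ∣ Δ)
    (ha : 4 * a = Δ - Δ ^ 2) :
    ∃ e : QuadraticAlgebra ℤ_[p] (a : ℤ_[p]) (Δ : ℤ_[p]) ≃+* WittVector p (GaloisField p 2),
      ∀ z, e (algebraMap _ _ z) = padicToWitt p z := by
  obtain ⟨ρ, hρ⟩ := exists_root_wittVector h hpΔ ha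
  let W := WittVector p (GaloisField p 2)
  let Q := QuadraticAlgebra ℤ_[p] (a : ℤ_[p]) (Δ : ℤ_[p])
  let _ : Algebra ℤ_[p] W := (padicToWitt p).toAlgebra
  have hsmul : ∀ (z : ℤ_[p]) (w : W), z • w = padicToWitt p z * w := fun z w => rfl
  let θ : Q →ₐ[ℤ_[p]] W := QuadraticAlgebra.lift ⟨ρ, by
    rw [hsmul, hsmul, map_intCast, map_intCast, ← sq, hρ]; ring⟩
  have hθ : ∀ z : Q, θ z = padicToWitt p z.re + padicToWitt p z.im * ρ := by
    intro z
    change z.re • (1 : W) + z.im • ρ = _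
    rw [hsmul, hsmul, mul_one]
  let x : GaloisField p 2 := WittVector.constantCoeff ρ
  have hx : x ^ 2 = Δ * x + a := by
    have := congrArg WittVector.constantCoeff hρ
    simpa only [map_add, map_mul, map_pow, map_intCast] using this
  have hcc : ∀ z : Q, WittVector.constantCoeff (θ z) =
      algebraMap (ZMod p) (GaloisField p 2) (PadicInt.toZMod z.re) +
      algebraMap (ZMod p) (GaloisField p 2) (PadicInt.toZMod z.im) * x := by
    intro z
    rw [hθ, map_add, map_mul, constantCoeff_padicToWitt, constantCoeff_padicToWitt]
  have hinj : Function.Injective θ := by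
    rw [injective_iff_map_eq_zero]
    intro z hz
    -- 1 and x are independent over 𝔽_p, so an element of the kernel is divisible by p. As W has no
    -- p-torsion, the quotient is again in the kernel, and the argument repeats indefinitely.
    have step : ∀ z : Q, θ z = 0 → ∃ y : Q, z = (p : ℤ_[p]) • y ∧ θ y = 0 := by
      intro z hz
      have h0 := hcc z
      rw [hz, map_zero] at h0
      obtain ⟨h1, h2⟩ := algebraMap_add_mul_eq_zero h hx h0.symm
      rw [toZMod_eq_zero_iff] at h1 h2
      obtain ⟨u, hu⟩ := h1
      obtain ⟨v, hv⟩ := h2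
      refine ⟨⟨u, v⟩, ?_, ?_⟩
      · ext
        · exact hu
        · exact hv
      · have hzy : z = (p : ℤ_[p]) • (⟨u, v⟩ : Q) := by
          ext
          · exact hu
          · exact hv
        rw [hzy, map_smul, hsmul, map_natCast, mul_comm] at hz
        exact WittVector.eq_zero_of_p_mul_eq_zero _ hz
    have hall : ∀ n : ℕ, ∃ y : Q, z = ((p : ℤ_[p]) ^ n) • y ∧ θ y = 0 := by
      intro n
      induction n with
      | zero => exact ⟨z, by rw [pow_zero, one_smul], hz⟩
      | succ n ih =>
        obtain ⟨y, hy, hy0⟩ := ih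
        obtain ⟨y', hy', hy0'⟩ := step y hy0
        exact ⟨y', by rw [hy, hy', smul_smul, pow_succ], hy0'⟩
    ext
    · refine padicInt_eq_zero_of_forall_pow_dvd fun n => ?_
      obtain ⟨y, hy, -⟩ := hall n
      rw [hy]
      exact Dvd.intro _ rfl
    · refine padicInt_eq_zero_of_forall_pow_dvd fun n => ?_
      obtain ⟨y, hy, -⟩ := hall n
      rw [hy]
      exact Dvd.intro _ rfl
  have hsurj : Function.Surjective θ := by
    let I : Ideal ℤ_[p] := IsLocalRing.maximalIdeal ℤ_[p]
    have hI : I = Ideal.span {(p : ℤ_[p])} := PadicInt.maximalIdeal_eq_span_p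
    have hmap : ∀ n : ℕ, ∀ w : W, w ∈ (I ^ n • ⊤ : Submodule ℤ_[p] W) →
        w ∈ (Ideal.span {(p : W)}) ^ n := by
      intro n w hw
      refine Submodule.smul_induction_on hw (fun r hr y _ => ?_) fun y z hy hz => ?_
      · rw [hI, Ideal.span_singleton_pow,
          Ideal.mem_span_singleton] at hr
        obtain ⟨s, rfl⟩ := hr
        rw [hsmul, map_mul, map_pow, map_natCast, mul_assoc, Ideal.span_singleton_pow]
        exact Ideal.mem_span_singleton.2 (Dvd.intro _ rfl)
      · exact add_mem hy hz
    have h1 : IsPrecomplete I Q := quadraticAlgebra_isPrecomplete I _ _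
    have h2 : IsHausdorff I W := by
      refine ⟨fun w hw => ?_⟩
      have hW : IsHausdorff (Ideal.span {(p : W)}) W := inferInstance
      refine hW.haus w fun n => ?_
      rw [SModEq.zero, smul_eq_mul, Ideal.mul_top]
      exact hmap n w (SModEq.zero.1 (hw n))
    -- With a complete source and a separated target, surjectivity modulo p suffices. There it
    -- follows by counting: an injection of 𝔽_p² into 𝔽_{p²} is onto.
    refine surjective_of_mkQ_comp_surjective (I := I) (f := θ.toLinearMap) ?_
    intro w
    obtain ⟨w, rfl⟩ := Submodule.mkQ_surjective _ w
    let g : ZMod p × ZMod p → GaloisField p 2 := fun u =>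
      algebraMap (ZMod p) (GaloisField p 2) u.1 + algebraMap (ZMod p) (GaloisField p 2) u.2 * x
    have hg : Function.Surjective g := by
      have hginj : Function.Injective g := by
        intro u v huv
        have := algebraMap_add_mul_eq_zero h hx (u := u.1 - v.1) (v := u.2 - v.2) (by
          rw [map_sub, map_sub]
          linear_combination huv)
        exact Prod.ext (sub_eq_zero.1 this.1) (sub_eq_zero.1 this.2)
      refine (hginj.bijective_of_nat_card_le ?_).2
      rw [GaloisField.card p 2 two_ne_zero, Nat.card_prod, Nat.card_zmod, sq]
    obtain ⟨u, hu⟩ := hg (WittVector.constantCoeff w)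
    obtain ⟨r, hr⟩ : ∃ z : ℤ_[p], PadicInt.toZMod z = u.1 := ZMod.ringHom_surjective _ _
    obtain ⟨s, hs⟩ : ∃ z : ℤ_[p], PadicInt.toZMod z = u.2 := ZMod.ringHom_surjective _ _
    refine ⟨⟨r, s⟩, ?_⟩
    have hk : θ ⟨r, s⟩ - w ∈ Ideal.span {(p : W)} := by
      rw [← WittVector.ker_constantCoeff, RingHom.mem_ker, map_sub, hcc, hr, hs, ← hu, sub_self]
    obtain ⟨v, hv⟩ := Ideal.mem_span_singleton.1 hk
    change (Submodule.mkQ _) (θ ⟨r, s⟩) = _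
    rw [← sub_eq_zero, ← map_sub, hv]
    refine (Submodule.Quotient.mk_eq_zero _).2 ?_
    have : (p : W) * v = (p : ℤ_[p]) • v := by rw [hsmul, map_natCast]
    rw [this]
    refine Submodule.smul_mem_smul ?_ Submodule.mem_top
    rw [hI]
    exact Ideal.mem_span_singleton_self _
  refine ⟨RingEquiv.ofBijective θ ⟨hinj, hsurj⟩, fun z => θ.commutes z⟩

end Witt

/-! ### Residually split and residually inert orders -/

section Residual

variable {p : ℕ} [hp : Fact p.Prime] {a Δ : ℤ}

/-- ℤ_p is flat over ℤ, so the injection ℤ² → M stays injective after tensoring. -/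
theorem tensor_eq_zero {M : Type*} [AddCommGroup M] {m₁ m₂ : M}
    (h : ∀ x y : ℤ, x • m₁ + y • m₂ = 0 → x = 0 ∧ y = 0) {x y : ℤ_[p]}
    (hxy : TensorProduct.tmul ℤ x m₁ + TensorProduct.tmul ℤ y m₂ = 0) : x = 0 ∧ y = 0 := by
  let φ : ℤ × ℤ →ₗ[ℤ] M :=
    (LinearMap.toSpanSingleton ℤ M m₁).coprod (LinearMap.toSpanSingleton ℤ M m₂)
  have hφ : Function.Injective φ := by
    rw [injective_iff_map_eq_zero]
    rintro ⟨u, v⟩ huv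
    obtain ⟨rfl, rfl⟩ := h u v huv
    rfl
  have hinj := Module.Flat.lTensor_preserves_injective_linearMap (M := ℤ_[p]) φ hφ
  have hz : TensorProduct.tmul ℤ x ((1, 0) : ℤ × ℤ) + TensorProduct.tmul ℤ y ((0, 1) : ℤ × ℤ) = 0 := by
    apply hinj
    rw [map_add, map_zero, LinearMap.lTensor_tmul, LinearMap.lTensor_tmul]
    simpa [φ] using hxy
  have h1 := congrArg (TensorProduct.rid ℤ ℤ_[p] ∘ LinearMap.lTensor ℤ_[p] (LinearMap.fst ℤ ℤ ℤ)) hz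
  have h2 := congrArg (TensorProduct.rid ℤ ℤ_[p] ∘ LinearMap.lTensor ℤ_[p] (LinearMap.snd ℤ ℤ ℤ)) hz
  constructor
  · simpa using h1
  · simpa using h2

variable {B : Type*} [Ring B] {R : Subring B}

theorem exists_quadraticAlgebra_hom {γ : B} (hγ : γ ∈ R) (hsq : γ * γ = a • 1 + Δ • γ)
    (hli : ∀ x y : ℤ, x • (1 : B) + y • γ = 0 → x = 0 ∧ y = 0) :
    ∃ f : QuadraticAlgebra ℤ_[p] (a : ℤ_[p]) (Δ : ℤ_[p]) →ₐ[ℤ_[p]] TensorProduct ℤ ℤ_[p] R,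
      Function.Injective f := by
  let γ' : R := ⟨γ, hγ⟩
  have hsq' : γ' * γ' = a • 1 + Δ • γ' := Subtype.ext hsq
  have hli' : ∀ x y : ℤ, x • (1 : R) + y • γ' = 0 → x = 0 ∧ y = 0 := fun x y h =>
    hli x y (congrArg Subtype.val h)
  let f := QuadraticAlgebra.lift (R := ℤ_[p]) (a := (a : ℤ_[p])) (b := (Δ : ℤ_[p]))
    (A := TensorProduct ℤ ℤ_[p] R) ⟨TensorProduct.tmul ℤ 1 γ', by
      rw [Algebra.TensorProduct.tmul_mul_tmul, hsq', mul_one, TensorProduct.tmul_add,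
        TensorProduct.tmul_smul, TensorProduct.tmul_smul, Int.cast_smul_eq_zsmul,
        Int.cast_smul_eq_zsmul, Algebra.TensorProduct.one_def]⟩
  refine ⟨f, ?_⟩
  rw [injective_iff_map_eq_zero]
  intro z hz
  have hfz : f z = TensorProduct.tmul ℤ z.re 1 + TensorProduct.tmul ℤ z.im γ' := by
    change z.re • (1 : TensorProduct ℤ ℤ_[p] R) + z.im • TensorProduct.tmul ℤ 1 γ' = _
    rw [Algebra.TensorProduct.one_def, TensorProduct.smul_tmul', TensorProduct.smul_tmul',
      smul_eq_mul, smul_eq_mul, mul_one, mul_one]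
  rw [hfz] at hz
  obtain ⟨h1, h2⟩ := tensor_eq_zero hli' hz
  ext
  · exact h1
  · exact h2

/-- The subalgebra ℤ_p[γ] is itself W(𝔽_{p²}), so the residual type of R is forced by the presence
of γ. -/
theorem residuallyInertAt_of_not_hasRootMod (h : ¬ HasRootMod p a Δ) (hpΔ : ¬ (p : ℤ) ∣ Δ)
    (ha : 4 * a = Δ - Δ ^ 2) {γ : B} (hγ : γ ∈ R) (hsq : γ * γ = a • 1 + Δ • γ)
    (hli : ∀ x y : ℤ, x • (1 : B) + y • γ = 0 → x = 0 ∧ y = 0) : ResiduallyInertAt p R := by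
  obtain ⟨e, he⟩ := exists_quadraticAlgebra_equiv_wittVector h hpΔ ha
  obtain ⟨f, hf⟩ := exists_quadraticAlgebra_hom (p := p) hγ hsq hli
  refine ⟨f.toRingHom.comp e.symm.toRingHom, hf.comp e.symm.injective, fun z => ?_⟩
  change f (e.symm (padicToWitt p z)) = _
  rw [← he, e.symm_apply_apply, f.commutes]

theorem residuallySplitAt_of_hasRootMod (h : HasRootMod p a Δ) (hpΔ : ¬ (p : ℤ) ∣ Δ)
    (ha : 4 * a = Δ - Δ ^ 2) {γ : B} (hγ : γ ∈ R) (hsq : γ * γ = a • 1 + Δ • γ)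
    (hli : ∀ x y : ℤ, x • (1 : B) + y • γ = 0 → x = 0 ∧ y = 0) : ResiduallySplitAt p R := by
  obtain ⟨r, s, hrs⟩ := exists_splitRoots h hpΔ ha
  obtain ⟨f, hf⟩ := exists_quadraticAlgebra_hom (p := p) hγ hsq hli
  obtain ⟨u, hu⟩ := hrs.isUnit.exists_left_inv
  -- Evaluation at the two roots is an isomorphism onto ℤ_p × ℤ_p, because its determinant s - r is
  -- a unit.
  let g : QuadraticAlgebra ℤ_[p] (a : ℤ_[p]) (Δ : ℤ_[p]) →ₐ[ℤ_[p]] (ℤ_[p] × ℤ_[p]) :=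
    QuadraticAlgebra.lift ⟨(r, s), by
      have h1 := hrs.add_eq
      have h2 := hrs.mul_eq
      ext
      · change r * r = a * 1 + Δ * r
        linear_combination r * h1 - h2
      · change s * s = a * 1 + Δ * s
        linear_combination s * h1 - h2⟩
  have hg1 : ∀ z, (g z).1 = z.re + z.im * r := fun z => by
    change z.re * 1 + z.im * r = _
    rw [mul_one]
  have hg2 : ∀ z, (g z).2 = z.re + z.im * s := fun z => by
    change z.re * 1 + z.im * s = _
    rw [mul_one]
  have hg : Function.Bijective g := by
    constructor
    · rw [injective_iff_map_eq_zero]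
      intro z hz
      have h1 : z.re + z.im * r = 0 := by rw [← hg1, hz]; rfl
      have h2 : z.re + z.im * s = 0 := by rw [← hg2, hz]; rfl
      have h3 : z.im = 0 := by linear_combination u * (h1 - h2) - z.im * hu
      ext
      · change z.re = 0
        rw [h3, zero_mul, add_zero] at h1
        exact h1
      · exact h3
    · rintro ⟨x, y⟩
      refine ⟨⟨x - u * (x - y) * r, u * (x - y)⟩, Prod.ext ?_ ?_⟩
      · rw [hg1]; ring
      · rw [hg2]
        change x - u * (x - y) * r + u * (x - y) * s = y
        linear_combination -(x - y) * hu
  let e := AlgEquiv.ofBijective g hg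
  exact ⟨f.comp e.symm.toAlgHom, hf.comp e.symm.injective⟩

end Residual

/-! ### Arithmetic of fundamental discriminants -/

section Discriminants

/-- The square of the denominator of q divides m. -/
theorem exists_int_eq_of_squarefree {m : ℤ} (hm : Squarefree m) {q : ℚ} {z : ℤ}
    (h : (m : ℚ) * q ^ 2 = z) : ∃ k : ℤ, q = k := by
  have hden : (q.den : ℚ) ≠ 0 := by exact_mod_cast q.den_nz
  have hq : q * q.den = q.num := Rat.mul_den_eq_num q
  have h1 : m * q.num ^ 2 = z * (q.den : ℤ) ^ 2 := by
    have : (m : ℚ) * q.num ^ 2 = z * (q.den : ℚ) ^ 2 := by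
      rw [← hq, ← h]; ring
    exact_mod_cast this
  have hcop : IsCoprime ((q.den : ℤ) ^ 2) (q.num ^ 2) := by
    refine (IsCoprime.pow ?_)
    rw [Int.isCoprime_iff_gcd_eq_one, Int.gcd_comm]
    exact q.reduced
  have h2 : (q.den : ℤ) * q.den ∣ m := by
    rw [← sq]
    exact hcop.dvd_of_dvd_mul_right (Dvd.intro_left _ h1.symm)
  have h3 := hm _ h2
  have h4 : q.den = 1 := by simpa using Int.isUnit_iff_natAbs_eq.1 h3
  exact ⟨q.num, by rw [h4] at hq; simpa using hq⟩

/-- This determines the integers of ℚ(√D): X and N are the trace and norm of (X + q√D)/2, and the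
conclusion places that element in ℤ + ℤ(D + √D)/2. -/
theorem IsFundamentalDiscriminant.exists_int {D X N : ℤ} (hD : IsFundamentalDiscriminant D) {q : ℚ}
    (h : (D : ℚ) * q ^ 2 = ((X ^ 2 - 4 * N : ℤ) : ℚ)) : ∃ n : ℤ, q = n ∧ 2 ∣ X - n * D := by
  rcases hD with ⟨hD, hsf⟩ | ⟨m, rfl, hm, hsf⟩
  · obtain ⟨n, rfl⟩ := exists_int_eq_of_squarefree hsf h
    refine ⟨n, rfl, ?_⟩
    have h1 : D * n ^ 2 = X ^ 2 - 4 * N := by exact_mod_cast h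
    have hp : (2 : ℤ) ∣ X ^ 2 - D * n ^ 2 := ⟨2 * N, by rw [h1]; ring⟩
    have e1 := Int.emod_two_eq_zero_or_one D
    rcases Int.even_or_odd' X with ⟨x, rfl | rfl⟩ <;> rcases Int.even_or_odd' n with ⟨y, rfl | rfl⟩ <;>
      obtain ⟨k, hk⟩ : ∃ k, D = 4 * k + 1 := ⟨D / 4, by omega⟩ <;> subst hk
    · exact ⟨x - y * (4 * k + 1), by ring⟩
    · obtain ⟨l, hl⟩ := hp
      ring_nf at hl
      omega
    · obtain ⟨l, hl⟩ := hp
      ring_nf at hl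
      omega
    · exact ⟨x - 2 * k - y * (4 * k + 1), by ring⟩
  · have h' : (m : ℚ) * (2 * q) ^ 2 = ((X ^ 2 - 4 * N : ℤ) : ℚ) := by
      rw [← h]; push_cast; ring
    obtain ⟨k, hk⟩ := exists_int_eq_of_squarefree hsf h'
    rw [hk] at h'
    have h1 : m * k ^ 2 = X ^ 2 - 4 * N := by exact_mod_cast h'
    rcases Int.even_or_odd' k with ⟨n, rfl | rfl⟩
    · refine ⟨n, ?_, ?_⟩
      · push_cast at hk; linarith
      · rcases Int.even_or_odd' X with ⟨x, rfl | rfl⟩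
        · exact ⟨x - 2 * n * m, by ring⟩
        · exfalso
          ring_nf at h1
          generalize m * n ^ 2 = A at h1
          generalize x ^ 2 = B at h1
          omega
    · exfalso
      obtain ⟨j, hj⟩ : ∃ j, m = 4 * j + m % 4 := ⟨m / 4, by omega⟩
      have key : m * (2 * n + 1) ^ 2 = 4 * (m * (n ^ 2 + n)) + m := by ring
      rw [key] at h1
      generalize m * (n ^ 2 + n) = A at h1
      rcases Int.even_or_odd' X with ⟨x, rfl | rfl⟩
      · have : (2 * x) ^ 2 = 4 * x ^ 2 := by ring
        rw [this] at h1
        generalize x ^ 2 = B at h1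
        omega
      · have : (2 * x + 1) ^ 2 = 4 * (x ^ 2 + x) + 1 := by ring
        rw [this] at h1
        generalize x ^ 2 + x = B at h1
        omega

theorem IsFundamentalDiscriminant.mul {Δ₁ Δ₂ : ℤ} (h₁ : IsFundamentalDiscriminant Δ₁)
    (h₂ : IsFundamentalDiscriminant Δ₂) (h : IsCoprime Δ₁ Δ₂) :
    IsFundamentalDiscriminant (Δ₁ * Δ₂) := by
  have key : ∀ {D E : ℤ}, D % 4 = 1 → Squarefree D →
      (∃ m : ℤ, E = 4 * m ∧ (m % 4 = 2 ∨ m % 4 = 3) ∧ Squarefree m) → IsCoprime D E →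
      IsFundamentalDiscriminant (D * E) := by
    rintro D _ hD hsf ⟨m, rfl, hm, hsm⟩ hc
    refine Or.inr ⟨D * m, by ring, ?_, ?_⟩
    · rw [Int.mul_emod, hD, one_mul, Int.emod_emod]
      exact hm
    · exact squarefree_mul_iff.2 ⟨hc.of_mul_right_right.isRelPrime, hsf, hsm⟩
  rcases h₁ with ⟨hD, hsf⟩ | h₁
  · rcases h₂ with ⟨hE, hsf'⟩ | h₂
    · refine Or.inl ⟨by rw [Int.mul_emod, hD, hE]; rfl, ?_⟩
      exact squarefree_mul_iff.2 ⟨h.isRelPrime, hsf, hsf'⟩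
    · exact key hD hsf h₂ h
  · rcases h₂ with ⟨hE, hsf'⟩ | ⟨m, rfl, -⟩
    · rw [mul_comm]
      exact key hE hsf' h₁ h.symm
    · obtain ⟨l, rfl, -⟩ := h₁
      exfalso
      have : IsUnit (4 : ℤ) := h.isUnit_of_dvd' (Dvd.intro _ rfl) (Dvd.intro _ rfl)
      exact absurd this (by decide)

theorem IsFundamentalDiscriminant.not_isSquare {D : ℤ} (hD : IsFundamentalDiscriminant D)
    (h1 : D ≠ 1) : ¬ IsSquare D := by
  rintro ⟨k, rfl⟩
  rcases hD with ⟨-, hsf⟩ | ⟨m, hm, hm4, hsf⟩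
  · rcases Int.isUnit_iff.1 (hsf k dvd_rfl) with rfl | rfl <;> exact h1 rfl
  · rcases Int.even_or_odd' k with ⟨l, rfl | rfl⟩
    · have : m = l * l := by linarith
      subst this
      rcases Int.isUnit_iff.1 (hsf l dvd_rfl) with rfl | rfl <;> omega
    · ring_nf at hm
      generalize l ^ 2 = A at hm
      omega

end Discriminants

/-! ### The biquadratic tower ℚ ⊂ F ⊂ L -/

section Tower

open NumberField

open scoped Pointwise

/-- `L = F(s)` and `F = ℚ(d)` with `s² = Δ`, `d² = Δ Δ'`. -/
structure IsBiquadraticTower {L : Type*} [Field L] [NumberField L] (F : IntermediateField ℚ L)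
    (Δ Δ' : ℤ) (s : L) (d : F) : Prop where
  neg : Δ < 0
  neg' : Δ' < 0
  not_isSquare : ¬ IsSquare (Δ * Δ')
  s_sq : s ^ 2 = Δ
  d_sq : (d : L) ^ 2 = Δ * Δ'
  span_L : ∀ z : L, ∃ x y : F, z = x + y * s
  span_F : ∀ u : F, ∃ x y : ℚ, (u : L) = x + y * d

namespace IsBiquadraticTower

variable {L : Type*} [Field L] [NumberField L] {F : IntermediateField ℚ L} {Δ Δ' : ℤ} {s : L} {d : F}

theorem d_notMem (h : IsBiquadraticTower F Δ Δ' s d) (q : ℚ) : (d : L) ≠ q := by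
  intro hq
  refine h.not_isSquare ?_
  rw [← Rat.isSquare_intCast_iff]
  refine ⟨q, ?_⟩
  have := h.d_sq
  rw [hq] at this
  have h2 : (q : L) ^ 2 = ((Δ * Δ' : ℤ) : L) := by rw [this]; push_cast; rfl
  rw [← sq]
  exact_mod_cast h2.symm

/-- If s = x + y d with x, y rational, irrationality of d forces xy = 0, and then Δ = x² + ΔΔ'y² is
nonnegative, against Δ < 0. The signs of both discriminants enter here. -/
theorem s_notMem (h : IsBiquadraticTower F Δ Δ' s d) (u : F) : s ≠ u := by
  intro hs
  obtain ⟨x, y, hxy⟩ := h.span_F u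
  have hΔ : (Δ : ℚ) < 0 := by exact_mod_cast h.neg
  have hΔ' : (Δ' : ℚ) < 0 := by exact_mod_cast h.neg'
  have h1 : (Δ : L) = x ^ 2 + Δ * Δ' * y ^ 2 + 2 * x * y * d := by
    have h2 := h.s_sq
    rw [hs, hxy] at h2
    linear_combination y ^ 2 * h.d_sq - h2
  by_cases hxy0 : 2 * x * y = 0
  · have hL : (2 * x * y : L) = 0 := by exact_mod_cast congrArg (Rat.cast : ℚ → L) hxy0
    rw [hL, zero_mul, add_zero] at h1
    have h2 : (Δ : ℚ) = x ^ 2 + Δ * Δ' * y ^ 2 := by exact_mod_cast h1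
    nlinarith [sq_nonneg x, mul_nonneg (mul_pos_of_neg_of_neg hΔ hΔ').le (sq_nonneg y)]
  · refine h.d_notMem ((Δ - x ^ 2 - Δ * Δ' * y ^ 2) / (2 * x * y)) ?_
    have hL : (2 * x * y : L) ≠ 0 := by exact_mod_cast hxy0
    push_cast
    rw [eq_div_iff hL]
    linear_combination -h1

theorem exists_gal_neg [IsGalois ℚ L] (h : IsBiquadraticTower F Δ Δ' s d) :
    ∃ σ : Gal(L/F), σ s = -s := by
  have hs : s ∉ Set.range (algebraMap F L) := by
    rintro ⟨u, hu⟩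
    exact h.s_notMem u hu.symm
  rw [IsGalois.mem_range_algebraMap_iff_fixed] at hs
  push Not at hs
  obtain ⟨σ, hσ⟩ := hs
  refine ⟨σ, ?_⟩
  have h2 : (σ s) ^ 2 = s ^ 2 := by rw [← map_pow, h.s_sq, map_intCast]
  exact (sq_eq_sq_iff_eq_or_eq_neg.1 h2).resolve_left hσ

theorem exists_gal_neg_d [IsGalois ℚ L] (h : IsBiquadraticTower F Δ Δ' s d) :
    ∃ τ : Gal(L/ℚ), τ d = -d := by
  have hs : (d : L) ∉ Set.range (algebraMap ℚ L) := by
    rintro ⟨u, hu⟩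
    exact h.d_notMem u (by rw [← hu]; rfl)
  rw [IsGalois.mem_range_algebraMap_iff_fixed] at hs
  push Not at hs
  obtain ⟨σ, hσ⟩ := hs
  refine ⟨σ, ?_⟩
  have h2 : (σ d) ^ 2 = (d : L) ^ 2 := by rw [← map_pow, h.d_sq, map_mul, map_intCast, map_intCast]
  exact (sq_eq_sq_iff_eq_or_eq_neg.1 h2).resolve_left hσ

theorem gal_eq (h : IsBiquadraticTower F Δ Δ' s d) {σ g : Gal(L/F)} (hg : g s = σ s) : g = σ := by
  ext z
  obtain ⟨x, y, rfl⟩ := h.span_L z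
  have hF : ∀ (τ : Gal(L/F)) (u : F), τ u = u := fun τ u => τ.commutes u
  rw [map_add, map_mul, map_add, map_mul, hg, hF, hF, hF, hF]

theorem gal_eq_one_or (h : IsBiquadraticTower F Δ Δ' s d) {σ : Gal(L/F)} (hσ : σ s = -s)
    (g : Gal(L/F)) : g = 1 ∨ g = σ := by
  have h2 : (g s) ^ 2 = s ^ 2 := by rw [← map_pow, h.s_sq, map_intCast]
  rcases sq_eq_sq_iff_eq_or_eq_neg.1 h2 with h3 | h3
  · exact Or.inl (h.gal_eq h3)
  · exact Or.inr (h.gal_eq (h3.trans hσ.symm))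

theorem gal_mul_self (h : IsBiquadraticTower F Δ Δ' s d) {σ : Gal(L/F)} (hσ : σ s = -s) :
    σ * σ = 1 := by
  refine h.gal_eq ?_
  change σ (σ s) = s
  rw [hσ, map_neg, hσ, neg_neg]

/-- Every integer of `F` lies in `ℤ + ℤ (t + d) / 2`. -/
theorem exists_int_coords [IsGalois ℚ L] (h : IsBiquadraticTower F Δ Δ' s d)
    (hD : IsFundamentalDiscriminant (Δ * Δ')) {t : ℤ} (ht : 2 ∣ t - Δ * Δ') (u : 𝓞 F) :
    ∃ m n : ℤ, ((u : F) : L) = m + n * ((t + d) / 2) := by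
  obtain ⟨x, y, hxy⟩ := h.span_F u
  obtain ⟨τ, hτ⟩ := h.exists_gal_neg_d
  have hu : IsIntegral ℤ ((u : F) : L) := (RingOfIntegers.isIntegral_coe u).map F.val
  have hu' : IsIntegral ℤ (τ ((u : F) : L)) := hu.map τ
  have hτu : τ ((u : F) : L) = x - y * d := by
    rw [hxy, map_add, map_mul, map_ratCast, map_ratCast, hτ]; ring
  have hrat : ∀ q : ℚ, IsIntegral ℤ (q : L) → ∃ n : ℤ, q = n := by
    intro q hq
    have h1 : IsIntegral ℤ (algebraMap ℚ L q) := hq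
    rw [isIntegral_algebraMap_iff (algebraMap ℚ L).injective,
      IsIntegrallyClosed.isIntegral_iff] at h1
    obtain ⟨n, hn⟩ := h1
    exact ⟨n, hn.symm⟩
  obtain ⟨X, hX⟩ := hrat (2 * x) (by
    have := hu.add hu'
    rw [hτu, hxy] at this
    have e : ((2 * x : ℚ) : L) = x + y * d + (x - y * d) := by push_cast; ring
    rwa [e])
  obtain ⟨N, hN⟩ := hrat (x ^ 2 - Δ * Δ' * y ^ 2) (by
    have := hu.mul hu'
    rw [hτu, hxy] at this
    have e : ((x ^ 2 - Δ * Δ' * y ^ 2 : ℚ) : L) = (x + y * d) * (x - y * d) := by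
      push_cast
      linear_combination y ^ 2 * h.d_sq
    rwa [e])
  -- The trace is X = 2x and the norm is N = x² - ΔΔ'y², so ΔΔ'(2y)² = X² - 4N.
  obtain ⟨n, hn, k, hk⟩ := hD.exists_int (X := X) (N := N) (q := 2 * y) (by
    push_cast
    rw [← hX, ← hN]
    ring)
  obtain ⟨l, hl⟩ := ht
  refine ⟨k - n * l, n, ?_⟩
  have hkL : (X : L) - n * (Δ * Δ') = 2 * k := by exact_mod_cast congrArg (Int.cast : ℤ → L) hk
  have hlL : (t : L) - Δ * Δ' = 2 * l := by exact_mod_cast congrArg (Int.cast : ℤ → L) hl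
  have hXL : (2 * x : L) = X := by exact_mod_cast congrArg (Rat.cast : ℚ → L) hX
  have hnL : (2 * y : L) = n := by exact_mod_cast congrArg (Rat.cast : ℚ → L) hn
  rw [hxy]
  push_cast
  linear_combination (1 / 2 : L) * (hXL + d * hnL + hkL - n * hlL)

variable {p : ℕ} {a : ℤ}

/-- The integer `(Δ + s) / 2`. -/
theorem exists_gen (h : IsBiquadraticTower F Δ Δ' s d) (ha : 4 * a = Δ - Δ ^ 2) :
    ∃ γ : 𝓞 L, 2 * (γ : L) = Δ + s ∧ γ ^ 2 = Δ * γ + a := by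
  have haL : (4 * a : L) = Δ - Δ ^ 2 := by exact_mod_cast congrArg (Int.cast : ℤ → L) ha
  have hγ : ((Δ + s) / 2) ^ 2 = Δ * ((Δ + s) / 2) + a := by
    linear_combination (1 / 4 : L) * h.s_sq - (1 / 4 : L) * haL
  have hint : IsIntegral ℤ ((Δ + s) / 2) := by
    refine ⟨Polynomial.X ^ 2 - (Polynomial.C Δ * Polynomial.X + Polynomial.C a),
      Polynomial.monic_X_pow_sub Polynomial.degree_linear_lt, ?_⟩
    simp only [Polynomial.eval₂_sub, Polynomial.eval₂_add, Polynomial.eval₂_mul,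
      Polynomial.eval₂_pow, Polynomial.eval₂_X, Polynomial.eval₂_C]
    exact sub_eq_zero.2 hγ
  refine ⟨⟨(Δ + s) / 2, hint⟩, ?_, ?_⟩
  · change 2 * ((Δ + s) / 2) = Δ + s
    ring
  · apply RingOfIntegers.coe_injective
    push_cast
    exact hγ

theorem smul_gen {γ : 𝓞 L} (hγ : 2 * (γ : L) = Δ + s) {σ : Gal(L/F)} (hσ : σ s = -s) :
    σ • γ = Δ - γ := by
  apply RingOfIntegers.coe_injective
  have h2 : 2 * σ (γ : L) = Δ - s := by
    have := congrArg σ hγ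
    rw [map_mul, map_add, hσ, map_intCast, map_ofNat] at this
    rw [this]; ring
  change σ (γ : L) = _
  rw [map_sub, map_intCast]
  linear_combination (1 / 2 : L) * (h2 + hγ)

end IsBiquadraticTower

theorem intCast_mem_iff_of_mem_primesOver {p : ℕ} {R : Type*} [CommRing R] {P : Ideal R}
    (hP : P ∈ (Ideal.span {(p : ℤ)}).primesOver R) (n : ℤ) : (n : R) ∈ P ↔ (p : ℤ) ∣ n := by
  have := hP.2
  rw [← Ideal.mem_span_singleton, Ideal.mem_of_liesOver P (Ideal.span {(p : ℤ)}) n]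
  rfl

end Tower

/-! ### Splitting of primes in L/F -/

section Genus

open NumberField

open scoped Pointwise

namespace IsBiquadraticTower

variable {L : Type*} [Field L] [NumberField L] {F : IntermediateField ℚ L} {Δ Δ' : ℤ} {s : L} {d : F}
  {p : ℕ} [hp : Fact p.Prime] {a : ℤ}

/-- Let r be a root modulo p. A prime P above 𝔮 contains (γ - r)(γ - (Δ - r)), and σ exchanges the
two factors up to sign. If σP = P, both factors lie in P, hence so does Δ - 2r, whose square is Δ
modulo p; this contradicts p ∤ Δ. So P and σP are distinct, and they are all the primes above 𝔮. -/
theorem ncard_primesOver_of_hasRootMod [IsGalois ℚ L] (h : IsBiquadraticTower F Δ Δ' s d)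
    (ha : 4 * a = Δ - Δ ^ 2) (hpΔ : ¬ (p : ℤ) ∣ Δ) (hroot : HasRootMod p a Δ) {𝔮 : Ideal (𝓞 F)}
    (h𝔮 : 𝔮 ∈ (Ideal.span {(p : ℤ)}).primesOver (𝓞 F)) :
    (𝔮.primesOver (𝓞 L)).ncard = 2 := by
  obtain ⟨γ, hγ, hγ2⟩ := h.exists_gen ha
  obtain ⟨σ, hσ⟩ := h.exists_gal_neg
  have hprime : 𝔮.IsPrime := h𝔮.1
  have hover : 𝔮.LiesOver (Ideal.span {(p : ℤ)}) := h𝔮.2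
  obtain ⟨x, hx⟩ := hroot
  obtain ⟨r, rfl⟩ := ZMod.intCast_surjective x
  have hr : (p : ℤ) ∣ r ^ 2 - (Δ * r + a) := by
    rw [← ZMod.intCast_zmod_eq_zero_iff_dvd]
    push_cast
    exact sub_eq_zero.2 hx
  obtain ⟨P⟩ := (inferInstance : Nonempty (𝔮.primesOver (𝓞 L)))
  have hPprime : P.1.IsPrime := P.2.1
  have hPover : P.1.LiesOver 𝔮 := P.2.2
  have hPp : P.1 ∈ (Ideal.span {(p : ℤ)}).primesOver (𝓞 L) :=
    ⟨hPprime, Ideal.LiesOver.trans P.1 𝔮 _⟩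
  have hset : 𝔮.primesOver (𝓞 L) = {P.1, σ • P.1} := by
    ext Q
    constructor
    · rintro ⟨hQ, hQ'⟩
      obtain ⟨g, rfl⟩ := Ideal.exists_smul_eq_of_isGaloisGroup 𝔮 P.1 Q Gal(L/F)
      rcases h.gal_eq_one_or hσ g with rfl | rfl
      · exact Or.inl (one_smul _ _)
      · exact Or.inr rfl
    · rintro (rfl | rfl)
      · exact P.2
      · exact ⟨inferInstance, inferInstance⟩
  have hne : P.1 ≠ σ • P.1 := by
    intro heq
    have heq' : σ • P.1 = P.1 := heq.symm
    have hstab : ∀ z ∈ P.1, σ • z ∈ P.1 := fun z hz => by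
      have := Ideal.smul_mem_pointwise_smul σ z P.1 hz
      rwa [heq'] at this
    have hprod : (γ - r) * (γ - (Δ - r)) ∈ P.1 := by
      have e : (γ - r) * (γ - (Δ - r)) = ((-(r ^ 2 - (Δ * r + a)) : ℤ) : 𝓞 L) := by
        push_cast
        linear_combination hγ2
      rw [e, intCast_mem_iff_of_mem_primesOver hPp]
      exact (dvd_neg).2 hr
    have hs1 : σ • (γ - r : 𝓞 L) = -(γ - (Δ - r)) := by
      rw [smul_sub, smul_gen hγ hσ]
      have : σ • (r : 𝓞 L) = r := map_intCast (MulSemiringAction.toRingHom Gal(L/F) (𝓞 L) σ) r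
      rw [this]
      ring
    have hs2 : σ • (γ - (Δ - r) : 𝓞 L) = -(γ - r) := by
      have h2 := congrArg (σ • ·) hs1
      simp only [smul_neg, ← mul_smul, h.gal_mul_self hσ, one_smul] at h2
      rw [h2, neg_neg]
    have hboth : (γ - r : 𝓞 L) ∈ P.1 ∧ (γ - (Δ - r) : 𝓞 L) ∈ P.1 := by
      rcases hPprime.mem_or_mem hprod with h1 | h1
      · refine ⟨h1, ?_⟩
        have := hstab _ h1
        rwa [hs1, neg_mem_iff] at this
      · refine ⟨?_, h1⟩
        have := hstab _ h1
        rwa [hs2, neg_mem_iff] at this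
    have hdiff : ((Δ - 2 * r : ℤ) : 𝓞 L) ∈ P.1 := by
      have := sub_mem hboth.1 hboth.2
      have e : ((Δ - 2 * r : ℤ) : 𝓞 L) = (γ - r) - (γ - (Δ - r)) := by
        push_cast; ring
      rwa [e]
    rw [intCast_mem_iff_of_mem_primesOver hPp] at hdiff
    refine hpΔ ?_
    have e : Δ = (Δ - 2 * r) * (Δ - 2 * r) - 4 * (r ^ 2 - (Δ * r + a)) := by
      linear_combination -ha
    rw [e]
    exact dvd_sub (Dvd.dvd.mul_right hdiff _) (Dvd.dvd.mul_left hr _)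
  rw [hset, Set.ncard_pair hne]

/-- When 𝔮 splits, γ is congruent modulo P to an integer u of F, which is therefore a root of the
polynomial modulo 𝔮. The divisibility p ∣ c makes the residue field of 𝔮 equal to 𝔽_p, so the root
can be taken in ℤ. -/
theorem hasRootMod_of_ncard_primesOver [IsGalois ℚ L] (h : IsBiquadraticTower F Δ Δ' s d)
    (ha : 4 * a = Δ - Δ ^ 2) (hD : IsFundamentalDiscriminant (Δ * Δ')) {t c : ℤ}
    (ht : 2 ∣ t - Δ * Δ') (hc : 4 * c = t ^ 2 - Δ * Δ') (hpc : (p : ℤ) ∣ c) {𝔮 : Ideal (𝓞 F)}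
    (h𝔮 : 𝔮 ∈ (Ideal.span {(p : ℤ)}).primesOver (𝓞 F))
    (hcard : (𝔮.primesOver (𝓞 L)).ncard = 2) : HasRootMod p a Δ := by
  obtain ⟨γ, hγ, hγ2⟩ := h.exists_gen ha
  obtain ⟨σ, hσ⟩ := h.exists_gal_neg
  have hprime : 𝔮.IsPrime := h𝔮.1
  have hover : 𝔮.LiesOver (Ideal.span {(p : ℤ)}) := h𝔮.2
  obtain ⟨P, P', hne, hset⟩ := Set.ncard_eq_two.1 hcard
  have hP : P ∈ 𝔮.primesOver (𝓞 L) := hset ▸ Or.inl rfl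
  have hP' : P' ∈ 𝔮.primesOver (𝓞 L) := hset ▸ Or.inr rfl
  have hP1 := hP.1
  have hP2 := hP.2
  have hP1' := hP'.1
  have hP2' := hP'.2
  have hσP : σ • P = P' := by
    obtain ⟨g, hg⟩ := Ideal.exists_smul_eq_of_isGaloisGroup 𝔮 P P' Gal(L/F)
    rcases h.gal_eq_one_or hσ g with rfl | rfl
    · rw [one_smul] at hg
      exact absurd hg hne
    · exact hg
  have hσP' : σ • P' = P := by
    rw [← hσP, ← mul_smul, h.gal_mul_self hσ, one_smul]
  have hmax : ∀ Q ∈ 𝔮.primesOver (𝓞 L), Q.IsMaximal := by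
    rintro Q ⟨hQ, hQ'⟩
    have hQp : Q ∈ (Ideal.span {(p : ℤ)}).primesOver (𝓞 L) := ⟨hQ, Ideal.LiesOver.trans Q 𝔮 _⟩
    refine hQ.isMaximal ?_
    rintro rfl
    have := (intCast_mem_iff_of_mem_primesOver hQp p).2 dvd_rfl
    rw [Ideal.mem_bot] at this
    exact hp.1.ne_zero (by exact_mod_cast this)
  have hcop : P ⊔ P' = ⊤ := Ideal.IsMaximal.coprime_of_ne (hmax P hP) (hmax P' hP') hne
  -- β is 1 modulo P and 0 modulo P' = σP, so the trace βγ + σ(βγ), which lies in F, is congruent to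
  -- γ modulo P.
  obtain ⟨α, hα, β, hβ, hαβ⟩ := Submodule.mem_sup.1 ((Ideal.eq_top_iff_one _).1 hcop)
  obtain ⟨x, y, hxy⟩ := h.span_L (algebraMap (𝓞 L) L (β * γ))
  have htr : algebraMap (𝓞 L) L (β * γ + σ • (β * γ)) = algebraMap F L (2 * x) := by
    have e1 : algebraMap (𝓞 L) L (σ • (β * γ)) = σ (algebraMap (𝓞 L) L (β * γ)) := rfl
    have hF : ∀ u : F, σ u = u := fun u => σ.commutes u
    rw [map_add, e1, hxy, map_add, map_mul, hσ, hF, hF, map_mul, map_ofNat]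
    change _ = 2 * (x : L)
    ring
  have hint : IsIntegral ℤ (2 * x : F) := by
    rw [← isIntegral_algebraMap_iff (algebraMap F L).injective]
    rw [← htr]
    exact RingOfIntegers.isIntegral_coe (β * γ + σ • (β * γ))
  let u : 𝓞 F := ⟨2 * x, hint⟩
  have hu : algebraMap (𝓞 F) (𝓞 L) u = β * γ + σ • (β * γ) := by
    apply RingOfIntegers.coe_injective
    exact htr.symm
  have huγ : algebraMap (𝓞 F) (𝓞 L) u - γ ∈ P := by
    have e : algebraMap (𝓞 F) (𝓞 L) u - γ = σ • (β * γ) - α * γ := by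
      rw [hu]
      linear_combination γ * hαβ
    rw [e]
    refine sub_mem ?_ (Ideal.mul_mem_right _ _ hα)
    rw [← hσP']
    exact Ideal.smul_mem_pointwise_smul σ _ P' (Ideal.mul_mem_right _ _ hβ)
  have huq : u ^ 2 - (Δ * u + a) ∈ 𝔮 := by
    rw [Ideal.mem_of_liesOver P 𝔮]
    have e : algebraMap (𝓞 F) (𝓞 L) (u ^ 2 - (Δ * u + a)) =
        (algebraMap (𝓞 F) (𝓞 L) u - γ) * (algebraMap (𝓞 F) (𝓞 L) u + γ - Δ) := by
      rw [map_sub, map_pow, map_add, map_mul, map_intCast, map_intCast]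
      linear_combination hγ2
    rw [e]
    exact Ideal.mul_mem_right _ _ huγ
  obtain ⟨m, n, hmn⟩ := h.exists_int_coords hD ht u
  have hcL : (4 * c : L) = t ^ 2 - Δ * Δ' := by exact_mod_cast congrArg (Int.cast : ℤ → L) hc
  have hδint : IsIntegral ℤ ((t + d) / 2 : F) := by
    refine ⟨Polynomial.X ^ 2 - (Polynomial.C t * Polynomial.X + Polynomial.C (-c)),
      Polynomial.monic_X_pow_sub Polynomial.degree_linear_lt, ?_⟩
    simp only [Polynomial.eval₂_sub, Polynomial.eval₂_add, Polynomial.eval₂_mul,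
      Polynomial.eval₂_pow, Polynomial.eval₂_X, Polynomial.eval₂_C]
    apply (algebraMap F L).injective
    have hd : algebraMap F L d = (d : L) := rfl
    simp only [map_sub, map_add, map_mul, map_pow, map_div₀, map_intCast, map_ofNat, map_neg, hd,
      map_zero, eq_intCast, Int.cast_neg]
    linear_combination (1 / 4 : L) * h.d_sq + (1 / 4 : L) * hcL
  let δ : 𝓞 F := ⟨(t + d) / 2, hδint⟩
  have hδL : ((δ : F) : L) = (t + d) / 2 := by
    change (((t + d) / 2 : F) : L) = _
    push_cast
    rfl
  have huδ : u = m + n * δ := by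
    apply RingOfIntegers.coe_injective
    apply (algebraMap F L).injective
    change ((u : F) : L) = (((m + n * δ : 𝓞 F) : F) : L)
    rw [hmn, ← hδL]
    push_cast
    rfl
  have hδδ : δ * (t - δ) = c := by
    apply RingOfIntegers.coe_injective
    apply (algebraMap F L).injective
    have hδL' : algebraMap F L (algebraMap (𝓞 F) F δ) = (t + d) / 2 := hδL
    simp only [map_mul, map_sub, map_intCast, hδL']
    linear_combination -(1 / 4 : L) * h.d_sq - (1 / 4 : L) * hcL
  have hcq : δ * (t - δ) ∈ 𝔮 := by
    rw [hδδ, intCast_mem_iff_of_mem_primesOver h𝔮]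
    exact hpc
  -- 𝔮 contains δ or t - δ, so δ is congruent to 0 or t, and u = m + nδ to m or m + nt.
  obtain ⟨k, hk⟩ : ∃ k : ℤ, u - k ∈ 𝔮 := by
    rcases hprime.mem_or_mem hcq with h1 | h1
    · refine ⟨m, ?_⟩
      rw [huδ, add_sub_cancel_left]
      exact Ideal.mul_mem_left _ _ h1
    · refine ⟨m + n * t, ?_⟩
      have e : u - ((m + n * t : ℤ) : 𝓞 F) = -(n * (t - δ)) := by
        rw [huδ]; push_cast; ring
      rw [e]
      exact neg_mem (Ideal.mul_mem_left _ _ h1)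
  have hkq : ((k ^ 2 - (Δ * k + a) : ℤ) : 𝓞 F) ∈ 𝔮 := by
    have e : ((k ^ 2 - (Δ * k + a) : ℤ) : 𝓞 F) =
        u ^ 2 - (Δ * u + a) - (u - k) * (u + k - Δ) := by
      push_cast; ring
    rw [e]
    exact sub_mem huq (Ideal.mul_mem_right _ _ hk)
  rw [intCast_mem_iff_of_mem_primesOver h𝔮, ← ZMod.intCast_zmod_eq_zero_iff_dvd] at hkq
  refine ⟨k, ?_⟩
  push_cast at hkq
  exact sub_eq_zero.1 hkq

end IsBiquadraticTower

end Genus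

/-! ### The genus character of the concrete fields -/

section Compositum

open NumberField Polynomial

variable {Δ₁ Δ₂ : ℤ}

theorem isSplittingField_compositumField (Δ₁ Δ₂ : ℤ) :
    IsSplittingField ℚ (compositumField Δ₁ Δ₂) ((X ^ 2 - C (Δ₁ : ℚ)) * (X ^ 2 - C (Δ₂ : ℚ))) := by
  have hne : ∀ Δ : ℤ, (X ^ 2 - C (Δ : ℚ)) ≠ 0 := fun Δ => (monic_X_pow_sub_C _ two_ne_zero).ne_zero
  have hset : {z : ℂ | z ^ 2 = (Δ₁ : ℂ) ∨ z ^ 2 = (Δ₂ : ℂ)} =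
      ((X ^ 2 - C (Δ₁ : ℚ)) * (X ^ 2 - C (Δ₂ : ℚ))).rootSet ℂ := by
    ext z
    rw [mem_rootSet_of_ne (mul_ne_zero (hne _) (hne _))]
    simp [sub_eq_zero]
  rw [compositumField, hset]
  exact IntermediateField.adjoin_rootSet_isSplittingField (IsAlgClosed.splits _)

instance finiteDimensional_compositumField (Δ₁ Δ₂ : ℤ) :
    FiniteDimensional ℚ (compositumField Δ₁ Δ₂) :=
  have := isSplittingField_compositumField Δ₁ Δ₂
  IsSplittingField.finiteDimensional _ ((X ^ 2 - C (Δ₁ : ℚ)) * (X ^ 2 - C (Δ₂ : ℚ)))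

instance numberField_compositumField (Δ₁ Δ₂ : ℤ) : NumberField (compositumField Δ₁ Δ₂) where

instance isGalois_compositumField (Δ₁ Δ₂ : ℤ) : IsGalois ℚ (compositumField Δ₁ Δ₂) :=
  have := isSplittingField_compositumField Δ₁ Δ₂
  have : Normal ℚ (compositumField Δ₁ Δ₂) :=
    Normal.of_isSplittingField ((X ^ 2 - C (Δ₁ : ℚ)) * (X ^ 2 - C (Δ₂ : ℚ)))
  {}

/-- F + Fs is a ring because s² = Δ, and it contains the other square root s' = (d/Δ) s. The
unordered hypothesis lets either discriminant play the part of Δ. -/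
theorem exists_coords_compositumField {s s' : compositumField Δ₁ Δ₂} {d : productField Δ₁ Δ₂}
    {Δ Δ' : ℤ} (hΔ : Δ ≠ 0) (hs : s ^ 2 = Δ) (hs' : s' ^ 2 = Δ')
    (hd : (d : compositumField Δ₁ Δ₂) = s * s')
    (h : Δ₁ = Δ ∧ Δ₂ = Δ' ∨ Δ₁ = Δ' ∧ Δ₂ = Δ) (z : compositumField Δ₁ Δ₂) :
    ∃ x y : productField Δ₁ Δ₂, z = x + y * s := by
  have hΔL : (Δ : compositumField Δ₁ Δ₂) ≠ 0 := by exact_mod_cast hΔ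
  have hroot : ∀ z : compositumField Δ₁ Δ₂, z ^ 2 = Δ ∨ z ^ 2 = Δ' →
      ∃ x y : productField Δ₁ Δ₂, z = x + y * s := by
    rintro z (hz | hz)
    · rcases sq_eq_sq_iff_eq_or_eq_neg.1 (hz.trans hs.symm) with rfl | rfl
      · exact ⟨0, 1, by push_cast; ring⟩
      · exact ⟨0, -1, by push_cast; ring⟩
    · have e : s' = d / Δ * s := by
        rw [hd]
        field_simp
        linear_combination -s' * hs
      rcases sq_eq_sq_iff_eq_or_eq_neg.1 (hz.trans hs'.symm) with rfl | rfl
      · exact ⟨0, d / Δ, by push_cast; linear_combination e⟩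
      · exact ⟨0, -d / Δ, by push_cast; linear_combination -e⟩
  let S : Set ℂ := {z : ℂ | z ^ 2 = (Δ₁ : ℂ) ∨ z ^ 2 = (Δ₂ : ℂ)}
  have halg : (compositumField Δ₁ Δ₂).toSubalgebra = Algebra.adjoin ℚ S := by
    refine IntermediateField.adjoin_toSubalgebra_of_isAlgebraic fun x hx => ?_
    have hx' : x ∈ compositumField Δ₁ Δ₂ := IntermediateField.subset_adjoin _ _ hx
    have hx'' : IsAlgebraic ℚ (⟨x, hx'⟩ : compositumField Δ₁ Δ₂) :=
      Algebra.IsAlgebraic.isAlgebraic _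
    exact hx''.algHom (compositumField Δ₁ Δ₂).val
  have hz : (z : ℂ) ∈ Algebra.adjoin ℚ S := halg ▸ z.2
  have key : ∀ w : ℂ, w ∈ Algebra.adjoin ℚ S → ∃ x y : productField Δ₁ Δ₂,
      w = ((x + y * s : compositumField Δ₁ Δ₂) : ℂ) := by
    intro w hw
    induction hw using Algebra.adjoin_induction with
    | mem w hw =>
      have hw' : w ∈ compositumField Δ₁ Δ₂ := IntermediateField.subset_adjoin _ _ hw
      obtain ⟨x, y, hxy⟩ := hroot ⟨w, hw'⟩ (by
        have hcast : ∀ E : ℤ, w ^ 2 = E → (⟨w, hw'⟩ : compositumField Δ₁ Δ₂) ^ 2 = E := by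
          intro E hE
          apply Subtype.ext
          push_cast
          exact hE
        rcases h with ⟨h1, h2⟩ | ⟨h1, h2⟩ <;> rcases hw with hw | hw <;>
          simp only [h1, h2] at hw
        · exact Or.inl (hcast _ hw)
        · exact Or.inr (hcast _ hw)
        · exact Or.inr (hcast _ hw)
        · exact Or.inl (hcast _ hw))
      exact ⟨x, y, congrArg Subtype.val hxy⟩
    | algebraMap q =>
      refine ⟨algebraMap ℚ _ q, 0, ?_⟩
      simp
    | add u v _ _ hu hv =>
      obtain ⟨x, y, hu⟩ := hu
      obtain ⟨x', y', hv⟩ := hv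
      refine ⟨x + x', y + y', ?_⟩
      rw [hu, hv, ← IntermediateField.coe_add]
      congr 1
      push_cast
      ring
    | mul u v _ _ hu hv =>
      obtain ⟨x, y, hu⟩ := hu
      obtain ⟨x', y', hv⟩ := hv
      refine ⟨x * x' + Δ * y * y', x * y' + x' * y, ?_⟩
      rw [hu, hv, ← IntermediateField.coe_mul]
      congr 1
      push_cast
      linear_combination (y * y' : compositumField Δ₁ Δ₂) * hs
  obtain ⟨x, y, hxy⟩ := key z hz
  exact ⟨x, y, Subtype.ext hxy⟩

theorem exists_coords_productField {d : productField Δ₁ Δ₂}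
    (hd : (d : compositumField Δ₁ Δ₂) ^ 2 = Δ₁ * Δ₂) (u : productField Δ₁ Δ₂) :
    ∃ x y : ℚ, (u : compositumField Δ₁ Δ₂) = x + y * d := by
  have halg := IntermediateField.adjoin_toSubalgebra (F := ℚ) (E := compositumField Δ₁ Δ₂)
    {z : compositumField Δ₁ Δ₂ | z ^ 2 = (Δ₁ : compositumField Δ₁ Δ₂) * Δ₂}
  have hu : (u : compositumField Δ₁ Δ₂) ∈ Algebra.adjoin ℚ
    {z : compositumField Δ₁ Δ₂ | z ^ 2 = (Δ₁ : compositumField Δ₁ Δ₂) * Δ₂} := halg ▸ u.2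
  generalize (u : compositumField Δ₁ Δ₂) = w at hu
  induction hu using Algebra.adjoin_induction with
  | mem w hw =>
    rcases sq_eq_sq_iff_eq_or_eq_neg.1 (Eq.trans hw hd.symm) with rfl | rfl
    · exact ⟨0, 1, by push_cast; ring⟩
    · exact ⟨0, -1, by push_cast; ring⟩
  | algebraMap q => exact ⟨q, 0, by simp⟩
  | add u v _ _ hu hv =>
    obtain ⟨x, y, rfl⟩ := hu
    obtain ⟨x', y', rfl⟩ := hv
    exact ⟨x + x', y + y', by push_cast; ring⟩
  | mul u v _ _ hu hv =>
    obtain ⟨x, y, rfl⟩ := hu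
    obtain ⟨x', y', rfl⟩ := hv
    refine ⟨x * x' + Δ₁ * Δ₂ * y * y', x * y' + x' * y, ?_⟩
    push_cast
    linear_combination (y * y' : compositumField Δ₁ Δ₂) * hd

theorem exists_sq_eq_compositumField {Δ : ℤ} (h : Δ = Δ₁ ∨ Δ = Δ₂) :
    ∃ s : compositumField Δ₁ Δ₂, s ^ 2 = Δ := by
  obtain ⟨z, hz⟩ := IsAlgClosed.exists_pow_nat_eq (Δ : ℂ) (n := 2) two_pos
  refine ⟨⟨z, IntermediateField.subset_adjoin _ _ ?_⟩, ?_⟩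
  · rcases h with rfl | rfl
    · exact Or.inl hz
    · exact Or.inr hz
  · apply Subtype.ext
    push_cast
    exact hz

theorem exists_isBiquadraticTower (h₁ : Δ₁ < 0) (h₂ : Δ₂ < 0) (hsq : ¬ IsSquare (Δ₁ * Δ₂))
    {Δ Δ' : ℤ} (h : Δ₁ = Δ ∧ Δ₂ = Δ' ∨ Δ₁ = Δ' ∧ Δ₂ = Δ) :
    ∃ (s : compositumField Δ₁ Δ₂) (d : productField Δ₁ Δ₂),
      IsBiquadraticTower (productField Δ₁ Δ₂) Δ Δ' s d := by
  have hneg : Δ < 0 ∧ Δ' < 0 := by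
    rcases h with ⟨rfl, rfl⟩ | ⟨rfl, rfl⟩
    · exact ⟨h₁, h₂⟩
    · exact ⟨h₂, h₁⟩
  have hmul : Δ₁ * Δ₂ = Δ * Δ' := by
    rcases h with ⟨rfl, rfl⟩ | ⟨rfl, rfl⟩
    · rfl
    · exact mul_comm _ _
  have hmulL : (Δ₁ * Δ₂ : compositumField Δ₁ Δ₂) = Δ * Δ' := by
    exact_mod_cast congrArg (Int.cast : ℤ → compositumField Δ₁ Δ₂) hmul
  obtain ⟨s, hs⟩ := exists_sq_eq_compositumField (Δ₁ := Δ₁) (Δ₂ := Δ₂) (Δ := Δ) (by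
    rcases h with ⟨rfl, rfl⟩ | ⟨rfl, rfl⟩
    · exact Or.inl rfl
    · exact Or.inr rfl)
  obtain ⟨s', hs'⟩ := exists_sq_eq_compositumField (Δ₁ := Δ₁) (Δ₂ := Δ₂) (Δ := Δ') (by
    rcases h with ⟨rfl, rfl⟩ | ⟨rfl, rfl⟩
    · exact Or.inr rfl
    · exact Or.inl rfl)
  have hd : (s * s') ^ 2 = (Δ₁ : compositumField Δ₁ Δ₂) * Δ₂ := by
    rw [mul_pow, hs, hs', hmulL]
  let d : productField Δ₁ Δ₂ := ⟨s * s', IntermediateField.subset_adjoin _ _ hd⟩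
  refine ⟨s, d, ⟨hneg.1, hneg.2, hmul ▸ hsq, hs, hd.trans hmulL, ?_, ?_⟩⟩
  · exact exists_coords_compositumField (d := d) hneg.1.ne hs hs' rfl h
  · exact exists_coords_productField hd

/-- `genusEpsilon` asks for one split prime above p. The root criterion does not depend on the
prime, so any prime above p serves in the converse direction. -/
theorem genusEpsilon_eq_one_iff (h₁ : Δ₁ < 0) (h₂ : Δ₂ < 0) (hf₁ : IsFundamentalDiscriminant Δ₁)
    (hf₂ : IsFundamentalDiscriminant Δ₂) (hcop : IsCoprime Δ₁ Δ₂) {Δ Δ' : ℤ}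
    (h : Δ₁ = Δ ∧ Δ₂ = Δ' ∨ Δ₁ = Δ' ∧ Δ₂ = Δ) {p : ℕ} [hp : Fact p.Prime] {a t c : ℤ}
    (ha : 4 * a = Δ - Δ ^ 2) (ht : 2 ∣ t - Δ₁ * Δ₂) (hc : 4 * c = t ^ 2 - Δ₁ * Δ₂)
    (hpc : (p : ℤ) ∣ c) (hpΔ : ¬ (p : ℤ) ∣ Δ) :
    genusEpsilon Δ₁ Δ₂ p = 1 ↔ HasRootMod p a Δ := by
  have hD := hf₁.mul hf₂ hcop
  have hmul : Δ₁ * Δ₂ = Δ * Δ' := by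
    rcases h with ⟨rfl, rfl⟩ | ⟨rfl, rfl⟩
    · rfl
    · exact mul_comm _ _
  -- Otherwise Δ₁ would be a negative unit, and -1 is not a discriminant.
  have hD1 : Δ₁ * Δ₂ ≠ 1 := by
    intro h1
    have hu : IsUnit Δ₁ := IsUnit.of_mul_eq_one _ h1
    rcases Int.isUnit_iff.1 hu with rfl | rfl
    · omega
    · rcases hf₁ with ⟨h4, -⟩ | ⟨m, hm, -⟩ <;> omega
  obtain ⟨s, d, H⟩ := exists_isBiquadraticTower h₁ h₂ (hD.not_isSquare hD1) h
  have hbot : (Ideal.span {(p : ℤ)}).IsPrime := by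
    rw [Ideal.span_singleton_prime (by exact_mod_cast hp.1.ne_zero)]
    exact Nat.prime_iff_prime_int.1 hp.1
  have hiff : genusEpsilon Δ₁ Δ₂ p = 1 ↔ ∃ 𝔮 ∈ (Ideal.span {(p : ℤ)}).primesOver
      (𝓞 (productField Δ₁ Δ₂)), (𝔮.primesOver (𝓞 (compositumField Δ₁ Δ₂))).ncard = 2 := by
    unfold genusEpsilon genusCharacter
    simp only [ite_eq_left_iff, reduceCtorEq, imp_false, not_not]
  rw [hiff]
  constructor
  · rintro ⟨𝔮, h𝔮, hcard⟩
    rw [hmul] at hD ht hc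
    exact H.hasRootMod_of_ncard_primesOver ha hD ht hc hpc h𝔮 hcard
  · intro hroot
    obtain ⟨𝔮⟩ := (inferInstance :
      Nonempty ((Ideal.span {(p : ℤ)}).primesOver (𝓞 (productField Δ₁ Δ₂))))
    exact ⟨𝔮.1, 𝔮.2, H.ncard_primesOver_of_hasRootMod ha hpΔ hroot 𝔮.2⟩

end Compositum

/-! ### The local structure of the Clifford order -/

section CliffordLocal

variable {Δ₁ Δ₂ t : ℤ}

theorem IsFundamentalDiscriminant.exists_four_mul_eq {Δ : ℤ} (h : IsFundamentalDiscriminant Δ) :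
    ∃ a : ℤ, 4 * a = Δ - Δ ^ 2 := by
  rcases h with ⟨h, -⟩ | ⟨m, rfl, -⟩
  · obtain ⟨k, hk⟩ : ∃ k, Δ = 4 * k + 1 := ⟨Δ / 4, by omega⟩
    exact ⟨-k * (4 * k + 1), by rw [hk]; ring⟩
  · exact ⟨m - 4 * m ^ 2, by ring⟩

theorem IsFundamentalDiscriminant.exists_four_mul_eq_sq_sub {D : ℤ}
    (h : IsFundamentalDiscriminant D) (ht : t ≡ D [ZMOD 2]) : ∃ c : ℤ, 4 * c = t ^ 2 - D := by
  obtain ⟨l, hl⟩ := ht.symm.dvd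
  obtain ⟨a, ha⟩ := h.exists_four_mul_eq
  refine ⟨l ^ 2 + D * l - a, ?_⟩
  have : t = D + 2 * l := by linarith
  rw [this]
  linear_combination -ha

theorem isZOrder_cliffordOrder {a a' : ℤ} (ha : 4 * a = Δ₁ - Δ₁ ^ 2) (ha' : 4 * a' = Δ₂ - Δ₂ ^ 2)
    (ht : t ≡ Δ₁ * Δ₂ [ZMOD 2]) : IsZOrder (cliffordOrder Δ₁ Δ₂ t) := by
  constructor
  · let N : Submodule ℤ (CliffordQuat Δ₁ Δ₂ t) := Submodule.span ℤ
      {1, cliffordGen₁ Δ₁ Δ₂ t, cliffordGen₂ Δ₁ Δ₂ t, cliffordGen₁ Δ₁ Δ₂ t * cliffordGen₂ Δ₁ Δ₂ t}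
    have hN : Module.Finite ℤ N := Module.Finite.span_of_finite ℤ (Set.toFinite _)
    let f : cliffordOrder Δ₁ Δ₂ t →ₗ[ℤ] N :=
      { toFun := fun x => ⟨x, mem_cliffordOrder_span ha ha' ht x.2⟩
        map_add' := fun _ _ => rfl
        map_smul' := fun _ _ => rfl }
    refine Module.Finite.of_injective f fun x y hxy => Subtype.ext ?_
    exact congrArg (fun z : N => (z : CliffordQuat Δ₁ Δ₂ t)) hxy
  · have hcl : Submonoid.closure (cliffordOrder Δ₁ Δ₂ t : Set (CliffordQuat Δ₁ Δ₂ t)) =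
        (cliffordOrder Δ₁ Δ₂ t).toSubmonoid := Submonoid.closure_eq _
    have hspan := Algebra.adjoin_eq_span ℚ (cliffordOrder Δ₁ Δ₂ t : Set (CliffordQuat Δ₁ Δ₂ t))
    rw [hcl] at hspan
    have htop : Algebra.adjoin ℚ (cliffordOrder Δ₁ Δ₂ t : Set (CliffordQuat Δ₁ Δ₂ t)) = ⊤ := by
      rw [eq_top_iff, ← CliffordAlgebra.adjoin_range_ι]
      refine Algebra.adjoin_le ?_
      rintro _ ⟨⟨x, y⟩, rfl⟩
      let A := Algebra.adjoin ℚ (cliffordOrder Δ₁ Δ₂ t : Set (CliffordQuat Δ₁ Δ₂ t))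
      have h1 : CliffordAlgebra.ι (binaryForm Δ₁ Δ₂ t) (1, 0) ∈ A := by
        have e : CliffordAlgebra.ι (binaryForm Δ₁ Δ₂ t) (1, 0) =
            (2 : ℚ) • cliffordGen₁ Δ₁ Δ₂ t - algebraMap ℚ _ (Δ₁ : ℚ) := by
          rw [cliffordGen₁, smul_smul]
          norm_num
        rw [e]
        exact sub_mem (A.smul_mem (Algebra.subset_adjoin gen₁_mem) _) (A.algebraMap_mem _)
      have h2 : CliffordAlgebra.ι (binaryForm Δ₁ Δ₂ t) (0, 1) ∈ A := by
        have e : CliffordAlgebra.ι (binaryForm Δ₁ Δ₂ t) (0, 1) =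
            (2 : ℚ) • cliffordGen₂ Δ₁ Δ₂ t - algebraMap ℚ _ (Δ₂ : ℚ) := by
          rw [cliffordGen₂, smul_smul]
          norm_num
        rw [e]
        exact sub_mem (A.smul_mem (Algebra.subset_adjoin gen₂_mem) _) (A.algebraMap_mem _)
      have e : ((x, y) : ℚ × ℚ) = x • ((1, 0) : ℚ × ℚ) + y • ((0, 1) : ℚ × ℚ) := by
        simp
      rw [e, map_add, map_smul, map_smul]
      exact add_mem (A.smul_mem h1 _) (A.smul_mem h2 _)
    rw [htop, Algebra.top_toSubmodule] at hspan
    exact hspan.symm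

/-- A root of a quadratic polynomial with negative discriminant is not rational. -/
theorem linearIndependent_one_of_neg {B : Type*} [Ring B] [Algebra ℚ B] [Nontrivial B] {a Δ : ℤ}
    (hΔ : Δ < 0) (ha : 4 * a = Δ - Δ ^ 2) {γ : B} (hsq : γ * γ = a • 1 + Δ • γ) (x y : ℤ)
    (hxy : x • (1 : B) + y • γ = 0) : x = 0 ∧ y = 0 := by
  have hinj : ∀ n : ℤ, n • (1 : B) = 0 → n = 0 := by
    intro n hn
    have : algebraMap ℚ B n = 0 := by
      rw [map_intCast, ← hn, zsmul_one]
    have := (algebraMap ℚ B).injective (this.trans (map_zero _).symm)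
    exact_mod_cast this
  have hy : y • γ = -(x • (1 : B)) := (neg_eq_of_add_eq_zero_right hxy).symm
  have hy2 : (y • γ) * (y • γ) = (x * x) • (1 : B) := by
    rw [hy, neg_mul_neg, smul_mul_smul_comm, mul_one]
  have hy3 : (y • γ) * (y • γ) = (y * y * a - Δ * y * x) • (1 : B) := by
    rw [smul_mul_smul_comm, hsq, smul_add, smul_smul, smul_smul,
      show y * y * Δ = (Δ * y) * y by ring, mul_smul (Δ * y) y γ, hy, sub_smul, smul_neg, smul_smul,
      sub_eq_add_neg]
  have h0 : x * x - (y * y * a - Δ * y * x) = 0 := by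
    apply hinj
    rw [sub_smul, ← hy2, ← hy3, sub_self]
  -- Completing the square uses Δ² + 4a = Δ. For Δ < 0 both terms are nonnegative, so y = 0.
  have h1 : (2 * x + Δ * y) ^ 2 - Δ * y ^ 2 = 0 := by
    linear_combination 4 * h0 + y ^ 2 * ha
  have hy0 : y = 0 := by
    by_contra hne
    have : 0 < y ^ 2 := by positivity
    nlinarith [sq_nonneg (2 * x + Δ * y)]
  subst hy0
  refine ⟨?_, rfl⟩
  have : x * x = 0 := by linear_combination h0
  exact mul_self_eq_zero.1 this

/-- By coprimality p misses one of the two discriminants; the corresponding generator spans an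
unramified quadratic algebra at p. -/
theorem exists_local_generator (h₁ : Δ₁ < 0) (h₂ : Δ₂ < 0) (hf₁ : IsFundamentalDiscriminant Δ₁)
    (hf₂ : IsFundamentalDiscriminant Δ₂) (hcop : IsCoprime Δ₁ Δ₂) (ht : t ≡ Δ₁ * Δ₂ [ZMOD 2])
    {c : ℤ} (hc : 4 * c = t ^ 2 - Δ₁ * Δ₂) (p : ℕ) [hp : Fact p.Prime] :
    ∃ Δ Δ' a : ℤ, ∃ γ ∈ cliffordOrder Δ₁ Δ₂ t, (Δ₁ = Δ ∧ Δ₂ = Δ' ∨ Δ₁ = Δ' ∧ Δ₂ = Δ) ∧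
      4 * a = Δ - Δ ^ 2 ∧ ¬ (p : ℤ) ∣ Δ ∧ γ * γ = a • 1 + Δ • γ ∧
      ∃ Φ, IsCompletionAt p Φ (cliffordOrder Δ₁ Δ₂ t) (integralQuat (a : ℤ_[p]) (Δ : ℤ_[p]) c) := by
  by_cases hpΔ : (p : ℤ) ∣ Δ₁
  · have hpΔ₂ : ¬ (p : ℤ) ∣ Δ₂ := fun h =>
      (Nat.prime_iff_prime_int.1 hp.1).not_isUnit (hcop.isUnit_of_dvd' hpΔ h)
    obtain ⟨a, ha⟩ := hf₂.exists_four_mul_eq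
    exact ⟨Δ₂, Δ₁, a, _, gen₂_mem, Or.inr ⟨rfl, rfl⟩, ha, hpΔ₂, gen₂_mul_gen₂ ha,
      exists_isCompletionAt' ha hc h₂.ne ht hpΔ₂⟩
  · obtain ⟨a, ha⟩ := hf₁.exists_four_mul_eq
    exact ⟨Δ₁, Δ₂, a, _, gen₁_mem, Or.inl ⟨rfl, rfl⟩, ha, hpΔ, gen₁_mul_gen₁ ha,
      exists_isCompletionAt ha hc h₁.ne ht hpΔ⟩

/-- The overorders of the Clifford order of `p`-power index, at a prime `p` with `ε(p) = 1` and at a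
prime with `ε(p) = -1`. -/
theorem cliffordOrder_local {Nspl Nns : ℕ} (h₁ : Δ₁ < 0) (h₂ : Δ₂ < 0)
    (hf₁ : IsFundamentalDiscriminant Δ₁) (hf₂ : IsFundamentalDiscriminant Δ₂)
    (hcop : IsCoprime Δ₁ Δ₂) (hH₁ : IsHeegner Nspl Nns Δ₁) (hH₂ : IsHeegner Nspl Nns Δ₂)
    (ht : t ≡ Δ₁ * Δ₂ [ZMOD 2]) {c : ℤ} (hc0 : c ≠ 0) (hc : 4 * c = t ^ 2 - Δ₁ * Δ₂) (p : ℕ)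
    [hp : Fact p.Prime] :
    (((p : ℤ) ∣ c → genusEpsilon Δ₁ Δ₂ p = 1) ∧ ¬ p ∣ Nns ∧
      (∀ R, cliffordOrder Δ₁ Δ₂ t ≤ R → ResiduallySplitAt p R) ∧
      HasMaximalExponent (cliffordOrder Δ₁ Δ₂ t) p (c.natAbs.factorization p) ∧
      ∀ m ≤ c.natAbs.factorization p, (overrings (cliffordOrder Δ₁ Δ₂ t) (p ^ m)).ncard = m + 1) ∨
    (((p : ℤ) ∣ c → genusEpsilon Δ₁ Δ₂ p ≠ 1) ∧ ¬ p ∣ Nspl ∧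
      (∀ R, cliffordOrder Δ₁ Δ₂ t ≤ R → ResiduallyInertAt p R) ∧
      HasMaximalExponent (cliffordOrder Δ₁ Δ₂ t) p (2 * (c.natAbs.factorization p / 2)) ∧
      ∀ k, 2 * k ≤ c.natAbs.factorization p →
        (overrings (cliffordOrder Δ₁ Δ₂ t) (p ^ (2 * k))).ncard = 1) := by
  obtain ⟨Δ, Δ', a, γ, hγ, h, ha, hpΔ, hsq, Φ, hΦ⟩ :=
    exists_local_generator h₁ h₂ hf₁ hf₂ hcop ht hc p
  have hneg : Δ < 0 := by
    rcases h with ⟨rfl, rfl⟩ | ⟨rfl, rfl⟩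
    · exact h₁
    · exact h₂
  have hH : IsHeegner Nspl Nns Δ := by
    rcases h with ⟨rfl, rfl⟩ | ⟨rfl, rfl⟩
    · exact hH₁
    · exact hH₂
  have ht2 : (2 : ℤ) ∣ t - Δ₁ * Δ₂ := ht.symm.dvd
  have hε : (p : ℤ) ∣ c → (genusEpsilon Δ₁ Δ₂ p = 1 ↔ HasRootMod p a Δ) := fun hpc =>
    genusEpsilon_eq_one_iff h₁ h₂ hf₁ hf₂ hcop h ha ht2 hc hpc hpΔ
  have hn : ∀ m : ℕ, (p : ℤ_[p]) ^ m ∣ (c : ℤ_[p]) ↔ m ≤ c.natAbs.factorization p := by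
    intro m
    rw [PadicInt.pow_p_dvd_int_iff, ← hp.1.pow_dvd_iff_le_factorization (Int.natAbs_ne_zero.2 hc0),
      ← Int.natCast_dvd]
    push_cast
    rfl
  have hli := linearIndependent_one_of_neg hneg ha hsq
  -- The symbol of Δ at p is ±1. It decides the local type and, by the Heegner condition, which of
  -- Nspl and Nns the prime p cannot divide.
  rcases kroneckerAtPrime_eq_one_or hpΔ ha with ⟨hk, hroot⟩ | ⟨hk, hroot⟩
  · left
    obtain ⟨r, s, hrs⟩ := exists_splitRoots hroot hpΔ ha
    refine ⟨fun hpc => (hε hpc).2 hroot, fun hdvd => ?_, fun R hR => ?_, ?_, fun m hm => ?_⟩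
    · have := hH.2 p hp.1 hdvd
      omega
    · exact residuallySplitAt_of_hasRootMod hroot hpΔ ha (hR hγ) hsq hli
    · exact hΦ.hasMaximalExponent (hrs.hasMaximalExponent hn)
    · rw [hΦ.ncard_overrings, hrs.ncard_overrings ((hn m).2 hm)]
  · right
    have hdisc := isUnit_disc hpΔ ha
    have haniso := anisotropic_of_not_hasRootMod hroot
    refine ⟨fun hpc => mt (hε hpc).1 hroot, fun hdvd => ?_, fun R hR => ?_, ?_, fun k hk => ?_⟩
    · have := hH.1 p hp.1 hdvd
      omega
    · exact residuallyInertAt_of_not_hasRootMod hroot hpΔ ha (hR hγ) hsq hli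
    · exact hΦ.hasMaximalExponent (inert_hasMaximalExponent hdisc haniso hn)
    · rw [hΦ.ncard_overrings, inert_ncard_overrings hdisc haniso ((hn _).2 hk)]

end CliffordLocal

/-! ### The global count -/

open Classical in
/-- The exponent of `p` in the index of the Clifford order in a maximal order. -/
noncomputable def cliffordExponent (Δ₁ Δ₂ c : ℤ) (p : ℕ) : ℕ :=
  if genusEpsilon Δ₁ Δ₂ p = 1 then c.natAbs.factorization p else 2 * (c.natAbs.factorization p / 2)

theorem cliffordExponent_eq_zero {Δ₁ Δ₂ c : ℤ} {p : ℕ} (h : ¬ (p : ℤ) ∣ c) :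
    cliffordExponent Δ₁ Δ₂ c p = 0 := by
  have h0 : c.natAbs.factorization p = 0 :=
    Nat.factorization_eq_zero_of_not_dvd fun h' => h (Int.natCast_dvd.2 h')
  unfold cliffordExponent
  rw [h0]
  split_ifs <;> rfl

theorem mainTheorem6 (Nspl Nns : ℕ) (hNspl : 0 < Nspl) (hNns : 0 < Nns)
    (hN : Nspl.Coprime Nns) (Δ₁ Δ₂ : ℤ) (hΔ₁ : Δ₁ < 0) (hΔ₂ : Δ₂ < 0)
    (hfund₁ : IsFundamentalDiscriminant Δ₁) (hfund₂ : IsFundamentalDiscriminant Δ₂)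
    (hcop : IsCoprime Δ₁ Δ₂) (hH₁ : IsHeegner Nspl Nns Δ₁) (hH₂ : IsHeegner Nspl Nns Δ₂)
    (t : ℤ) (ht : t ≡ Δ₁ * Δ₂ [ZMOD 2]) (ht' : t ^ 2 ≠ Δ₁ * Δ₂)
    (hdvd : (Nspl * Nns) ^ 2 ∣ reducedDisc (cliffordOrder Δ₁ Δ₂ t)) :
    (mixedCartanOver Δ₁ Δ₂ t Nspl Nns).Finite ∧
      ((mixedCartanOver Δ₁ Δ₂ t Nspl Nns).ncard : ℤ) =
        ∏ p ∈ (reducedDisc (cliffordOrder Δ₁ Δ₂ t)).primeFactors with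
            genusEpsilon Δ₁ Δ₂ p = 1,
          (1 + padicValRat p
            (((Δ₁ * Δ₂ - t ^ 2 : ℤ) : ℚ) / (4 * ((Nspl * Nns : ℕ) : ℚ) ^ 2))) := by
  obtain ⟨a, ha⟩ := hfund₁.exists_four_mul_eq
  obtain ⟨a', ha'⟩ := hfund₂.exists_four_mul_eq
  obtain ⟨c, hc⟩ := (hfund₁.mul hfund₂ hcop).exists_four_mul_eq_sq_sub ht
  have hc0 : c ≠ 0 := by
    rintro rfl
    exact ht' (by linarith)
  have hdisc : reducedDisc (cliffordOrder Δ₁ Δ₂ t) = c.natAbs :=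
    reducedDisc_cliffordOrder ha ha' hc hΔ₁.ne ht
  have hcn : c.natAbs ≠ 0 := Int.natAbs_ne_zero.2 hc0
  have hS : IsZOrder (cliffordOrder Δ₁ Δ₂ t) := isZOrder_cliffordOrder ha ha' ht
  have hlocal := fun (p : ℕ) (hp : p.Prime) =>
    have : Fact p.Prime := ⟨hp⟩
    cliffordOrder_local hΔ₁ hΔ₂ hfund₁ hfund₂ hcop hH₁ hH₂ ht hc0 hc p
  rw [hdisc] at hdvd ⊢
  set N := Nspl * Nns with hNdef
  have hN0 : N ≠ 0 := Nat.mul_ne_zero hNspl.ne' hNns.ne'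
  have hmax : ∀ p, p.Prime → HasMaximalExponent (cliffordOrder Δ₁ Δ₂ t) p
      (cliffordExponent Δ₁ Δ₂ c p) := by
    intro p hp
    by_cases hpc : (p : ℤ) ∣ c
    · rcases hlocal p hp with ⟨hε, -, -, h, -⟩ | ⟨hε, -, -, h, -⟩
      · rwa [cliffordExponent, if_pos (hε hpc)]
      · rwa [cliffordExponent, if_neg (hε hpc)]
    · rw [cliffordExponent_eq_zero hpc]
      have h0 : c.natAbs.factorization p = 0 :=
        Nat.factorization_eq_zero_of_not_dvd fun h' => hpc (Int.natCast_dvd.2 h')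
      rcases hlocal p hp with ⟨-, -, -, h, -⟩ | ⟨-, -, -, h, -⟩ <;> rwa [h0] at h
  have hle : ∀ p, 2 * N.factorization p ≤ c.natAbs.factorization p := by
    intro p
    have := (Nat.factorization_le_iff_dvd (pow_ne_zero 2 hN0) hcn).2 hdvd p
    rwa [Nat.factorization_pow, Finsupp.smul_apply, smul_eq_mul] at this
  -- Rounding down to an even number does not go below the even number 2 ord_p N.
  have hle' : ∀ p, 2 * N.factorization p ≤ cliffordExponent Δ₁ Δ₂ c p := by
    intro p
    have := hle p
    unfold cliffordExponent
    split_ifs <;> omega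
  have hP : ∀ p ∈ c.natAbs.primeFactors, p.Prime := fun p hp => Nat.prime_of_mem_primeFactors hp
  have hNprod : N ^ 2 = ∏ p ∈ c.natAbs.primeFactors, p ^ (2 * N.factorization p) := by
    have hsub : N.factorization.support ⊆ c.natAbs.primeFactors := by
      rw [Nat.support_factorization]
      exact Nat.primeFactors_mono ((Dvd.intro_left _ (pow_succ N 1).symm).trans hdvd) hcn
    conv_lhs => rw [← Nat.prod_factorization_pow_eq_self hN0]
    rw [Finsupp.prod_of_support_subset _ hsub _ (fun _ _ => pow_zero _), ← Finset.prod_pow]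
    exact Finset.prod_congr rfl fun p _ => by rw [← pow_mul, mul_comm]
  have hd : N ^ 2 * ∏ p ∈ c.natAbs.primeFactors,
      p ^ (cliffordExponent Δ₁ Δ₂ c p - 2 * N.factorization p) =
      ∏ p ∈ c.natAbs.primeFactors, p ^ cliffordExponent Δ₁ Δ₂ c p := by
    rw [hNprod, ← Finset.prod_mul_distrib]
    exact Finset.prod_congr rfl fun p _ => by rw [← pow_add, Nat.add_sub_cancel' (hle' p)]
  have hμ0 : ∀ p, p.Prime → p ∉ c.natAbs.primeFactors → cliffordExponent Δ₁ Δ₂ c p = 0 := by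
    intro p hp hpP
    refine cliffordExponent_eq_zero fun h => hpP ?_
    exact Nat.mem_primeFactors.2 ⟨hp, Int.natCast_dvd.1 h, hcn⟩
  -- The residual conditions hold for every overring, so only the index condition remains, and it
  -- fixes the index over the Clifford order.
  have hset : mixedCartanOver Δ₁ Δ₂ t Nspl Nns = overrings (cliffordOrder Δ₁ Δ₂ t)
      (∏ p ∈ c.natAbs.primeFactors, p ^ (cliffordExponent Δ₁ Δ₂ c p - 2 * N.factorization p)) := by
    ext R
    constructor
    · rintro ⟨hR, hSR⟩
      exact (index_in_maximal_iff hP hmax hμ0 hS hd hSR).1 ⟨hR.isZOrder, hR.index_eq⟩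
    · intro hR
      have hSR : cliffordOrder Δ₁ Δ₂ t ≤ R := hR.1
      obtain ⟨hRO, hRi⟩ := (index_in_maximal_iff hP hmax hμ0 hS hd hSR).2 hR
      refine ⟨⟨hRO, fun p hp hpR => ?_, hRi, fun p hp hpN => ?_, fun p hp hpN => ?_⟩, hSR⟩
      · rcases hlocal p hp.1 with ⟨-, -, h, -, -⟩ | ⟨-, -, h, -, -⟩
        · exact Or.inl (h R hSR)
        · exact Or.inr (h R hSR)
      · rcases hlocal p hp.1 with ⟨-, -, h, -, -⟩ | ⟨-, hn, -, -, -⟩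
        · exact h R hSR
        · exact absurd hpN hn
      · rcases hlocal p hp.1 with ⟨-, hn, -, -, -⟩ | ⟨-, -, h, -, -⟩
        · exact absurd hpN hn
        · exact h R hSR
  have hcount : ∀ p ∈ c.natAbs.primeFactors, (overrings (cliffordOrder Δ₁ Δ₂ t)
      (p ^ (cliffordExponent Δ₁ Δ₂ c p - 2 * N.factorization p))).ncard =
      if genusEpsilon Δ₁ Δ₂ p = 1
      then 1 + (c.natAbs.factorization p - 2 * N.factorization p) else 1 := by
    intro p hpP
    have hpc : (p : ℤ) ∣ c := Int.natCast_dvd.2 (Nat.dvd_of_mem_primeFactors hpP)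
    rcases hlocal p (hP p hpP) with ⟨hε, -, -, -, h⟩ | ⟨hε, -, -, -, h⟩
    · rw [cliffordExponent, if_pos (hε hpc), if_pos (hε hpc), h _ (Nat.sub_le _ _), add_comm]
    -- In the inert case the exponent is twice a difference, so exactly one local overring exists.
    · rw [cliffordExponent, if_neg (hε hpc), if_neg (hε hpc), ← Nat.mul_sub]
      exact h _ (by omega)
  have hcard : (mixedCartanOver Δ₁ Δ₂ t Nspl Nns).ncard =
      ∏ p ∈ c.natAbs.primeFactors with genusEpsilon Δ₁ Δ₂ p = 1,
        (1 + (c.natAbs.factorization p - 2 * N.factorization p)) := by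
    rw [hset, ncard_overrings_prod _ hP, Finset.prod_congr rfl hcount, Finset.prod_filter]
  -- An infinite set has `ncard` 0, whereas every factor here is at least 1.
  refine ⟨Set.finite_of_ncard_ne_zero ?_, ?_⟩
  · rw [hcard]
    exact Finset.prod_ne_zero_iff.2 fun p _ => by omega
  · rw [hcard]
    push_cast
    refine Finset.prod_congr rfl fun p hp => ?_
    have hpp : p.Prime := hP p (Finset.mem_filter.1 hp).1
    have : Fact p.Prime := ⟨hpp⟩
    -- The quotient in the statement is -c/N²; the sign does not affect the valuation.
    have hq : ((Δ₁ : ℚ) * Δ₂ - t ^ 2) / (4 * (N : ℚ) ^ 2) = ((-c : ℤ) : ℚ) / (N : ℚ) ^ 2 := by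
      have hcq : (4 * c : ℚ) = t ^ 2 - Δ₁ * Δ₂ := by exact_mod_cast hc
      have hNq : (N : ℚ) ≠ 0 := by exact_mod_cast hN0
      push_cast
      field_simp
      linear_combination hcq
    -- The truncated subtraction is a true one because N² divides the discriminant.
    rw [Nat.cast_sub (hle p)]
    congr 1
    rw [hq, padicValRat.div (by exact_mod_cast neg_ne_zero.2 hc0) (by positivity),
      padicValRat.pow, padicValRat.of_int, padicValRat.of_nat, Nat.factorization_def _ hpp,
      Nat.factorization_def _ hpp, padicValInt, Int.natAbs_neg]
    push_cast
    ring
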